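/- **Definitions.** A primitive group is one of $\mathbb Z$, $\mathbb R$, $\mathbb Z_N$ ($N\ge 1$, discrete), $\mathbb T=\mathbb R/\mathbb Z$, with characteristic $0,0,N,1$ respectively. An elementary Abelian group is a finite product $G=G_1\times\dots\times G_m$ of primitive groups with the product topology. For $x\in\mathbb R^m$ and $g\in G$ write $x\equiv g\pmod G$ if each coordinate $x_i$ is congruent to $g_i$ modulo the characteristic of $G_i$ (equality for $\mathbb Z$ and $\mathbb R$; for $\mathbb Z_N$, $x_i$ is an integer in the class $g_i$; for $\mathbb T$, $x_i$ lies in the coset $g_i$). A real $n\times m$ matrix $A$ is a matrix representation of a homomorphism $\alpha:G\to H=H_1\times\dots\times H_n$ if $Ax\equiv\alpha(g)\pmod H$ for all $g\in G$ and all $x\in\mathbb R^m$ with $x\equiv g\pmod G$. **Theorem.** There are two deterministic algorithms, using exact integer arithmetic, and a polynomial $T$ in six variables with the following property. Let $G=G_1\times\dots\times G_m$ and $H=H_1\times\dots\times H_n$ be elementary Abelian groups, let $c_i$ and $d_j$ be the characteristics of $G_i$ and $H_j$, let $A$ be a rational matrix representation of a continuous homomorphism $\alpha:G\to H$, and let the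 rational tuple $b$ represent an element of $H$. Given the groups $G,H$ (as lists of types and characteristics of their factors), $A$ and $b$: 1. the first algorithm decides whether the system $\alpha(x)\equiv Ax\equiv b\pmod H$, $x\in G$, has a solution; 2. the second algorithm finds a general solution $(x_0,\mathcal E)$ if the system is solvable, and reports that there is none otherwise. Here $x_0\in G$ is a solution, output as a rational tuple congruent to it, and $\mathcal E$ is a continuous homomorphism from a group $\mathbb R^r\times\mathbb Z^k$ to $G$ whose image is $\ker\alpha$, output as the numbers $r,k$ and a rational matrix representation of $\mathcal E$. On every such input both algorithms run in worst-case time at most $$T\bigl(m,\ n,\ \|A\|_{\mathbf b},\ \|b\|_{\mathbf b},\ \max_i \ell(c_i),\ \max_j \ell(d_j)\bigr).$$ Here $\|X\|_{\mathbf b}$ is the maximal number of bits of a coefficient of $X$ (a rational number in lowest terms, stored as numerator and denominator), $\ell(c)$ is the binary length of $c$ (with $\ell(0)=0$, so $\ell(c)=\lfloor\log_2 c\rfloor+1$ for $c\ge 1$), a maximum over the empty set is $0$, and time is the logarithmic (bit) cost on a random access machine: each operation is charged the bit lengths of the integers involved. -/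

import Mathlib

/-! ### Elementary Abelian groups -/

/-- The primitive groups `ℤ`, `ℝ`, `ℤ_N` (with `N ≥ 1`) and `𝕋 = ℝ / ℤ`. -/
inductive Primitive : Type
  | int : Primitive
  | real : Primitive
  | cyclic (N : ℕ+) : Primitive
  | circle : Primitive

namespace Primitive

/-- The underlying type of a primitive group. -/
def Carrier : Primitive → Type
  | int => ℤ
  | real => ℝ
  | cyclic N => ZMod (N : ℕ)
  | circle => UnitAddCircle

noncomputable instance : (P : Primitive) → AddCommGroup P.Carrier
  | int => inferInstanceAs (AddCommGroup ℤ)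
  | real => inferInstanceAs (AddCommGroup ℝ)
  | cyclic N => inferInstanceAs (AddCommGroup (ZMod (N : ℕ)))
  | circle => inferInstanceAs (AddCommGroup UnitAddCircle)

/-- The usual topologies; `ℤ_N` is discrete. -/
instance : (P : Primitive) → TopologicalSpace P.Carrier
  | int => inferInstanceAs (TopologicalSpace ℤ)
  | real => inferInstanceAs (TopologicalSpace ℝ)
  | cyclic _ => ⊥
  | circle => inferInstanceAs (TopologicalSpace UnitAddCircle)

/-- The characteristic of a primitive group. -/
def char : Primitive → ℕ
  | int => 0
  | real => 0
  | cyclic N => N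
  | circle => 1

/-- The real number `x` is congruent to the group element `g` modulo the characteristic.
For `ℤ` and `ℝ` this means equality; for `ℤ_N` it means that `x` is an integer in the
residue class `g`; for `𝕋` it means that `x` is in the coset `g` of `ℤ` in `ℝ`. -/
def Congr : (P : Primitive) → ℝ → P.Carrier → Prop
  | int, x, g => x = ((show ℤ from g) : ℝ)
  | real, x, g => x = (show ℝ from g)
  | cyclic N, x, g => ∃ k : ℤ, x = (k : ℝ) ∧ (k : ZMod (N : ℕ)) = (show ZMod (N : ℕ) from g)
  | circle, x, g => (x : UnitAddCircle) = (show UnitAddCircle from g)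

/-- Description of a primitive group by integers: a tag for its type, and its
characteristic. -/
def encode : Primitive → List ℤ
  | int => [0, 0]
  | real => [1, 0]
  | cyclic N => [2, ((N : ℕ) : ℤ)]
  | circle => [3, 1]

end Primitive

/-- The elementary Abelian group `G_1 × ⋯ × G_m`, with the product topology. -/
abbrev ElementaryGroup {m : ℕ} (G : Fin m → Primitive) : Type :=
  (i : Fin m) → (G i).Carrier

/-- `x ≡ g (mod G)` for a real tuple `x` and a group element `g`. -/
def TupleCongr {m : ℕ} (G : Fin m → Primitive) (x : Fin m → ℝ) (g : ElementaryGroup G) : Prop :=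
  ∀ i, (G i).Congr (x i) (g i)

/-- The real `n × m` matrix `A` is a matrix representation of `φ : G → H`:
`A x ≡ φ(g) (mod H)` for every `g ∈ G` and every real tuple `x ≡ g (mod G)`. -/
def IsMatrixRep {m n : ℕ} {G : Fin m → Primitive} {H : Fin n → Primitive}
    (φ : ElementaryGroup G →ₜ+ ElementaryGroup H) (A : Matrix (Fin n) (Fin m) ℝ) : Prop :=
  ∀ (g : ElementaryGroup G) (x : Fin m → ℝ), TupleCongr G x g → TupleCongr H (A.mulVec x) (φ g)

/-- The factors of the group `ℝ^r × ℤ^k`. -/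
def realIntFactors (r k : ℕ) : Fin (r + k) → Primitive :=
  Fin.append (fun _ : Fin r => Primitive.real) (fun _ : Fin k => Primitive.int)

/-- `(x₀, E)` is a general solution of `φ(x) = h`: `x₀` is a solution, and `E` is a continuous
homomorphism from `ℝ^r × ℤ^k` to `G` whose image is the kernel of `φ`. -/
def IsGeneralSolution {m n : ℕ} {G : Fin m → Primitive} {H : Fin n → Primitive}
    (φ : ElementaryGroup G →ₜ+ ElementaryGroup H) (h : ElementaryGroup H) {r k : ℕ}
    (x₀ : ElementaryGroup G) (E : ElementaryGroup (realIntFactors r k) →ₜ+ ElementaryGroup G) :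
    Prop :=
  φ x₀ = h ∧ E.toAddMonoidHom.range = φ.toAddMonoidHom.ker

/-! ### Bit sizes and encodings -/

/-- The number of bits of a rational number in lowest terms. -/
def ratBits (q : ℚ) : ℕ := Nat.size q.num.natAbs + Nat.size q.den

/-- The number of bits sufficient to store any one coefficient of a rational tuple. -/
def vecBits {n : ℕ} (v : Fin n → ℚ) : ℕ := Finset.univ.sup fun j => ratBits (v j)

/-- The number of bits sufficient to store any one coefficient of a rational matrix. -/
def matBits {n m : ℕ} (A : Matrix (Fin n) (Fin m) ℚ) : ℕ :=
  Finset.univ.sup fun i => vecBits (A i)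

/-- The largest bit length of a characteristic of a factor of `G`. -/
def charBits {m : ℕ} (G : Fin m → Primitive) : ℕ :=
  Finset.univ.sup fun i => Nat.size (G i).char

/-- A rational number is given by its numerator and denominator, in lowest terms. -/
def encodeRat (q : ℚ) : List ℤ := [q.num, (q.den : ℤ)]

/-- Rational tuples, coefficient by coefficient. -/
def encodeVec {n : ℕ} (v : Fin n → ℚ) : List ℤ := (List.ofFn fun j => encodeRat (v j)).flatten

/-- Rational matrices, row by row. -/
def encodeMat {n m : ℕ} (A : Matrix (Fin n) (Fin m) ℚ) : List ℤ :=
  (List.ofFn fun i => encodeVec (A i)).flatten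

/-- Elementary Abelian groups, factor by factor. -/
def encodeGroup {m : ℕ} (G : Fin m → Primitive) : List ℤ :=
  (List.ofFn fun i => (G i).encode).flatten

/-- The input that describes the system `A x ≡ b (mod H)`, `x ∈ G`. -/
def encodeSystem {m n : ℕ} (G : Fin m → Primitive) (H : Fin n → Primitive)
    (A : Matrix (Fin n) (Fin m) ℚ) (b : Fin n → ℚ) : List ℤ :=
  [(m : ℤ), (n : ℤ)] ++ encodeGroup G ++ encodeGroup H ++ encodeMat A ++ encodeVec b

/-- The output that describes a general solution: the flag `1`, the exponents of `ℝ^r × ℤ^k`,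
the tuple `x₀` and the matrix `E`. -/
def encodeSolution {m r k : ℕ} (x₀ : Fin m → ℚ) (E : Matrix (Fin m) (Fin (r + k)) ℚ) : List ℤ :=
  [1, (r : ℤ), (k : ℤ)] ++ encodeVec x₀ ++ encodeMat E

/-- The value of a polynomial in six variables at the parameters of the system: the numbers
`m`, `n` of factors, the bit sizes of `A` and `b`, and the logarithms of the characteristics. -/
noncomputable def timeBound {m n : ℕ} (T : MvPolynomial (Fin 6) ℕ) (G : Fin m → Primitive)
    (H : Fin n → Primitive) (A : Matrix (Fin n) (Fin m) ℚ) (b : Fin n → ℚ) : ℕ :=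
  MvPolynomial.eval ![m, n, matBits A, vecBits b, charBits G, charBits H] T

/-! ### The machine model: a random access machine with logarithmic cost

Memory cells hold integers of arbitrary size. Every operation is charged the bit lengths of
all the numbers involved (operands, result and, for an array access, the index), so that the
cost of a run is polynomially related to the running time of a Turing machine. Programs are
finite while programs. -/

namespace LogRAM

/-- The elementary operations. -/
inductive BinOp : Type
  | add | sub | mul | div | mod | lt | eq

/-- Integer arithmetic (with Euclidean division, and `x / 0 = 0`, `x % 0 = x`);
comparisons give `1` or `0`. -/
def BinOp.eval : BinOp → ℤ → ℤ → ℤ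
  | .add, x, y => x + y
  | .sub, x, y => x - y
  | .mul, x, y => x * y
  | .div, x, y => x / y
  | .mod, x, y => x % y
  | .lt, x, y => if x < y then 1 else 0
  | .eq, x, y => if x = y then 1 else 0

/-- The contents of memory: integer variables, arrays of integers, and the list of the
integers that have been output so far. -/
structure State : Type where
  /-- the value of each variable -/
  var : ℕ → ℤ
  /-- the entries of each array -/
  arr : ℕ → ℤ → ℤ
  /-- the output -/
  out : List ℤ

/-- Expressions: constants, variables, array entries and elementary operations. -/
inductive Expr : Type
  | const (z : ℤ) : Expr
  | var (i : ℕ) : Expr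
  | get (a : ℕ) (e : Expr) : Expr
  | op (o : BinOp) (e f : Expr) : Expr

/-- The bit length of an integer, with a bit for the sign. -/
def len (z : ℤ) : ℕ := Nat.size z.natAbs + 1

/-- The value of an expression. -/
def Expr.eval (s : State) : Expr → ℤ
  | .const z => z
  | .var i => s.var i
  | .get a e => s.arr a (e.eval s)
  | .op o e f => o.eval (e.eval s) (f.eval s)

/-- The cost of evaluating an expression. -/
def Expr.cost (s : State) : Expr → ℕ
  | .const z => len z
  | .var i => len (s.var i)
  | .get a e => e.cost s + len (e.eval s) + len (s.arr a (e.eval s))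
  | .op o e f => e.cost s + f.cost s + len (e.eval s) + len (f.eval s) +
      len (o.eval (e.eval s) (f.eval s))

/-- Programs. -/
inductive Program : Type
  | skip : Program
  | assign (i : ℕ) (e : Expr) : Program
  | store (a : ℕ) (idx e : Expr) : Program
  | emit (e : Expr) : Program
  | seq (p q : Program) : Program
  | branch (e : Expr) (p q : Program) : Program
  | loop (e : Expr) (p : Program) : Program

/-- `Exec p s s' t`: started in state `s`, the program `p` halts in state `s'`, at cost `t`. -/
inductive Exec : Program → State → State → ℕ → Prop
  | skip (s : State) : Exec .skip s s 1
  | assign (i : ℕ) (e : Expr) (s : State) :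
      Exec (.assign i e) s { s with var := Function.update s.var i (e.eval s) } (e.cost s + 1)
  | store (a : ℕ) (idx e : Expr) (s : State) :
      Exec (.store a idx e) s
        { s with
          arr := (Function.update s.arr a (Function.update (s.arr a) (idx.eval s) (e.eval s))) }
        (idx.cost s + e.cost s + 1)
  | emit (e : Expr) (s : State) :
      Exec (.emit e) s { s with out := s.out ++ [e.eval s] } (e.cost s + 1)
  | seq {p q : Program} {s₁ s₂ s₃ : State} {t u : ℕ} :
      Exec p s₁ s₂ t → Exec q s₂ s₃ u → Exec (.seq p q) s₁ s₃ (t + u)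
  | branch_true {e : Expr} {p q : Program} {s s' : State} {t : ℕ} :
      e.eval s ≠ 0 → Exec p s s' t → Exec (.branch e p q) s s' (e.cost s + 1 + t)
  | branch_false {e : Expr} {p q : Program} {s s' : State} {t : ℕ} :
      e.eval s = 0 → Exec q s s' t → Exec (.branch e p q) s s' (e.cost s + 1 + t)
  | loop_done {e : Expr} {p : Program} {s : State} :
      e.eval s = 0 → Exec (.loop e p) s s (e.cost s + 1)
  | loop_step {e : Expr} {p : Program} {s₁ s₂ s₃ : State} {t u : ℕ} :
      e.eval s₁ ≠ 0 → Exec p s₁ s₂ t → Exec (.loop e p) s₂ s₃ u →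
        Exec (.loop e p) s₁ s₃ (e.cost s₁ + 1 + t + u)

/-- The machine is deterministic: the final state and the cost are determined by the program
and the initial state. -/
theorem Exec.deterministic {p : Program} {s s₁ : State} {t₁ : ℕ} (h₁ : Exec p s s₁ t₁) :
    ∀ {s₂ : State} {t₂ : ℕ}, Exec p s s₂ t₂ → s₁ = s₂ ∧ t₁ = t₂ := by
  induction h₁ with
  | skip s => intro s₂ t₂ h; cases h; exact ⟨rfl, rfl⟩
  | assign i e s => intro s₂ t₂ h; cases h; exact ⟨rfl, rfl⟩
  | store a idx e s => intro s₂ t₂ h; cases h; exact ⟨rfl, rfl⟩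
  | emit e s => intro s₂ t₂ h; cases h; exact ⟨rfl, rfl⟩
  | seq _ _ ih₁ ih₂ =>
    intro s₂ t₂ h
    cases h with
    | seq a b =>
      obtain ⟨rfl, rfl⟩ := ih₁ a
      obtain ⟨rfl, rfl⟩ := ih₂ b
      exact ⟨rfl, rfl⟩
  | branch_true he _ ih =>
    intro s₂ t₂ h
    cases h with
    | branch_true _ a => obtain ⟨rfl, rfl⟩ := ih a; exact ⟨rfl, rfl⟩
    | branch_false he' _ => exact absurd he' he
  | branch_false he _ ih =>
    intro s₂ t₂ h
    cases h with
    | branch_true he' _ => exact absurd he he'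
    | branch_false _ a => obtain ⟨rfl, rfl⟩ := ih a; exact ⟨rfl, rfl⟩
  | loop_done he =>
    intro s₂ t₂ h
    cases h with
    | loop_done _ => exact ⟨rfl, rfl⟩
    | loop_step he' _ _ => exact absurd he he'
  | loop_step he _ _ ih₁ ih₂ =>
    intro s₂ t₂ h
    cases h with
    | loop_done he' => exact absurd he' he
    | loop_step _ a b =>
      obtain ⟨rfl, rfl⟩ := ih₁ a
      obtain ⟨rfl, rfl⟩ := ih₂ b
      exact ⟨rfl, rfl⟩

/-- Initially array `0` holds the input, variable `0` its length, everything else is zero, and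
nothing has been output. -/
def initial (input : List ℤ) : State where
  var i := if i = 0 then (input.length : ℤ) else 0
  arr a k := if a = 0 ∧ 0 ≤ k then input.getD k.toNat 0 else 0
  out := []

/-- On the given input, the program halts with the given output, at cost at most `T`. -/
def OutputsWithin (p : Program) (input output : List ℤ) (T : ℕ) : Prop :=
  ∃ (s : State) (t : ℕ), Exec p (initial input) s t ∧ s.out = output ∧ t ≤ T

end LogRAM

/-!
The solvability of `α(x) = h` is a question about a mixed system of linear equations. Let `Δ` be a
common denominator of `A` and `b`. A real tuple `x` represents a solution if and only if there are
integers `y` with `Δ (∑ i, A r i * x i - d r * y r - b r * s) = 0` for all `r` and `s = 1`, where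
`x i` is an arbitrary real number if `G i` is `ℝ` or `𝕋`, and an integer otherwise. The solutions of
the homogeneous system with `s = 0` represent the kernel (`apply_eq_iff_exists_mixedSolution`). So
`N = m + n + 1` unknowns have to be found, some real and some integral, subject to integral
equations.

Fraction-free elimination, which prefers real unknowns as pivots, parametrizes the real solutions
`z` of the equations as `z = W v / D`, where the parameters `v` are coordinates of `z`. The entries
of `W` and `D` are cofactors and the determinant of a matrix whose rows are, up to sign, rows of the
system or unit vectors (`Elimination`). This makes the divisions exact and bounds all numbers by
`N! * μ ^ N`, if `μ` bounds the coefficients. Because of the choice of the pivots, an integral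
unknown depends on integral parameters only (`Elimination.separated`). Hence the mixed solutions
correspond to arbitrary real parameters together with the integer parameter vectors `v` for which
`D` divides the integral coordinates of `W v`.

These vectors form a lattice that contains `D ℤ ^ N`, and it is computed by adding one congruence
`ω v ≡ 0 (mod D)` at a time: the Euclidean algorithm is run on the pairs of a generator and its
residue `ω v`, starting with the additional pair `(0, D)`, until all residues but one vanish
(`Residues`). Everything is reduced modulo `D`, so that the numbers do not grow. Finally, one more
run for the coordinate `s` leaves generators with `s ≡ 0`, which give the kernel, and one vector
with `s ≡ g`, where `g` is the greatest common divisor of `D` and the values of `s` on the lattice.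
The system is solvable if and only if the equations do not force `s = 0` and `g = 1`
(`Elimination.exists_solution_iff`), and then the last vector gives a particular solution
(`exists_isGeneralSolution`).

The programs are verified with a Hoare logic, `Achieves X R p s Q`, that also counts costs: if all
memory cells remain bounded by `X` and no loop makes more than `R` iterations, then the cost is at
most `p.steps R * (X.size + 1)`, where `p.steps R` is a polynomial in `R`. Here the bit length of
`X` and the number `R` are polynomially bounded in the parameters of the system
(`capacity_spec`); for the Euclidean algorithm this is the usual logarithmic bound for the number of
divisions (`euclidMeasure_lt`).
-/

open Matrix

namespace LogRAM

/-! ### Cost accounting for programs with bounded memory -/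

theorem len_mono {x y : ℤ} (h : |x| ≤ |y|) : len x ≤ len y := by
  unfold len
  have : x.natAbs ≤ y.natAbs := by
    rw [Int.abs_eq_natAbs, Int.abs_eq_natAbs] at h; exact_mod_cast h
  exact Nat.add_le_add_right (Nat.size_le_size this) 1

theorem one_le_len (x : ℤ) : 1 ≤ len x := by unfold len; omega

theorem len_add_le (x y : ℤ) : len (x + y) ≤ len x + len y := by
  unfold len
  have h1 := Nat.lt_size_self x.natAbs
  have h2 := Nat.lt_size_self y.natAbs
  have h : (x + y).natAbs < 2 ^ (x.natAbs.size + y.natAbs.size + 1) := by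
    have h3 : 2 ^ x.natAbs.size ≤ 2 ^ (x.natAbs.size + y.natAbs.size) :=
      Nat.pow_le_pow_right (by norm_num) (by omega)
    have h4 : 2 ^ y.natAbs.size ≤ 2 ^ (x.natAbs.size + y.natAbs.size) :=
      Nat.pow_le_pow_right (by norm_num) (by omega)
    have := Int.natAbs_add_le x y
    rw [pow_succ]; omega
  have := Nat.size_le.2 h
  omega

theorem len_mul_le (x y : ℤ) : len (x * y) ≤ len x + len y := by
  unfold len
  have h1 := Nat.lt_size_self x.natAbs
  have h2 := Nat.lt_size_self y.natAbs
  have h : (x * y).natAbs < 2 ^ (x.natAbs.size + y.natAbs.size) := by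
    rw [Int.natAbs_mul, pow_add]
    exact Nat.mul_lt_mul'' h1 h2
  have := Nat.size_le.2 h
  omega

theorem abs_ediv_le (x y : ℤ) : |x / y| ≤ |x| := by
  rw [Int.abs_eq_natAbs, Int.abs_eq_natAbs]
  exact_mod_cast Int.natAbs_ediv_le_natAbs x y

/-- Every elementary operation at most adds the bit lengths of its operands. -/
theorem BinOp.len_eval_le (o : BinOp) (x y : ℤ) : len (o.eval x y) ≤ len x + len y := by
  have hx := one_le_len x
  have hy := one_le_len y
  have l0 : len 0 = 1 := by simp [len]
  have l1 : len 1 = 2 := by simp [len]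
  cases o with
  | add => exact len_add_le x y
  | sub =>
    have := len_add_le x (-y)
    have h2 : len (-y) = len y := by simp [len]
    rw [h2] at this
    simpa [BinOp.eval, sub_eq_add_neg] using this
  | mul => exact len_mul_le x y
  | div => exact (len_mono (abs_ediv_le x y)).trans (by omega)
  | mod =>
    by_cases h : y = 0
    · subst h; simp [BinOp.eval]
    · have : len (x % y) ≤ len y := len_mono (by
        rw [abs_of_nonneg (Int.emod_nonneg x h)]; exact (Int.emod_lt_abs x h).le)
      exact this.trans (by omega)
  | lt => simp only [BinOp.eval]; split_ifs <;> omega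
  | eq => simp only [BinOp.eval]; split_ifs <;> omega

/-- The value of `e` has at most `e.width * b` bits if all memory cells have at most `b` bits. -/
def Expr.width : Expr → ℕ
  | .const z => len z
  | .var _ => 1
  | .get _ _ => 1
  | .op _ e f => e.width + f.width

/-- Evaluating `e` costs at most `e.weight * b` if all memory cells have at most `b` bits. -/
def Expr.weight : Expr → ℕ
  | .const z => len z
  | .var _ => 1
  | .get _ e => e.weight + e.width + 1
  | .op _ e f => e.weight + f.weight + 2 * (e.width + f.width)

/-- Every memory cell holds an integer of absolute value at most `X`. -/
structure Bounded (X : ℕ) (s : State) : Prop where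
  var : ∀ i, |s.var i| ≤ X
  arr : ∀ a k, |s.arr a k| ≤ X

theorem len_le_of_abs_le {X : ℕ} {z : ℤ} (h : |z| ≤ X) : len z ≤ X.size + 1 := by
  have : len z ≤ len (X : ℤ) := len_mono (by simpa using h)
  simpa [len] using this

theorem Expr.len_eval_le {X : ℕ} {s : State} (h : Bounded X s) :
    ∀ e : Expr, len (e.eval s) ≤ e.width * (X.size + 1)
  | .const z => by
    simp only [Expr.eval, Expr.width]; nlinarith [Nat.zero_le (len z * X.size)]
  | .var i => by simpa [Expr.eval, Expr.width] using len_le_of_abs_le (h.var i)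
  | .get a e => by simpa [Expr.eval, Expr.width] using len_le_of_abs_le (h.arr a _)
  | .op o e f => by
    have h1 := Expr.len_eval_le h e
    have h2 := Expr.len_eval_le h f
    have h3 := o.len_eval_le (e.eval s) (f.eval s)
    simp only [Expr.eval, Expr.width]
    rw [Nat.add_mul]; omega

theorem Expr.cost_le {X : ℕ} {s : State} (h : Bounded X s) :
    ∀ e : Expr, e.cost s ≤ e.weight * (X.size + 1)
  | .const z => by
    simp only [Expr.cost, Expr.weight]; nlinarith [Nat.zero_le (len z * X.size)]
  | .var i => by simpa [Expr.cost, Expr.weight] using len_le_of_abs_le (h.var i)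
  | .get a e => by
    have h1 := Expr.cost_le h e
    have h2 := Expr.len_eval_le h e
    have h3 := len_le_of_abs_le (h.arr a (e.eval s))
    simp only [Expr.cost, Expr.weight]
    rw [Nat.add_mul, Nat.add_mul]; omega
  | .op o e f => by
    have h1 := Expr.cost_le h e
    have h2 := Expr.cost_le h f
    have h3 := Expr.len_eval_le h e
    have h4 := Expr.len_eval_le h f
    have h5 := o.len_eval_le (e.eval s) (f.eval s)
    simp only [Expr.cost, Expr.weight]
    rw [Nat.add_mul, Nat.add_mul, Nat.mul_assoc, Nat.add_mul]; omega

/-- A bound for the number of operations of a program in which no loop makes more than `R`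
iterations. -/
def Program.steps (R : ℕ) : Program → ℕ
  | .skip => 1
  | .assign _ e => e.weight + 1
  | .store _ i e => i.weight + e.weight + 1
  | .emit e => e.weight + 1
  | .seq p q => p.steps R + q.steps R
  | .branch e p q => e.weight + 1 + p.steps R + q.steps R
  | .loop e p => R * (e.weight + 1 + p.steps R) + (e.weight + 1)

theorem Program.exists_steps_eq_eval (p : Program) :
    ∃ P : Polynomial ℕ, ∀ R, p.steps R = P.eval R := by
  induction p with
  | skip => exact ⟨1, fun R => by simp [Program.steps]⟩
  | assign i e => exact ⟨Polynomial.C (e.weight + 1), fun R => by simp [Program.steps]⟩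
  | store a i e => exact ⟨Polynomial.C (i.weight + e.weight + 1), fun R => by simp [Program.steps]⟩
  | emit e => exact ⟨Polynomial.C (e.weight + 1), fun R => by simp [Program.steps]⟩
  | seq p q hp hq =>
    obtain ⟨P, hP⟩ := hp
    obtain ⟨Q, hQ⟩ := hq
    exact ⟨P + Q, fun R => by simp [Program.steps, hP, hQ]⟩
  | branch e p q hp hq =>
    obtain ⟨P, hP⟩ := hp
    obtain ⟨Q, hQ⟩ := hq
    exact ⟨Polynomial.C (e.weight + 1) + P + Q, fun R => by simp [Program.steps, hP, hQ]⟩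
  | loop e p hp =>
    obtain ⟨P, hP⟩ := hp
    exact ⟨Polynomial.X * (Polynomial.C (e.weight + 1) + P) + Polynomial.C (e.weight + 1),
      fun R => by simp [Program.steps, hP]⟩

/-! ### Variables written by a program -/

/-- The variables that a program may change. -/
def Program.vars : Program → List ℕ
  | .skip => []
  | .assign i _ => [i]
  | .store _ _ _ => []
  | .emit _ => []
  | .seq p q => p.vars ++ q.vars
  | .branch _ p q => p.vars ++ q.vars
  | .loop _ p => p.vars

/-- The arrays that a program may change. -/
def Program.arrs : Program → List ℕ
  | .skip => []
  | .assign _ _ => []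
  | .store a _ _ => [a]
  | .emit _ => []
  | .seq p q => p.arrs ++ q.arrs
  | .branch _ p q => p.arrs ++ q.arrs
  | .loop _ p => p.arrs

/-- Whether a program contains an output instruction. -/
def Program.emits : Program → Bool
  | .skip => false
  | .assign _ _ => false
  | .store _ _ _ => false
  | .emit _ => true
  | .seq p q => p.emits || q.emits
  | .branch _ p q => p.emits || q.emits
  | .loop _ p => p.emits

/-- The states `s` and `s'` differ only in what the program `p` may change. -/
structure Frame (p : Program) (s s' : State) : Prop where
  var : ∀ i, i ∉ p.vars → s'.var i = s.var i
  arr : ∀ a, a ∉ p.arrs → s'.arr a = s.arr a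
  out : p.emits = false → s'.out = s.out

theorem Frame.refl (p : Program) (s : State) : Frame p s s :=
  ⟨fun _ _ => rfl, fun _ _ => rfl, fun _ => rfl⟩

theorem Frame.trans {p : Program} {s s' s'' : State} (h : Frame p s s') (h' : Frame p s' s'') :
    Frame p s s'' :=
  ⟨fun i hi => (h'.var i hi).trans (h.var i hi), fun a ha => (h'.arr a ha).trans (h.arr a ha),
    fun he => (h'.out he).trans (h.out he)⟩

theorem Frame.mono {p q : Program} {s s' : State} (h : Frame p s s')
    (hv : ∀ i, i ∈ p.vars → i ∈ q.vars) (ha : ∀ i, i ∈ p.arrs → i ∈ q.arrs)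
    (ho : q.emits = false → p.emits = false) : Frame q s s' :=
  ⟨fun i hi => h.var i fun h' => hi (hv i h'), fun a h1 => h.arr a fun h' => h1 (ha a h'),
    fun he => h.out (ho he)⟩

theorem Exec.frame {p : Program} {s s' : State} {t : ℕ} (h : Exec p s s' t) : Frame p s s' := by
  induction h with
  | skip s => exact Frame.refl _ _
  | assign i e s =>
    exact ⟨fun j hj => Function.update_of_ne (by simpa [Program.vars] using hj) _ _,
      fun _ _ => rfl, fun _ => rfl⟩
  | store a i e s =>
    exact ⟨fun _ _ => rfl,
      fun j hj => Function.update_of_ne (by simpa [Program.arrs] using hj) _ _, fun _ => rfl⟩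
  | emit e s => exact ⟨fun _ _ => rfl, fun _ _ => rfl, fun h => by simp [Program.emits] at h⟩
  | seq _ _ h1 h2 =>
    exact (h1.mono (by simp +contextual [Program.vars]) (by simp +contextual [Program.arrs])
      (by simp +contextual [Program.emits])).trans
      (h2.mono (by simp +contextual [Program.vars]) (by simp +contextual [Program.arrs])
      (by simp +contextual [Program.emits]))
  | branch_true _ _ h1 =>
    exact h1.mono (by simp +contextual [Program.vars]) (by simp +contextual [Program.arrs])
      (by simp +contextual [Program.emits])
  | branch_false _ _ h1 =>
    exact h1.mono (by simp +contextual [Program.vars]) (by simp +contextual [Program.arrs])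
      (by simp +contextual [Program.emits])
  | loop_done _ => exact Frame.refl _ _
  | loop_step _ _ _ h1 h2 => exact Frame.trans ⟨h1.var, h1.arr, h1.out⟩ h2

/-! ### Total correctness with cost bounds -/

/-- Started in the state `s`, whose cells are bounded by `X`, the program `p` halts in a state
that satisfies `Q` and whose cells are bounded by `X`, at the cost of a run with cells bounded
by `X` and no more than `R` iterations of each loop. -/
def Achieves (X R : ℕ) (p : Program) (s : State) (Q : State → Prop) : Prop :=
  Bounded X s → ∃ s' t, Exec p s s' t ∧ t ≤ p.steps R * (X.size + 1) ∧ Bounded X s' ∧ Q s'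

variable {X R : ℕ}

theorem Achieves.mono {p : Program} {s : State} {Q Q' : State → Prop}
    (h : Achieves X R p s Q) (hQ : ∀ s', Frame p s s' → Q s' → Q' s') : Achieves X R p s Q' := by
  intro hb
  obtain ⟨s', t, h1, h2, h3, h4⟩ := h hb
  exact ⟨s', t, h1, h2, h3, hQ s' h1.frame h4⟩

theorem Achieves.assign {i : ℕ} {e : Expr} {s : State} {Q : State → Prop}
    (hX : |e.eval s| ≤ X) (hQ : Q { s with var := Function.update s.var i (e.eval s) }) :
    Achieves X R (.assign i e) s Q := by
  intro hb
  refine ⟨_, _, Exec.assign i e s, ?_, ⟨fun j => ?_, hb.arr⟩, hQ⟩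
  · have := Expr.cost_le hb e
    simp only [Program.steps]; rw [Nat.add_mul]; omega
  · by_cases h : j = i
    · subst h; simpa using hX
    · simpa [h] using hb.var j

theorem Achieves.store {a : ℕ} {i e : Expr} {s : State} {Q : State → Prop}
    (hX : |e.eval s| ≤ X)
    (hQ : Q { s with
      arr := Function.update s.arr a (Function.update (s.arr a) (i.eval s) (e.eval s)) }) :
    Achieves X R (.store a i e) s Q := by
  intro hb
  refine ⟨_, _, Exec.store a i e s, ?_, ⟨hb.var, fun j k => ?_⟩, hQ⟩
  · have := Expr.cost_le hb e
    have := Expr.cost_le hb i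
    simp only [Program.steps]; rw [Nat.add_mul, Nat.add_mul]; omega
  · by_cases h : j = a
    · subst h
      by_cases h : k = i.eval s
      · subst h; simpa using hX
      · simpa [h] using hb.arr j k
    · simpa [h] using hb.arr j k

theorem Achieves.emit {e : Expr} {s : State} {Q : State → Prop}
    (hQ : Q { s with out := s.out ++ [e.eval s] }) : Achieves X R (.emit e) s Q := by
  intro hb
  refine ⟨_, _, Exec.emit e s, ?_, ⟨hb.var, hb.arr⟩, hQ⟩
  have := Expr.cost_le hb e
  simp only [Program.steps]; rw [Nat.add_mul]; omega

theorem Achieves.skip {s : State} {Q : State → Prop} (hQ : Q s) : Achieves X R .skip s Q :=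
  fun hb => ⟨_, _, Exec.skip s, by simp [Program.steps], hb, hQ⟩

theorem Achieves.seq {p q : Program} {s : State} {Q : State → Prop}
    (h : Achieves X R p s fun s' => Achieves X R q s' Q) : Achieves X R (.seq p q) s Q := by
  intro hb
  obtain ⟨s', t, h1, h2, h3, h4⟩ := h hb
  obtain ⟨s'', t', h1', h2', h3', h4'⟩ := h4 h3
  refine ⟨s'', t + t', h1.seq h1', ?_, h3', h4'⟩
  simp only [Program.steps]; rw [Nat.add_mul]; omega

theorem Achieves.branch {e : Expr} {p q : Program} {s : State} {Q : State → Prop}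
    (h₁ : e.eval s ≠ 0 → Achieves X R p s Q) (h₂ : e.eval s = 0 → Achieves X R q s Q) :
    Achieves X R (.branch e p q) s Q := by
  intro hb
  have hc := Expr.cost_le hb e
  by_cases h : e.eval s = 0
  · obtain ⟨s', t, h1, h2, h3, h4⟩ := h₂ h hb
    refine ⟨s', _, h1.branch_false h, ?_, h3, h4⟩
    simp only [Program.steps]; rw [Nat.add_mul, Nat.add_mul, Nat.add_mul]; omega
  · obtain ⟨s', t, h1, h2, h3, h4⟩ := h₁ h hb
    refine ⟨s', _, h1.branch_true h, ?_, h3, h4⟩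
    simp only [Program.steps]; rw [Nat.add_mul, Nat.add_mul, Nat.add_mul]; omega

/-- The rule for loops: `Inv` is an invariant, and `μ` decreases with every iteration. -/
theorem Achieves.loop {e : Expr} {p : Program} {s : State} {Q : State → Prop}
    (Inv : State → Prop) (μ : State → ℕ) (hR : μ s ≤ R) (h0 : Inv s)
    (hstep : ∀ s', Frame p s s' → Inv s' → e.eval s' ≠ 0 →
      Achieves X R p s' fun s'' => Inv s'' ∧ μ s'' < μ s')
    (hend : ∀ s', Frame p s s' → Inv s' → e.eval s' = 0 → Q s') :
    Achieves X R (.loop e p) s Q := by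
  have key : ∀ (k : ℕ) (s' : State), Frame p s s' → Inv s' → μ s' ≤ k → Bounded X s' →
      ∃ s'' t, Exec (.loop e p) s' s'' t ∧
        t ≤ (k * (e.weight + 1 + p.steps R) + (e.weight + 1)) * (X.size + 1) ∧
        Bounded X s'' ∧ Q s'' := by
    intro k
    induction k with
    | zero =>
      intro s' hf hi hk hb
      have hc := Expr.cost_le hb e
      have he : e.eval s' = 0 := by
        by_contra he
        obtain ⟨s'', t, -, -, -, -, h⟩ := hstep s' hf hi he hb
        omega
      refine ⟨s', _, Exec.loop_done he, ?_, hb, hend s' hf hi he⟩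
      rw [Nat.add_mul, Nat.add_mul]; omega
    | succ k ih =>
      intro s' hf hi hk hb
      have hc := Expr.cost_le hb e
      by_cases he : e.eval s' = 0
      · refine ⟨s', _, Exec.loop_done he, ?_, hb, hend s' hf hi he⟩
        rw [Nat.add_mul _ (e.weight + 1), Nat.add_mul e.weight]; omega
      · obtain ⟨s'', t, h1, h2, h3, h4, h5⟩ := hstep s' hf hi he hb
        obtain ⟨s₃, t', h1', h2', h3', h4'⟩ := ih s'' (hf.trans h1.frame) h4 (by omega) h3
        refine ⟨s₃, _, Exec.loop_step he h1 h1', ?_, h3', h4'⟩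
        have : ((k + 1) * (e.weight + 1 + p.steps R) + (e.weight + 1)) * (X.size + 1) =
          (k * (e.weight + 1 + p.steps R) + (e.weight + 1)) * (X.size + 1) +
          (e.weight * (X.size + 1) + (X.size + 1) + p.steps R * (X.size + 1)) := by ring
        omega
  intro hb
  obtain ⟨s', t, h1, h2, h3, h4⟩ := key (μ s) s (Frame.refl _ _) h0 le_rfl hb
  refine ⟨s', t, h1, h2.trans ?_, h3, h4⟩
  simp only [Program.steps]
  exact Nat.mul_le_mul_right _ (Nat.add_le_add_right (Nat.mul_le_mul_right _ hR) _)

/-! ### Notation for expressions and counting loops -/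

instance : Add Expr := ⟨.op .add⟩
instance : Sub Expr := ⟨.op .sub⟩
instance : Mul Expr := ⟨.op .mul⟩
instance : Div Expr := ⟨.op .div⟩
instance : Mod Expr := ⟨.op .mod⟩
instance (k : ℕ) : OfNat Expr k := ⟨.const (k : ℤ)⟩

/-- The comparison `e < f`, with value `1` or `0`. -/
def Expr.lt (e f : Expr) : Expr := .op .lt e f

/-- The comparison `e = f`, with value `1` or `0`. -/
def Expr.eq (e f : Expr) : Expr := .op .eq e f

section
variable (s : State) (e f : Expr)
@[simp] theorem eval_add : (e + f).eval s = e.eval s + f.eval s := rfl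
@[simp] theorem eval_sub : (e - f).eval s = e.eval s - f.eval s := rfl
@[simp] theorem eval_mul : (e * f).eval s = e.eval s * f.eval s := rfl
@[simp] theorem eval_div : (e / f).eval s = e.eval s / f.eval s := rfl
@[simp] theorem eval_mod : (e % f).eval s = e.eval s % f.eval s := rfl
@[simp] theorem eval_lt : (e.lt f).eval s = if e.eval s < f.eval s then 1 else 0 := rfl
@[simp] theorem eval_eq : (e.eq f).eval s = if e.eval s = f.eval s then 1 else 0 := rfl
@[simp] theorem eval_ofNat (k : ℕ) [k.AtLeastTwo] :
    (ofNat(k) : Expr).eval s = (ofNat(k) : ℤ) := rfl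
@[simp] theorem eval_zero : (0 : Expr).eval s = 0 := rfl
@[simp] theorem eval_one : (1 : Expr).eval s = 1 := rfl
@[simp] theorem eval_var (i : ℕ) : (Expr.var i).eval s = s.var i := rfl
@[simp] theorem eval_get (a : ℕ) : (Expr.get a e).eval s = s.arr a (e.eval s) := rfl
end

/-- Sequential composition of programs. -/
infixr:60 " ;; " => Program.seq

/-- `for v = 0, 1, …, c - 1 do p`, where the bound is the value of the variable `c`. -/
def forLoop (v c : ℕ) (p : Program) : Program :=
  .assign v 0 ;; .loop ((Expr.var v).lt (.var c)) (p ;; .assign v (.var v + 1))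

@[simp] theorem vars_forLoop (v c : ℕ) (p : Program) :
    (forLoop v c p).vars = v :: (p.vars ++ [v]) := rfl

@[simp] theorem arrs_forLoop (v c : ℕ) (p : Program) : (forLoop v c p).arrs = p.arrs := by
  simp [forLoop, Program.arrs]

@[simp] theorem emits_forLoop (v c : ℕ) (p : Program) : (forLoop v c p).emits = p.emits := by
  simp [forLoop, Program.emits]

/-- The rule for counting loops. The invariant `Inv k` holds whenever the counter has the
value `k`. -/
theorem Achieves.forLoop {v c : ℕ} {p : Program} {s : State} {Q : State → Prop} (cnt : ℕ)
    (Inv : ℕ → State → Prop) (hv : v ∉ p.vars) (hc : c ∉ p.vars) (hvc : v ≠ c)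
    (hcnt : s.var c = cnt) (hR : cnt ≤ R) (hX : cnt ≤ X)
    (h0 : Inv 0 { s with var := Function.update s.var v 0 })
    (hstep : ∀ k < cnt, ∀ s', Frame (forLoop v c p) s s' → s'.var v = k → Inv k s' →
      Achieves X R p s' fun s'' =>
        Inv (k + 1) { s'' with var := Function.update s''.var v (k + 1) })
    (hend : ∀ s', Frame (LogRAM.forLoop v c p) s s' → s'.var v = cnt → Inv cnt s' → Q s') :
    Achieves X R (forLoop v c p) s Q := by
  refine Achieves.seq (Achieves.assign (by simp) ?_)
  set s₀ : State := { s with var := Function.update s.var v ((0 : Expr).eval s) } with hs₀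
  have hf₀ : ∀ s', Frame (p ;; .assign v (.var v + 1)) s₀ s' →
      Frame (LogRAM.forLoop v c p) s s' := by
    intro s' h
    refine ⟨fun i hi => ?_, fun a ha => ?_, fun ho => ?_⟩
    · have hi' : i ∉ (p ;; Program.assign v (.var v + 1)).vars := by
        simp [Program.vars] at hi ⊢; tauto
      have hiv : i ≠ v := by simp at hi; tauto
      rw [h.var i hi', hs₀]; simp [hiv]
    · rw [h.arr a (by simpa [Program.arrs] using ha)]
    · rw [h.out (by simpa [Program.emits] using ho)]
  have hcv : ∀ s', Frame (p ;; .assign v (.var v + 1)) s₀ s' → s'.var c = cnt := by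
    intro s' h
    have hi' : c ∉ (p ;; Program.assign v (.var v + 1)).vars := by
      simp [Program.vars]; tauto
    rw [h.var c hi', hs₀]; simpa [hvc.symm] using hcnt
  refine Achieves.loop (fun s' => ∃ k : ℕ, k ≤ cnt ∧ s'.var v = k ∧ Inv k s')
    (fun s' => cnt - (s'.var v).toNat) ?_ ⟨0, Nat.zero_le _, by simp [hs₀], h0⟩ ?_ ?_
  · simp [hs₀]; omega
  · rintro s' hf ⟨k, hk, hvk, hinv⟩ he
    have hk' : k < cnt := by
      simp [hvk, hcv s' hf] at he; exact_mod_cast he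
    refine Achieves.seq ((hstep k hk' s' (hf₀ s' hf) hvk hinv).mono ?_)
    intro s'' hf'' hinv''
    have hvk' : s''.var v = k := by rw [hf''.var v hv, hvk]
    have he : (Expr.var v + 1).eval s'' = (k : ℤ) + 1 := by simp [hvk']
    refine Achieves.assign ?_ ⟨⟨k + 1, hk', by simp [hvk'], ?_⟩, ?_⟩
    · rw [he, abs_of_nonneg (by positivity)]; omega
    · rw [he]; exact hinv''
    · rw [he, hvk]; simp; omega
  · rintro s' hf ⟨k, hk, hvk, hinv⟩ he
    have hk' : k = cnt := by
      simp [hvk, hcv s' hf] at he; omega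
    subst hk'
    exact hend s' (hf₀ s' hf) hvk hinv

/-- The loop that fills an interval of the array `a` with the values of an expression. -/
def fillLoop (v c a : ℕ) (off e : Expr) : Program :=
  forLoop v c (.store a (off + .var v) e)

/-- The state after the first `k` iterations of a loop that fills the array `a` from `o` on
with the values of `f`. -/
def State.filled (s : State) (v a : ℕ) (o : ℤ) (f : ℕ → ℤ) (k : ℕ) : State where
  var := Function.update s.var v k
  arr := Function.update s.arr a
    fun x => if o ≤ x ∧ x < o + k then f (x - o).toNat else s.arr a x
  out := s.out

theorem Achieves.fillLoop {v c a : ℕ} {off e : Expr} {s : State} {Q : State → Prop}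
    (cnt : ℕ) (o : ℤ) (f : ℕ → ℤ) (hvc : v ≠ c) (hcnt : s.var c = cnt) (hR : cnt ≤ R) (hX : cnt ≤ X)
    (he : ∀ k < cnt, off.eval (s.filled v a o f k) = o ∧ e.eval (s.filled v a o f k) = f k ∧
      |f k| ≤ X)
    (hQ : Q (s.filled v a o f cnt)) : Achieves X R (fillLoop v c a off e) s Q := by
  refine Achieves.forLoop cnt (fun k s' => s' = s.filled v a o f k) (by simp [Program.vars])
    (by simp [Program.vars]) hvc hcnt hR hX ?_ ?_ ?_
  · simp only [State.filled, State.mk.injEq, Nat.cast_zero, add_zero, true_and, and_true]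
    rw [eq_comm, Function.update_eq_self_iff]
    ext x
    rw [if_neg (by omega)]
  · rintro k hk s' - hv rfl
    obtain ⟨h1, h2, h3⟩ := he k hk
    refine Achieves.store (by rw [h2]; exact h3) ?_
    rw [h2, eval_add, h1, eval_var, hv]
    simp only [State.filled, State.mk.injEq, Function.update_idem, Nat.cast_add, Nat.cast_one,
      and_true, true_and, Function.update_self]
    congr 1
    ext x
    by_cases hx : x = o + k
    · subst hx; simp
    · rw [Function.update_of_ne hx]
      by_cases h : o ≤ x ∧ x < o + k
      · rw [if_pos h, if_pos (by omega)]
      · rw [if_neg h, if_neg (by omega)]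
  · rintro s' - - rfl; exact hQ

/-- The loop that adds up the values of an expression in the variable `w`. -/
def sumLoop (v c w : ℕ) (e : Expr) : Program :=
  .assign w 0 ;; forLoop v c (.assign w (.var w + e))

/-- The state after `k` iterations of a summation loop. -/
def State.summed (s : State) (v w : ℕ) (f : ℕ → ℤ) (k : ℕ) : State :=
  { s with var := Function.update (Function.update s.var w (∑ i ∈ Finset.range k, f i)) v k }

theorem Achieves.sumLoop {v c w : ℕ} {e : Expr} {s : State} {Q : State → Prop}
    (cnt : ℕ) (f : ℕ → ℤ) (hvc : v ≠ c) (hvw : v ≠ w) (hwc : w ≠ c) (hcnt : s.var c = cnt)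
    (hR : cnt ≤ R) (hX : cnt ≤ X)
    (he : ∀ k < cnt, e.eval (s.summed v w f k) = f k)
    (hf : ∀ k ≤ cnt, |∑ i ∈ Finset.range k, f i| ≤ X)
    (hQ : Q (s.summed v w f cnt)) : Achieves X R (sumLoop v c w e) s Q := by
  refine Achieves.seq (Achieves.assign (by simp) ?_)
  refine Achieves.forLoop cnt (fun k s' => s' = s.summed v w f k) (by simp [Program.vars, hvw])
    (by simp [Program.vars, hwc.symm]) hvc (by simpa [hwc.symm] using hcnt) hR hX ?_ ?_ ?_
  · simp [State.summed]
  · rintro k hk s' - hv rfl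
    have h1 : (Expr.var w + e).eval (s.summed v w f k) = ∑ i ∈ Finset.range (k + 1), f i := by
      rw [eval_add, he k hk, Finset.sum_range_succ]; simp [State.summed, hvw.symm]
    refine Achieves.assign (by rw [h1]; exact hf _ hk) ?_
    rw [h1]
    simp only [State.summed, State.mk.injEq, and_true, Nat.cast_add, Nat.cast_one]
    ext j
    simp only [Function.update_apply]
    split_ifs <;> simp_all
  · rintro s' - - rfl; exact hQ

end LogRAM

/-! ### Fraction-free elimination -/

section Elimination

variable {ι : Type*} [Fintype ι] [DecidableEq ι]

theorem vecMul_adjugate_apply (Q : Matrix ι ι ℤ) (a : ι → ℤ) (c : ι) :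
    (a ᵥ* Q.adjugate) c = (Q.updateRow c a).det := by
  rw [← cramer_transpose_apply, cramer_eq_adjugate_mulVec, ← adjugate_transpose,
    mulVec_transpose]

/-- How the adjugate changes when one row is replaced: a multiple of the new adjugate is a
combination of two columns of the old one. -/
theorem det_mul_adjugate_updateRow (Q : Matrix ι ι ℤ) (a : ι → ℤ) {c l : ι} (hl : l ≠ c)
    (hd : (a ᵥ* Q.adjugate) c ≠ 0) (i : ι) :
    Q.det * (Q.updateRow c a).adjugate i l =
      (a ᵥ* Q.adjugate) c * Q.adjugate i l - Q.adjugate i c * (a ᵥ* Q.adjugate) l := by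
  set τ := a ᵥ* Q.adjugate with hτ
  set x : ι → ℤ := fun i => τ c * Q.adjugate i l - Q.adjugate i c * τ l with hx
  have hdet : (Q.updateRow c a).det = τ c := by rw [hτ, vecMul_adjugate_apply]
  have hx' : x = τ c • Q.adjugate.col l - τ l • Q.adjugate.col c := by
    ext i; simp [hx]; ring
  have hQ : ∀ j, Q *ᵥ Q.adjugate.col j = Pi.single j Q.det := by
    intro j
    ext ρ
    have : (Q * Q.adjugate) ρ j = (Q.det • (1 : Matrix ι ι ℤ)) ρ j := by rw [mul_adjugate]
    rw [mul_apply] at this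
    simp only [mulVec, dotProduct, Matrix.col_apply, this, Matrix.smul_apply, Matrix.one_apply,
      Pi.single_apply]
    simp
  have ha : ∀ j, a ⬝ᵥ Q.adjugate.col j = τ j := fun j => rfl
  have key : Q.updateRow c a *ᵥ x = Pi.single l (Q.det * τ c) := by
    ext ρ
    by_cases hρ : ρ = c
    · subst hρ
      have : (Q.updateRow ρ a *ᵥ x) ρ = a ⬝ᵥ x := by simp [mulVec]
      rw [this, hx', dotProduct_sub, dotProduct_smul, dotProduct_smul, ha, ha,
        Pi.single_eq_of_ne (Ne.symm hl)]
      simp; ring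
    · have : (Q.updateRow c a *ᵥ x) ρ = (Q *ᵥ x) ρ := by simp [mulVec, updateRow_ne hρ]
      rw [this, hx', mulVec_sub, mulVec_smul, mulVec_smul, hQ, hQ]
      by_cases h : ρ = l
      · subst h; simp [hρ]; ring
      · simp [hρ, h]
  have h2 : (Q.updateRow c a).adjugate *ᵥ (Q.updateRow c a *ᵥ x) = τ c • x := by
    rw [mulVec_mulVec, adjugate_mul, hdet, smul_mulVec, one_mulVec]
  rw [key] at h2
  have h3 := congrFun h2 i
  rw [mulVec_single] at h3
  simp only [Pi.smul_apply, Matrix.col_apply, MulOpposite.smul_eq_mul_unop, smul_eq_mul,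
    MulOpposite.unop_op] at h3
  apply mul_left_cancel₀ hd
  linarith

theorem abs_updateRow_le {ι : Type*} [DecidableEq ι] {μ : ℤ} {Q : Matrix ι ι ℤ}
    (hQ : ∀ i j, |Q i j| ≤ μ) {a : ι → ℤ} (ha : ∀ i, |a i| ≤ μ) (c : ι) (i j : ι) : |Q.updateRow c a i j| ≤ μ := by
  by_cases hi : i = c
  · subst hi; simpa using ha j
  · simpa [updateRow_ne hi] using hQ i j

/-- A bound for the determinants of matrices with entries bounded by `μ`. -/
def detBound (N : ℕ) (μ : ℤ) : ℤ := N.factorial * μ ^ N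

theorem abs_det_le_detBound {Q : Matrix ι ι ℤ} {μ : ℤ} (h : ∀ i j, |Q i j| ≤ μ) :
    |Q.det| ≤ detBound (Fintype.card ι) μ := by
  have := det_le (A := Q) (abv := AbsoluteValue.abs) (x := μ) h
  simpa [detBound] using this

/-- The state of the elimination after the equations in `done`. The columns of `W / D`
parametrize the real solutions `z` of these equations, the parameters being the coordinates of
`z` themselves; `W` consists of columns of the adjugate of a matrix `Q` made of unit vectors and
of equations, so that its entries are minors. The predicate `rl` marks the real unknowns, `q` is
the unknown that is never eliminated, and `bad` says that the equations force it to be zero. -/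
structure Elimination {ρ : Type*} (M : ρ → ι → ℤ) (rl : ι → Prop) (q : ι) (μ : ℤ)
    (done : ρ → Prop) (W : Matrix ι ι ℤ) (D : ℤ) (bad : Prop) : Prop where
  pos : 0 < D
  cofactor : ∃ (Q : Matrix ι ι ℤ) (F : Finset ι), (∀ i j, |Q i j| ≤ μ) ∧ Q.det = D ∧
    ∀ i l, W i l = if l ∈ F then Q.adjugate i l else 0
  kills : ¬ bad → ∀ r, done r → M r ᵥ* W = 0
  fixes : ∀ z : ι → ℝ, (∀ r, done r → ∑ i, (M r i : ℝ) * z i = 0) →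
    ∀ i, ∑ l, (W i l : ℝ) * z l = D * z i
  forced : bad → ∀ z : ι → ℝ, (∀ r, done r → ∑ i, (M r i : ℝ) * z i = 0) → z q = 0
  separated : ∀ i l, ¬ rl i → rl l → W i l = 0
  kept : ∀ l, W q l = if l = q then D else 0

namespace Elimination

variable {ρ : Type*} {M : ρ → ι → ℤ} {rl : ι → Prop} {q : ι} {μ : ℤ} {done : ρ → Prop}
  {W : Matrix ι ι ℤ} {D : ℤ} {bad : Prop}

theorem init (hμ : 1 ≤ μ) : Elimination M rl q μ (fun _ => False) 1 1 False where
  pos := one_pos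
  cofactor := ⟨1, Finset.univ, fun i j => by
    rw [one_apply]; split_ifs <;> simp <;> omega, det_one, fun i l => by simp⟩
  kills := fun _ r h => h.elim
  fixes := fun z _ i => by simp [one_apply]
  forced := fun h => h.elim
  separated := fun i l hi hl => one_apply_ne (fun h => hi (h ▸ hl))
  kept := fun l => by simp [one_apply, eq_comm]

theorem abs_le (h : Elimination M rl q μ done W D bad) : D ≤ detBound (Fintype.card ι) μ := by
  obtain ⟨Q, F, hQ, rfl, -⟩ := h.cofactor
  exact (le_abs_self _).trans (abs_det_le_detBound hQ)

theorem abs_entry_le (h : Elimination M rl q μ done W D bad) (hμ : 1 ≤ μ) (i l : ι) :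
    |W i l| ≤ detBound (Fintype.card ι) μ := by
  obtain ⟨Q, F, hQ, -, hW⟩ := h.cofactor
  rw [hW]
  split_ifs
  · rw [adjugate_apply]
    refine abs_det_le_detBound (abs_updateRow_le hQ (fun j => ?_) _)
    rw [Pi.single_apply]; split_ifs <;> simp <;> omega
  · simp only [abs_zero, detBound]; positivity

theorem abs_vecMul_le (h : Elimination M rl q μ done W D bad) (hμ : 1 ≤ μ) {a : ι → ℤ}
    (ha : ∀ i, |a i| ≤ μ) (l : ι) : |(a ᵥ* W) l| ≤ detBound (Fintype.card ι) μ := by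
  obtain ⟨Q, F, hQ, -, hW⟩ := h.cofactor
  by_cases hl : l ∈ F
  · have : (a ᵥ* W) l = (a ᵥ* Q.adjugate) l := by simp [vecMul, dotProduct, hW, hl]
    rw [this, vecMul_adjugate_apply]
    exact abs_det_le_detBound (abs_updateRow_le hQ ha _)
  · have : (a ᵥ* W) l = 0 := by simp [vecMul, dotProduct, hW, hl]
    rw [this]; simp only [abs_zero, detBound]; positivity

/-- One step of the elimination, with the pivot `c`; the sign `σ` keeps the determinant
positive. -/
theorem pivot (h : Elimination M rl q μ done W D bad) {r : ρ}
    (ha : ∀ i, |M r i| ≤ μ) {c : ι} (hcq : c ≠ q) (hc : (M r ᵥ* W) c ≠ 0)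
    (hrl : rl c ∨ ∀ l, rl l → (M r ᵥ* W) l = 0) {σ : ℤ} (hσ : σ = 1 ∨ σ = -1)
    (hpos : 0 < σ * (M r ᵥ* W) c) :
    Elimination M rl q μ (fun r' => done r' ∨ r' = r)
      (fun i l => σ * ((M r ᵥ* W) c * W i l - W i c * (M r ᵥ* W) l) / D)
      (σ * (M r ᵥ* W) c) bad := by
  obtain ⟨Q, F, hQ, hdet, hW⟩ := h.cofactor
  set τ := M r ᵥ* W with hτ
  have hD := h.pos
  have hcF : c ∈ F := by
    by_contra hcF
    exact hc (by simp [hτ, vecMul, dotProduct, hW, hcF])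
  have hτF : ∀ l ∈ F, ((σ • M r) ᵥ* Q.adjugate) l = σ * τ l := by
    intro l hl
    rw [smul_vecMul]
    simp [hτ, vecMul, dotProduct, hW, hl]
  have hτF' : ∀ l ∉ F, τ l = 0 := by
    intro l hl
    simp [hτ, vecMul, dotProduct, hW, hl]
  have hdet' : (Q.updateRow c (σ • M r)).det = σ * τ c := by
    rw [← vecMul_adjugate_apply, hτF c hcF]
  -- the division by `D` is exact
  have hex : ∀ i l, D * (if l ∈ F.erase c then (Q.updateRow c (σ • M r)).adjugate i l else 0) =
      σ * (τ c * W i l - W i c * τ l) := by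
    intro i l
    by_cases hl : l ∈ F.erase c
    · have hl' := Finset.mem_erase.1 hl
      rw [if_pos hl, ← hdet, det_mul_adjugate_updateRow Q _ hl'.1
        (by rw [hτF c hcF]; exact hpos.ne'), hτF c hcF, hτF l hl'.2, hW, hW, if_pos hl'.2,
        if_pos hcF]
      ring
    · rw [if_neg hl]
      by_cases hlc : l = c
      · subst hlc; ring
      · have hlF : l ∉ F := fun hlF => hl (Finset.mem_erase.2 ⟨hlc, hlF⟩)
        rw [hτF' l hlF, hW, if_neg hlF]; ring
  have hex' : ∀ i l, D * (σ * (τ c * W i l - W i c * τ l) / D) =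
      σ * (τ c * W i l - W i c * τ l) := by
    intro i l
    rw [← hex i l, Int.mul_ediv_cancel_left _ hD.ne']
  have hexR : ∀ i l, (D : ℝ) * ((σ * (τ c * W i l - W i c * τ l) / D : ℤ) : ℝ) =
      σ * (τ c * W i l - W i c * τ l) := by
    intro i l
    have := hex' i l
    exact_mod_cast this
  refine ⟨hpos, ⟨Q.updateRow c (σ • M r), F.erase c, abs_updateRow_le hQ (fun i => ?_) c, hdet',
    fun i l => ?_⟩, ?_, ?_, ?_, ?_, ?_⟩
  · rcases hσ with rfl | rfl <;> simpa using ha i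
  · apply mul_left_cancel₀ hD.ne'
    rw [hex' i l, hex i l]
  · intro hb r' hr'
    ext l
    apply mul_left_cancel₀ hD.ne'
    have h1 : D * (M r' ᵥ* fun i l => σ * (τ c * W i l - W i c * τ l) / D) l =
        σ * (τ c * (M r' ᵥ* W) l - (M r' ᵥ* W) c * τ l) := by
      simp only [vecMul, dotProduct]
      rw [Finset.mul_sum]
      simp_rw [mul_left_comm D, hex']
      simp only [Finset.mul_sum, Finset.sum_mul, ← Finset.sum_sub_distrib]
      exact Finset.sum_congr rfl fun i _ => by ring
    rw [h1]
    rcases hr' with hr' | rfl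
    · rw [h.kills hb r' hr']; simp
    · rw [← hτ]; simp
  · intro z hz i
    have hz' := h.fixes z fun r' hr' => hz r' (Or.inl hr')
    -- the new equation in terms of the parameters, because `W z = D z`
    have hτz : ∑ l, (τ l : ℝ) * z l = 0 := by
      have : ∀ l, (τ l : ℝ) * z l = ∑ i, (M r i : ℝ) * ((W i l : ℝ) * z l) := by
        intro l
        simp only [hτ, vecMul, dotProduct, Int.cast_sum, Int.cast_mul, Finset.sum_mul]
        exact Finset.sum_congr rfl fun i _ => by ring
      simp_rw [this]
      rw [Finset.sum_comm]
      simp_rw [← Finset.mul_sum, hz', mul_left_comm _ (D : ℝ)]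
      rw [← Finset.mul_sum, hz r (Or.inr rfl), mul_zero]
    have hD' : (D : ℝ) ≠ 0 := by exact_mod_cast hD.ne'
    apply mul_left_cancel₀ hD'
    rw [Finset.mul_sum]
    have : ∀ l, (D : ℝ) * (((σ * (τ c * W i l - W i c * τ l) / D : ℤ) : ℝ) * z l) =
        σ * τ c * (W i l * z l) - σ * W i c * (τ l * z l) := by
      intro l
      rw [← mul_assoc, hexR]; ring
    simp_rw [this]
    rw [Finset.sum_sub_distrib, ← Finset.mul_sum, ← Finset.mul_sum, hz', hτz]
    push_cast; ring
  · exact fun hb z hz => h.forced hb z fun r' hr' => hz r' (Or.inl hr')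
  -- here the preference for real pivots is needed
  · intro i l hi hl
    apply mul_left_cancel₀ hD.ne'
    rw [hex', h.separated i l hi hl]
    rcases hrl with hrl | hrl
    · rw [h.separated i c hi hrl]; simp
    · rw [hrl l hl]; simp
  · intro l
    apply mul_left_cancel₀ hD.ne'
    rw [hex', h.kept, h.kept, if_neg hcq]
    split_ifs <;> ring

/-- The step of the elimination for an equation without pivot. -/
theorem no_pivot (h : Elimination M rl q μ done W D bad) {r : ρ}
    (hτ : ∀ l, l ≠ q → (M r ᵥ* W) l = 0) :
    Elimination M rl q μ (fun r' => done r' ∨ r' = r) W D (bad ∨ (M r ᵥ* W) q ≠ 0) where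
  pos := h.pos
  cofactor := h.cofactor
  kills := by
    rintro hb r' (hr' | rfl)
    · exact h.kills (fun h => hb (Or.inl h)) r' hr'
    · ext l
      by_cases hl : l = q
      · subst hl
        by_contra hne
        exact hb (Or.inr hne)
      · exact hτ l hl
  fixes := fun z hz => h.fixes z fun r' hr' => hz r' (Or.inl hr')
  forced := by
    rintro (hb | hb) z hz
    · exact h.forced hb z fun r' hr' => hz r' (Or.inl hr')
    · have hz' := h.fixes z fun r' hr' => hz r' (Or.inl hr')
      have h1 : ∑ l, ((M r ᵥ* W) l : ℝ) * z l = 0 := by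
        have : ∀ l, ((M r ᵥ* W) l : ℝ) * z l = ∑ i, (M r i : ℝ) * ((W i l : ℝ) * z l) := by
          intro l
          simp only [vecMul, dotProduct, Int.cast_sum, Int.cast_mul, Finset.sum_mul]
          exact Finset.sum_congr rfl fun i _ => by ring
        simp_rw [this]
        rw [Finset.sum_comm]
        simp_rw [← Finset.mul_sum, hz', mul_left_comm _ (D : ℝ)]
        rw [← Finset.mul_sum, hz r (Or.inr rfl), mul_zero]
      rw [Finset.sum_eq_single q (fun l _ hl => by rw [hτ l hl]; simp) (by simp)] at h1
      rcases mul_eq_zero.1 h1 with h2 | h2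
      · exact absurd (by exact_mod_cast h2) hb
      · exact h2
  separated := h.separated
  kept := h.kept

end Elimination

end Elimination

/-! ### Generators of a lattice of congruences -/

section Lattice

theorem dotProduct_congr_mod {ι : Type*} [Fintype ι] {D : ℤ} {ω v w : ι → ℤ}
    (h : ∀ l, D ∣ v l - w l) : D ∣ ω ⬝ᵥ v - ω ⬝ᵥ w := by
  rw [← dotProduct_sub]
  exact Finset.dvd_sum fun l _ => Dvd.dvd.mul_left (h l) _

theorem dotProduct_sum_mul {ι κ : Type*} [Fintype ι] [Fintype κ] {ω : ι → ℤ} {V : κ → ι → ℤ}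
    (c : κ → ℤ) :
    ω ⬝ᵥ (fun l => ∑ j, c j * V j l) = ∑ j, c j * (ω ⬝ᵥ V j) := by
  simp only [dotProduct, Finset.mul_sum]
  rw [Finset.sum_comm]
  exact Finset.sum_congr rfl fun j _ => Finset.sum_congr rfl fun l _ => by ring

variable {ι κ : Type*} [Fintype ι] [Fintype κ]

/-- The vectors `V j`, `j ≠ p`, are reduced modulo `D`, satisfy `P`, and generate modulo `D` all
integer vectors that satisfy `P`. -/
structure Generates (D : ℤ) (P : (ι → ℤ) → Prop) (p : κ) (V : κ → ι → ℤ) : Prop where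
  mem : ∀ j, j ≠ p → P (V j)
  nonneg : ∀ j, j ≠ p → ∀ l, 0 ≤ V j l
  lt : ∀ j, j ≠ p → ∀ l, V j l < D
  span : ∀ v, P v → ∃ c : κ → ℤ, c p = 0 ∧ ∀ l, D ∣ v l - ∑ j, c j * V j l

/-- The state of the Euclidean algorithm for the generators `V` and the residues `t` modulo `D`
of the functional `ω` on them. The pairs `(V j, t j)` generate all pairs `(v, ω v)` that satisfy
`P`; the generator `p` has a positive residue. -/
structure Residues (D : ℤ) (P : (ι → ℤ) → Prop) (ω : ι → ℤ) (p : κ) (V : κ → ι → ℤ) (t : κ → ℤ) :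
    Prop where
  mem : ∀ j, P (V j)
  nonneg : ∀ j l, 0 ≤ V j l
  lt : ∀ j l, V j l < D
  residue : ∀ j, D ∣ ω ⬝ᵥ V j - t j
  res_nonneg : ∀ j, 0 ≤ t j
  res_le : ∀ j, t j ≤ D
  res_pos : 0 < t p
  span : ∀ v, P v → ∀ τ, D ∣ ω ⬝ᵥ v - τ →
    ∃ c : κ → ℤ, (∀ l, D ∣ v l - ∑ j, c j * V j l) ∧ τ = ∑ j, c j * t j

/-- A condition on integer vectors that defines a subgroup which contains, with every vector,
the vector of remainders modulo `D`. -/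
structure ModClosed (D : ℤ) (P : (ι → ℤ) → Prop) : Prop where
  zero : P 0
  sub_mul : ∀ v w (x : ℤ), P v → P w → P fun l => (v l - x * w l) % D

variable {D : ℤ} {P : (ι → ℤ) → Prop} {p : κ} {V : κ → ι → ℤ} {ω : ι → ℤ} {t : κ → ℤ}

/-- The generators together with the pair `(0, D)` start the Euclidean algorithm. -/
theorem Generates.residues [DecidableEq κ] (h : Generates D P p V) (hP : ModClosed D P)
    (hD : 0 < D) :
    Residues D P ω p (Function.update V p 0)
      (Function.update (fun j => (ω ⬝ᵥ V j) % D) p D) where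
  mem j := by
    by_cases hj : j = p
    · subst hj; simpa using hP.zero
    · simpa [hj] using h.mem j hj
  nonneg j l := by
    by_cases hj : j = p
    · subst hj; simp
    · simpa [hj] using h.nonneg j hj l
  lt j l := by
    by_cases hj : j = p
    · subst hj; simpa using hD
    · simpa [hj] using h.lt j hj l
  residue j := by
    by_cases hj : j = p
    · subst hj; simp
    · simpa [hj] using Int.dvd_self_sub_emod
  res_nonneg j := by
    by_cases hj : j = p
    · subst hj; simpa using hD.le
    · simpa [hj] using Int.emod_nonneg _ hD.ne'
  res_le j := by
    by_cases hj : j = p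
    · subst hj; simp
    · simpa [hj] using (Int.emod_lt_of_pos _ hD).le
  res_pos := by simpa using hD
  span v hv τ hτ := by
    obtain ⟨c, hc, hcv⟩ := h.span v hv
    have h1 : D ∣ τ - ∑ j, c j * ((ω ⬝ᵥ V j) % D) := by
      have h2 : D ∣ ω ⬝ᵥ v - ∑ j, c j * (ω ⬝ᵥ V j) := by
        rw [← dotProduct_sum_mul]; exact dotProduct_congr_mod hcv
      have h3 : D ∣ ∑ j, c j * (ω ⬝ᵥ V j) - ∑ j, c j * ((ω ⬝ᵥ V j) % D) := by
        rw [← Finset.sum_sub_distrib]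
        refine Finset.dvd_sum fun j _ => ?_
        rw [← mul_sub]
        exact Dvd.dvd.mul_left Int.dvd_self_sub_emod _
      have := dvd_sub (dvd_add h2 h3) hτ
      exact this.trans (dvd_of_eq (by ring))
    obtain ⟨x, hx⟩ := h1
    refine ⟨Function.update c p x, fun l => ?_, ?_⟩
    · convert hcv l using 2
      refine Finset.sum_congr rfl fun j _ => ?_
      by_cases hj : j = p
      · subst hj; simp [hc]
      · simp [hj]
    · rw [← Finset.add_sum_erase _ _ (Finset.mem_univ p)] at hx ⊢
      rw [hc] at hx
      have : ∑ j ∈ Finset.univ.erase p, Function.update c p x j *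
          Function.update (fun j => (ω ⬝ᵥ V j) % D) p D j =
          ∑ j ∈ Finset.univ.erase p, c j * ((ω ⬝ᵥ V j) % D) :=
        Finset.sum_congr rfl fun j hj => by simp [(Finset.mem_erase.1 hj).1]
      rw [this]
      simp only [Function.update_self]
      linarith

/-- One division with remainder of the Euclidean algorithm. -/
theorem Residues.step [DecidableEq κ] (h : Residues D P ω p V t) (hP : ModClosed D P) {j : κ}
    (hj : j ≠ p) (htj : t j ≠ 0) :
    Residues D P ω p
      (Function.update (Function.update V p (V j)) j
        fun l => (V p l - t p / t j * V j l) % D)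
      (Function.update (Function.update t p (t j)) j (t p % t j)) := by
  have hD : 0 < D := h.res_pos.trans_le (h.res_le p)
  have htj' : 0 < t j := lt_of_le_of_ne (h.res_nonneg j) htj.symm
  have hmod : t p % t j = t p - t p / t j * t j := by
    rw [Int.emod_def]; ring
  refine ⟨fun k => ?_, fun k l => ?_, fun k l => ?_, fun k => ?_, fun k => ?_, fun k => ?_, ?_, ?_⟩
  · by_cases hk : k = j
    · subst hk; simpa using hP.sub_mul _ _ _ (h.mem p) (h.mem k)
    · by_cases hk' : k = p
      · subst hk'; simpa [hk] using h.mem j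
      · simpa [hk, hk'] using h.mem k
  · by_cases hk : k = j
    · subst hk; simpa using Int.emod_nonneg _ hD.ne'
    · by_cases hk' : k = p
      · subst hk'; simpa [hk] using h.nonneg j l
      · simpa [hk, hk'] using h.nonneg k l
  · by_cases hk : k = j
    · subst hk; simpa using Int.emod_lt_of_pos _ hD
    · by_cases hk' : k = p
      · subst hk'; simpa [hk] using h.lt j l
      · simpa [hk, hk'] using h.lt k l
  · by_cases hk : k = j
    · subst hk
      simp only [Function.update_self]
      rw [hmod]
      have h1 : D ∣ ω ⬝ᵥ (fun l => (V p l - t p / t k * V k l) % D) -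
          ω ⬝ᵥ (V p - (t p / t k) • V k) :=
        dotProduct_congr_mod fun l => by
          simpa using (dvd_neg.2 (Int.dvd_self_sub_emod (x := V p l - t p / t k * V k l)))
      have h2 := dvd_sub (h.residue p) (Dvd.dvd.mul_left (h.residue k) (t p / t k))
      rw [dotProduct_sub, dotProduct_smul, smul_eq_mul] at h1
      have := dvd_add h1 h2
      exact this.trans (dvd_of_eq (by ring))
    · by_cases hk' : k = p
      · subst hk'; simpa [hk] using h.residue j
      · simpa [hk, hk'] using h.residue k
  · by_cases hk : k = j
    · subst hk; simpa using Int.emod_nonneg _ htj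
    · by_cases hk' : k = p
      · subst hk'; simpa [hk] using h.res_nonneg j
      · simpa [hk, hk'] using h.res_nonneg k
  · by_cases hk : k = j
    · subst hk
      simpa using (Int.emod_lt_of_pos _ htj').le.trans (h.res_le k)
    · by_cases hk' : k = p
      · subst hk'; simpa [hk] using h.res_le j
      · simpa [hk, hk'] using h.res_le k
  · simpa [hj.symm] using htj'
  · intro v hv τ hτ
    obtain ⟨c, hc, hct⟩ := h.span v hv τ hτ
    -- the coefficients of the new generators
    set c' : κ → ℤ := Function.update (Function.update c p (c j + t p / t j * c p)) j (c p)
      with hc'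
    have key : ∀ f g : κ → ℤ, (∀ k, k ≠ j → k ≠ p → g k = f k) → g p = f j →
        ∑ k, c k * f k - ∑ k, c' k * g k = c p * (f p - t p / t j * f j - g j) := by
      intro f g hfg hgp
      rw [← Finset.add_sum_erase _ _ (Finset.mem_univ p),
        ← Finset.add_sum_erase _ (fun k => c' k * g k) (Finset.mem_univ p),
        ← Finset.add_sum_erase _ _ (Finset.mem_erase.2 ⟨hj, Finset.mem_univ j⟩),
        ← Finset.add_sum_erase _ (fun k => c' k * g k)
          (Finset.mem_erase.2 ⟨hj, Finset.mem_univ j⟩)]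
      have h1 : ∑ k ∈ (Finset.univ.erase p).erase j, c' k * g k =
          ∑ k ∈ (Finset.univ.erase p).erase j, c k * f k := by
        refine Finset.sum_congr rfl fun k hk => ?_
        have h2 := Finset.mem_erase.1 hk
        have h3 := Finset.mem_erase.1 h2.2
        rw [hfg k h2.1 h3.1, hc']
        simp [h2.1, h3.1]
      have h2 : c' p = c j + t p / t j * c p := by simp [hc', hj.symm]
      have h3 : c' j = c p := by simp [hc']
      rw [h1, h2, h3, hgp]; ring
    refine ⟨c', fun l => ?_, ?_⟩
    · have h1 := key (fun k => V k l) (fun k => (Function.update (Function.update V p (V j)) j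
        fun l => (V p l - t p / t j * V j l) % D) k l) (fun k h2 h3 => by simp [h2, h3])
        (by simp [hj.symm])
      simp only [Function.update_self] at h1
      have h2 : D ∣ c p * (V p l - t p / t j * V j l - (V p l - t p / t j * V j l) % D) :=
        Dvd.dvd.mul_left Int.dvd_self_sub_emod _
      rw [← h1] at h2
      have := dvd_add (hc l) h2
      exact this.trans (dvd_of_eq (by ring))
    · have h1 := key t (Function.update (Function.update t p (t j)) j (t p % t j))
        (fun k h2 h3 => by simp [h2, h3]) (by simp [hj.symm])
      simp only [Function.update_self] at h1
      rw [hmod, sub_self, mul_zero] at h1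
      rw [hct, hmod]; linarith

/-- When all other residues vanish, the remaining vectors generate the vectors on which `ω`
vanishes modulo `D`. -/
theorem Residues.generates (h : Residues D P ω p V t) (ht : ∀ j, j ≠ p → t j = 0) :
    Generates D (fun v => P v ∧ D ∣ ω ⬝ᵥ v) p V where
  mem j hj := ⟨h.mem j, by simpa [ht j hj] using h.residue j⟩
  nonneg j _ := h.nonneg j
  lt j _ := h.lt j
  span v hv := by
    obtain ⟨c, hc, hct⟩ := h.span v hv.1 0 (by simpa using hv.2)
    refine ⟨c, ?_, hc⟩
    rw [Finset.sum_eq_single p (fun j _ hj => by rw [ht j hj, mul_zero]) (by simp)] at hct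
    exact (mul_eq_zero.1 hct.symm).resolve_right h.res_pos.ne'

theorem ModClosed.and_dvd (hP : ModClosed D P) (ω : ι → ℤ) :
    ModClosed D fun v => P v ∧ D ∣ ω ⬝ᵥ v where
  zero := ⟨hP.zero, by simp⟩
  sub_mul v w x hv hw := ⟨hP.sub_mul v w x hv.1 hw.1, by
    have h1 : D ∣ ω ⬝ᵥ (fun l => (v l - x * w l) % D) - ω ⬝ᵥ (v - x • w) :=
      dotProduct_congr_mod fun l => by
        simpa using (dvd_neg.2 (Int.dvd_self_sub_emod (x := v l - x * w l)))
    have h2 := dvd_sub hv.2 (Dvd.dvd.mul_left hw.2 x)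
    rw [dotProduct_sub, dotProduct_smul, smul_eq_mul] at h1
    have := dvd_add h1 h2
    simpa using this⟩

/-- The functionals whose values on the integer parameters have to vanish modulo `D`: the rows of
`W` that belong to integer unknowns, and in the end the coordinate `q` itself. -/
def rowFunctional [DecidableEq ι] (W : Matrix ι ι ℤ) (rl : ι → Prop) [DecidablePred rl] (q i : ι) :
    ι → ℤ :=
  if rl i then 0 else if i = q then Pi.single q 1 else W i

/-- The integer parameters that give integer values to the integer unknowns in `S`. -/
def IntegralOn [DecidableEq ι] (W : Matrix ι ι ℤ) (rl : ι → Prop) [DecidablePred rl] (q : ι) (D : ℤ)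
    (S : ι → Prop) (v : ι → ℤ) : Prop :=
  (∀ l, rl l → v l = 0) ∧ ∀ i, S i → D ∣ rowFunctional W rl q i ⬝ᵥ v

theorem modClosed_integralOn [DecidableEq ι] (W : Matrix ι ι ℤ) (rl : ι → Prop) [DecidablePred rl]
    (q : ι) (D : ℤ) (S : ι → Prop) : ModClosed D (IntegralOn W rl q D S) where
  zero := ⟨fun _ _ => rfl, fun _ _ => by simp⟩
  sub_mul v w x hv hw := by
    refine ⟨fun l hl => by simp [hv.1 l hl, hw.1 l hl], fun i hi => ?_⟩
    have hT : ModClosed D fun _ : ι → ℤ => True := ⟨trivial, fun _ _ _ _ _ => trivial⟩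
    exact ((hT.and_dvd (rowFunctional W rl q i)).sub_mul v w x ⟨trivial, hv.2 i hi⟩
      ⟨trivial, hw.2 i hi⟩).2

end Lattice

/-! ### Solutions of mixed systems -/

section Mixed

variable {ι κ ρ : Type*} [Fintype ι] [DecidableEq ι] [Fintype κ]
  {M : ρ → ι → ℤ} {rl : ι → Prop} [DecidablePred rl] {q : ι} {μ : ℤ} {W : Matrix ι ι ℤ} {D : ℤ}
  {bad : Prop} {p : κ} {V : κ → ι → ℤ} {t : κ → ℤ}

/-- The real vector `z` solves the homogeneous equations with coefficients `M`, and its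
coordinates outside `rl` are integers. -/
def MixedSolution (M : ρ → ι → ℤ) (rl : ι → Prop) (z : ι → ℝ) : Prop :=
  (∀ r, ∑ i, (M r i : ℝ) * z i = 0) ∧ ∀ i, ¬ rl i → ∃ k : ℤ, z i = k

namespace Elimination

/-- Integer parameters that lie in the lattice, together with arbitrary real parameters, give
a solution. -/
theorem mixedSolution_of_param (E : Elimination M rl q μ (fun _ => True) W D bad) (hb : ¬ bad)
    (hq : ¬ rl q) {v : ι → ℝ} {u : ι → ℤ} (hu : IntegralOn W rl q D (· ≠ q) u)
    (huv : ∀ l, ¬ rl l → v l = u l) {z : ι → ℝ} (hz : ∀ i, D * z i = ∑ l, (W i l : ℝ) * v l) :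
    MixedSolution M rl z ∧ z q = u q := by
  have hD : (D : ℝ) ≠ 0 := by exact_mod_cast E.pos.ne'
  have hzq : z q = u q := by
    apply mul_left_cancel₀ hD
    rw [hz, Finset.sum_eq_single q (fun l _ hl => by rw [E.kept, if_neg hl]; simp) (by simp),
      E.kept, if_pos rfl, huv q hq]
  refine ⟨⟨fun r => ?_, fun i hi => ?_⟩, hzq⟩
  · apply mul_left_cancel₀ hD
    rw [Finset.mul_sum]
    simp_rw [mul_left_comm (D : ℝ), hz, Finset.mul_sum]
    rw [Finset.sum_comm]
    have : ∀ l, ∑ i, (M r i : ℝ) * ((W i l : ℝ) * v l) = 0 := by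
      intro l
      have h1 := congrFun (E.kills hb r trivial) l
      simp only [vecMul, dotProduct, Pi.zero_apply] at h1
      simp_rw [← mul_assoc]
      rw [← Finset.sum_mul]
      have h2 : (∑ i, (M r i : ℝ) * (W i l : ℝ)) = 0 := by exact_mod_cast h1
      rw [h2, zero_mul]
    simp [this]
  · by_cases hiq : i = q
    · subst hiq; exact ⟨u i, hzq⟩
    · obtain ⟨k, hk⟩ := hu.2 i hiq
      refine ⟨k, ?_⟩
      apply mul_left_cancel₀ hD
      have h1 : rowFunctional W rl q i = W i := by simp [rowFunctional, hi, hiq]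
      rw [h1] at hk
      have h2 : ∑ l, (W i l : ℝ) * v l = ∑ l, (W i l : ℝ) * (u l : ℝ) := by
        refine Finset.sum_congr rfl fun l _ => ?_
        by_cases hl : rl l
        · rw [E.separated i l hi hl]; simp
        · rw [huv l hl]
      rw [hz, h2]
      have h3 : ∑ l, W i l * u l = D * k := hk
      exact_mod_cast h3

/-- The integer coordinates of a solution are parameters that lie in the lattice. -/
theorem integralOn_of_mixedSolution (E : Elimination M rl q μ (fun _ => True) W D bad)
    {z : ι → ℝ} (hz : MixedSolution M rl z) :
    ∃ u : ι → ℤ, IntegralOn W rl q D (· ≠ q) u ∧ ∀ l, ¬ rl l → z l = u l := by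
  classical
  choose! f hf using hz.2
  refine ⟨fun l => if rl l then 0 else f l, ⟨fun l hl => by simp [hl], fun i hi => ?_⟩,
    fun l hl => by simp [hl, hf l hl]⟩
  by_cases hir : rl i
  · simp [rowFunctional, hir]
  · have h1 : rowFunctional W rl q i = W i := by simp [rowFunctional, hir, hi]
    have h2 := E.fixes z (fun r _ => hz.1 r) i
    rw [h1]
    refine ⟨f i, ?_⟩
    have h3 : ∑ l, (W i l : ℝ) * z l = ∑ l, (W i l : ℝ) * ((if rl l then 0 else f l : ℤ) : ℝ) := by
      refine Finset.sum_congr rfl fun l _ => ?_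
      by_cases hl : rl l
      · rw [E.separated i l hir hl]; simp
      · simp [hl, hf l hl]
    rw [h3, hf i hir] at h2
    have h4 : ∑ l, W i l * (if rl l then 0 else f l) = D * f i := by exact_mod_cast h2
    exact h4

/-- If the greatest common divisor is `1`, the last generator can be changed modulo `D` so that
its coordinate `q` is `1`. -/
theorem integralOn_update (hq : ¬ rl q)
    (h : Residues D (IntegralOn W rl q D (· ≠ q)) (Pi.single q 1) p V t) (htp : t p = 1) :
    IntegralOn W rl q D (· ≠ q) (Function.update (V p) q 1) := by
  have h1 := h.residue p
  rw [htp, single_one_dotProduct] at h1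
  refine ⟨fun l hl => ?_, fun i hi => ?_⟩
  · rw [Function.update_of_ne (by rintro rfl; exact hq hl), (h.mem p).1 l hl]
  · have h2 := (h.mem p).2 i hi
    have h3 : D ∣ rowFunctional W rl q i ⬝ᵥ Function.update (V p) q 1 -
        rowFunctional W rl q i ⬝ᵥ V p := dotProduct_congr_mod fun l => by
      by_cases hl : l = q
      · subst hl; rw [Function.update_self]; exact (dvd_sub_comm).1 h1
      · simp [hl]
    exact (dvd_sub_left h2).1 h3

/-- The system is solvable with `z q = 1` if and only if the elimination found no contradiction
and the greatest common divisor `t p` of the values of the coordinate `q` is `1`. -/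
theorem exists_solution_iff (E : Elimination M rl q μ (fun _ => True) W D bad) (hq : ¬ rl q)
    (h : Residues D (IntegralOn W rl q D (· ≠ q)) (Pi.single q 1) p V t)
    (ht : ∀ j, j ≠ p → t j = 0) :
    (¬ bad ∧ t p = 1) ↔ ∃ z, MixedSolution M rl z ∧ z q = 1 := by
  constructor
  · rintro ⟨hb, htp⟩
    have hu := integralOn_update hq h htp
    have hD : (D : ℝ) ≠ 0 := by exact_mod_cast E.pos.ne'
    have := E.mixedSolution_of_param hb hq hu (v := fun l => (Function.update (V p) q 1 l : ℤ))
      (fun l _ => rfl)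
      (z := fun i => (∑ l, (W i l : ℝ) * ((Function.update (V p) q 1 l : ℤ) : ℝ)) / D)
      (fun i => mul_div_cancel₀ _ hD)
    exact ⟨_, this.1, by rw [this.2]; simp⟩
  · rintro ⟨z, hz, hzq⟩
    refine ⟨fun hb => ?_, ?_⟩
    · have := E.forced hb z fun r _ => hz.1 r
      rw [hzq] at this; exact one_ne_zero this
    · obtain ⟨u, hu, huz⟩ := E.integralOn_of_mixedSolution hz
      have huq : u q = 1 := by
        have := huz q hq
        rw [hzq] at this; exact_mod_cast this.symm
      -- all residues but `t p` vanish, so that `t p` divides the coordinate `1` of `u`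
      obtain ⟨c, -, hc⟩ := h.span u hu 1 (by rw [single_one_dotProduct, huq]; simp)
      rw [Finset.sum_eq_single p (fun j _ hj => by rw [ht j hj, mul_zero]) (by simp)] at hc
      exact Int.eq_one_of_dvd_one h.res_pos.le ⟨c p, by rw [hc]; ring⟩

/-- The solutions with `z q = 0`: the columns of `W` of the real unknowns span them over the
reals, and the images of the lattice generators, together with the multiples of `D`, over the
integers. -/
theorem kernel_iff (E : Elimination M rl q μ (fun _ => True) W D bad) (hb : ¬ bad) (hq : ¬ rl q)
    (h : Residues D (IntegralOn W rl q D (· ≠ q)) (Pi.single q 1) p V t)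
    (ht : ∀ j, j ≠ p → t j = 0) (z : ι → ℝ) :
    (MixedSolution M rl z ∧ z q = 0) ↔ ∃ (a : ι → ℝ) (c : κ → ℤ) (d : ι → ℤ), c p = 0 ∧
      ∀ i, D * z i = ∑ l, (W i l : ℝ) * ((if rl l then a l else 0) + (∑ j, c j * V j l : ℤ) +
        (if ¬ rl l ∧ l ≠ q then (D : ℝ) * d l else 0)) := by
  have hD : (D : ℝ) ≠ 0 := by exact_mod_cast E.pos.ne'
  have hgen := h.generates ht
  have hVq : ∀ j, j ≠ p → V j q = 0 := by
    intro j hj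
    have h1 := (hgen.mem j hj).2
    rw [single_one_dotProduct] at h1
    exact Int.eq_zero_of_dvd_of_nonneg_of_lt (hgen.nonneg j hj q) (hgen.lt j hj q) h1
  constructor
  · rintro ⟨hz, hzq⟩
    obtain ⟨u, hu, huz⟩ := E.integralOn_of_mixedSolution hz
    have huq : u q = 0 := by
      have := huz q hq
      rw [hzq] at this; exact_mod_cast this.symm
    obtain ⟨c, hcp, hc⟩ := hgen.span u ⟨hu, by rw [single_one_dotProduct, huq]; simp⟩
    choose d hd using hc
    refine ⟨z, c, d, hcp, fun i => ?_⟩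
    rw [← E.fixes z (fun r _ => hz.1 r) i]
    refine Finset.sum_congr rfl fun l _ => ?_
    congr 1
    by_cases hl : rl l
    · have h0 : ∑ j, c j * V j l = 0 := Finset.sum_eq_zero fun j _ => by
        by_cases hj : j = p
        · rw [hj, hcp, zero_mul]
        · rw [(hgen.mem j hj).1.1 l hl, mul_zero]
      simp [hl, h0]
    · by_cases hlq : l = q
      · subst hlq
        have h0 : ∑ j, c j * V j l = 0 := Finset.sum_eq_zero fun j _ => by
          by_cases hj : j = p
          · rw [hj, hcp, zero_mul]
          · rw [hVq j hj, mul_zero]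
        simp [hl, h0, hzq]
      · have h1 : u l = ∑ j, c j * V j l + D * d l := by have := hd l; linarith
        have h2 : (u l : ℝ) = (∑ j, c j * V j l : ℤ) + D * d l := by exact_mod_cast h1
        rw [if_neg hl, if_pos ⟨hl, hlq⟩, huz l hl, h2]; ring
  · rintro ⟨a, c, d, hcp, hz⟩
    set u : ι → ℤ := fun l => ∑ j, c j * V j l + (if ¬ rl l ∧ l ≠ q then D * d l else 0) with hu
    have huI : IntegralOn W rl q D (· ≠ q) u := by
      have h1 : ∀ i, i ≠ q → D ∣ rowFunctional W rl q i ⬝ᵥ (fun l => ∑ j, c j * V j l) := by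
        intro i hi
        rw [dotProduct_sum_mul]
        exact Finset.dvd_sum fun j _ => Dvd.dvd.mul_left ((h.mem j).2 i hi) _
      refine ⟨fun l hl => ?_, fun i hi => ?_⟩
      · have h0 : ∑ j, c j * V j l = 0 := Finset.sum_eq_zero fun j _ => by
          rw [(h.mem j).1 l hl, mul_zero]
        simp [hu, hl, h0]
      · have h3 : D ∣ rowFunctional W rl q i ⬝ᵥ u -
            rowFunctional W rl q i ⬝ᵥ (fun l => ∑ j, c j * V j l) :=
            dotProduct_congr_mod fun l => by
          simp only [hu, add_sub_cancel_left]
          split_ifs <;> simp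
        exact (dvd_sub_left (h1 i hi)).1 h3
    have huq : u q = 0 := by
      have h0 : ∑ j, c j * V j q = 0 := Finset.sum_eq_zero fun j _ => by
        by_cases hj : j = p
        · rw [hj, hcp, zero_mul]
        · rw [hVq j hj, mul_zero]
      simp [hu, h0]
    have := E.mixedSolution_of_param hb hq huI (fun l hl => ?_) hz
    · rw [huq] at this; simpa using this
    · simp only [hu, hl]; simp

end Elimination

end Mixed

/-! ### Congruence modulo a primitive group -/

namespace Primitive

/-- The primitive groups that are quotients of `ℝ`: their elements are represented by arbitrary
real numbers, those of the other primitive groups by integers only. -/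
def IsReal : Primitive → Prop
  | int => False
  | real => True
  | cyclic _ => False
  | circle => True

instance : DecidablePred IsReal := fun P => by
  cases P <;> unfold IsReal <;> infer_instance

theorem Congr.unique {P : Primitive} {x : ℝ} {g g' : P.Carrier} (h : P.Congr x g)
    (h' : P.Congr x g') : g = g' := by
  cases P with
  | int => exact Int.cast_injective (α := ℝ) (h.symm.trans h')
  | real => exact (show x = g from h).symm.trans h'
  | cyclic N =>
    obtain ⟨k, rfl, hk⟩ := h
    obtain ⟨k', hkk', hk'⟩ := h'
    rw [Int.cast_inj] at hkk'
    subst hkk'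
    exact hk.symm.trans hk'
  | circle => exact (show (x : UnitAddCircle) = g from h).symm.trans h'

theorem Congr.iff_exists {P : Primitive} {x : ℝ} {g : P.Carrier} (h : P.Congr x g) (x' : ℝ) :
    P.Congr x' g ↔ ∃ k : ℤ, x' = x + P.char * k := by
  cases P with
  | int =>
    have h : x = ((show ℤ from g) : ℝ) := h
    simp [Congr, char, h]
  | real =>
    simp only [char, Nat.cast_zero, zero_mul, add_zero, exists_const]
    rw [show x = (show ℝ from g) from h]
    rfl
  | cyclic N =>
    obtain ⟨k, rfl, hk⟩ := h
    constructor
    · rintro ⟨k', rfl, hk'⟩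
      rw [← hk, ZMod.intCast_eq_intCast_iff_dvd_sub] at hk'
      obtain ⟨j, hj⟩ := hk'
      refine ⟨-j, ?_⟩
      have : k' = k + (N : ℕ) * (-j) := by linarith
      simp only [char]; exact_mod_cast this
    · rintro ⟨j, rfl⟩
      refine ⟨k + (N : ℕ) * j, by simp [char], ?_⟩
      rw [← hk]; simp
  | circle =>
    have h : (x : UnitAddCircle) = (show UnitAddCircle from g) := h
    simp only [Congr, char, ← h]
    rw [eq_comm, ← sub_eq_zero, ← AddCircle.coe_sub, AddCircle.coe_eq_zero_iff]
    constructor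
    · rintro ⟨k, hk⟩
      refine ⟨-k, ?_⟩
      simp at hk ⊢; linarith
    · rintro ⟨k, hk⟩
      refine ⟨-k, ?_⟩
      simp at hk ⊢; linarith

theorem congr_zero (P : Primitive) : P.Congr 0 0 := by
  cases P with
  | int => exact Int.cast_zero.symm
  | real => exact rfl
  | cyclic N => exact ⟨0, by simp, Int.cast_zero⟩
  | circle => exact rfl

theorem exists_congr (P : Primitive) (g : P.Carrier) : ∃ x, P.Congr x g := by
  cases P with
  | int => exact ⟨_, rfl⟩
  | real => exact ⟨_, rfl⟩
  | cyclic N =>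
    obtain ⟨k, hk⟩ := ZMod.intCast_surjective (show ZMod (N : ℕ) from g)
    exact ⟨k, k, rfl, hk⟩
  | circle => exact QuotientAddGroup.mk_surjective (show UnitAddCircle from g)

theorem Congr.exists_int {P : Primitive} (hP : ¬ P.IsReal) {x : ℝ} {g : P.Carrier}
    (h : P.Congr x g) : ∃ k : ℤ, x = k := by
  cases P with
  | int => exact ⟨_, h⟩
  | real => exact (hP trivial).elim
  | cyclic N => obtain ⟨k, hk, -⟩ := h; exact ⟨k, hk⟩
  | circle => exact (hP trivial).elim

theorem exists_carrier_congr (P : Primitive) {x : ℝ} (hx : ¬ P.IsReal → ∃ k : ℤ, x = k) :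
    ∃ g, P.Congr x g := by
  cases P with
  | int => obtain ⟨k, hk⟩ := hx id; exact ⟨k, hk⟩
  | real => exact ⟨x, rfl⟩
  | cyclic N => obtain ⟨k, hk⟩ := hx id; exact ⟨(k : ZMod (N : ℕ)), k, hk, rfl⟩
  | circle => exact ⟨(x : UnitAddCircle), rfl⟩

/-- A continuous real-valued homomorphism induces a continuous homomorphism to a primitive group
if its values represent elements of that group. -/
theorem exists_continuousHom (P : Primitive) {X : Type*} [AddCommGroup X] [TopologicalSpace X]
    (f : X →+ ℝ) (hf : Continuous f) (hP : ¬ P.IsReal → ∀ x, ∃ k : ℤ, f x = k) :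
    ∃ g : X →ₜ+ P.Carrier, ∀ x, P.Congr (f x) (g x) := by
  have key : (∀ x, ∃ k : ℤ, f x = k) → ∃ g : X →ₜ+ ℤ, ∀ x, f x = g x := by
    intro h
    choose k hk using h
    have hc : Continuous k := by
      rw [Int.isClosedEmbedding_coe_real.isEmbedding.continuous_iff]
      convert hf using 1
      ext x; exact (hk x).symm
    refine ⟨⟨⟨⟨k, ?_⟩, fun x y => ?_⟩, hc⟩, hk⟩
    · have := hk 0
      rw [map_zero] at this; exact_mod_cast this.symm
    · have := hk (x + y)
      rw [map_add, hk, hk] at this; exact_mod_cast this.symm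
  cases P with
  | int => exact key (hP id)
  | real => exact ⟨⟨f, hf⟩, fun x => rfl⟩
  | cyclic N =>
    obtain ⟨k, hk⟩ := key (hP id)
    let c : ℤ →ₜ+ (cyclic N).Carrier :=
      ⟨(Int.castAddHom (ZMod (N : ℕ)) : ℤ →+ ZMod (N : ℕ)), continuous_of_discreteTopology⟩
    exact ⟨c.comp k, fun x => ⟨k x, hk x, rfl⟩⟩
  | circle =>
    let c : ℝ →ₜ+ circle.Carrier :=
      ⟨(QuotientAddGroup.mk' (AddSubgroup.zmultiples (1 : ℝ)) : ℝ →+ UnitAddCircle),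
        AddCircle.continuous_mk' 1⟩
    exact ⟨c.comp ⟨f, hf⟩, fun x => rfl⟩

/-- The real number that represents an element of `ℤ` or `ℝ`. For the other primitive groups the
value is irrelevant. -/
noncomputable def toReal : (P : Primitive) → P.Carrier →+ ℝ
  | int => (Int.castAddHom ℝ : ℤ →+ ℝ)
  | real => AddMonoidHom.id ℝ
  | cyclic _ => 0
  | circle => 0

theorem continuous_toReal (P : Primitive) : Continuous P.toReal := by
  cases P with
  | int => exact Int.isClosedEmbedding_coe_real.continuous
  | real => exact continuous_id
  | cyclic N => exact continuous_const
  | circle => exact continuous_const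

end Primitive

theorem TupleCongr.unique {m : ℕ} {G : Fin m → Primitive} {x : Fin m → ℝ}
    {g g' : ElementaryGroup G} (h : TupleCongr G x g) (h' : TupleCongr G x g') : g = g' :=
  funext fun i => (h i).unique (h' i)

theorem tupleCongr_realInt_iff {r k : ℕ} (x : Fin (r + k) → ℝ)
    (w : ElementaryGroup (realIntFactors r k)) :
    TupleCongr (realIntFactors r k) x w ↔ x = fun i => (realIntFactors r k i).toReal (w i) := by
  have key : ∀ P : Primitive, P = .real ∨ P = .int → ∀ (x : ℝ) (g : P.Carrier),
      P.Congr x g ↔ x = P.toReal g := by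
    rintro P (rfl | rfl) x g <;> exact Iff.rfl
  have hP : ∀ i, realIntFactors r k i = .real ∨ realIntFactors r k i = .int := by
    intro i
    refine Fin.addCases (fun i => ?_) (fun i => ?_) i
    · left; simp [realIntFactors]
    · right; simp [realIntFactors]
  rw [funext_iff]
  exact forall_congr' fun i => key _ (hP i) _ _

theorem exists_realInt {r k : ℕ} (a : Fin r → ℝ) (c : Fin k → ℤ) :
    ∃ w, TupleCongr (realIntFactors r k) (Fin.append a fun j => (c j : ℝ)) w := by
  have : ∀ i, ∃ g, (realIntFactors r k i).Congr (Fin.append a (fun j => (c j : ℝ)) i) g := by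
    intro i
    apply Primitive.exists_carrier_congr
    refine Fin.addCases (fun i => ?_) (fun i => ?_) i
    · intro h; exact (h (by simp [realIntFactors, Primitive.IsReal])).elim
    · intro _; exact ⟨c i, by simp⟩
  choose w hw using this
  exact ⟨w, hw⟩

theorem TupleCongr.exists_append {r k : ℕ} {x : Fin (r + k) → ℝ}
    {w : ElementaryGroup (realIntFactors r k)} (h : TupleCongr (realIntFactors r k) x w) :
    ∃ (a : Fin r → ℝ) (c : Fin k → ℤ), x = Fin.append a fun j => (c j : ℝ) := by
  have : ∀ j : Fin k, ∃ c : ℤ, x (Fin.natAdd r j) = c := fun j =>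
    (h (Fin.natAdd r j)).exists_int (by simp [realIntFactors, Primitive.IsReal])
  choose c hc using this
  refine ⟨fun i => x (Fin.castAdd k i), c, funext fun i => ?_⟩
  refine Fin.addCases (fun i => ?_) (fun i => ?_) i
  · simp
  · simp [hc]

/-- A real matrix represents a continuous homomorphism from `ℝ^r × ℤ^k` to `G` if its rows of
integral type vanish on `ℝ^r` and are integral on `ℤ^k`. -/
theorem exists_isMatrixRep {m r k : ℕ} (G : Fin m → Primitive)
    (E : Matrix (Fin m) (Fin (r + k)) ℝ)
    (hE : ∀ i, ¬ (G i).IsReal → (∀ j, E i (Fin.castAdd k j) = 0) ∧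
      ∀ j, ∃ c : ℤ, E i (Fin.natAdd r j) = c) :
    ∃ ε : ElementaryGroup (realIntFactors r k) →ₜ+ ElementaryGroup G, IsMatrixRep ε E := by
  have : ∀ i, ∃ g : ElementaryGroup (realIntFactors r k) →ₜ+ (G i).Carrier, ∀ w,
      (G i).Congr (E.mulVec (fun j => (realIntFactors r k j).toReal (w j)) i) (g w) := by
    intro i
    let f : ElementaryGroup (realIntFactors r k) →+ ℝ :=
      { toFun := fun w => E.mulVec (fun j => (realIntFactors r k j).toReal (w j)) i
        map_zero' := by simp [mulVec, dotProduct]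
        map_add' := fun v w => by
          simp [mulVec, dotProduct, mul_add, Finset.sum_add_distrib] }
    refine (G i).exists_continuousHom f ?_ ?_
    · have : Continuous fun w : ElementaryGroup (realIntFactors r k) =>
          ∑ j, E i j * (realIntFactors r k j).toReal (w j) :=
        continuous_finsetSum _ fun j _ => Continuous.mul continuous_const
          ((Primitive.continuous_toReal (realIntFactors r k j)).comp (continuous_apply j))
      exact this
    · intro hi w
      obtain ⟨a, c, hac⟩ := ((tupleCongr_realInt_iff _ w).2 rfl).exists_append
      obtain ⟨h0, h1⟩ := hE i hi
      choose e he using h1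
      refine ⟨∑ j, e j * c j, ?_⟩
      change E.mulVec (fun j => (realIntFactors r k j).toReal (w j)) i = _
      rw [hac]
      simp [mulVec, dotProduct, Fin.sum_univ_add, h0, he]
  choose g hg using this
  refine ⟨⟨⟨⟨fun w i => g i w, ?_⟩, fun v w => ?_⟩, ?_⟩, fun w x hx i => ?_⟩
  · ext i; simp
  · ext i; simp
  · exact continuous_pi fun i => (g i).continuous_toFun
  · rw [tupleCongr_realInt_iff] at hx
    subst hx
    exact hg i w

/-! ### The mixed system that belongs to a homomorphism -/

section System

variable {m n : ℕ}

/-- The index of the homomorphism's `i`-th argument among the unknowns. -/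
def unknown (n : ℕ) (i : Fin m) : Fin (m + n + 1) := (Fin.castAdd n i).castSucc

/-- The integral coefficients of the equations `Δ (∑ i, A r i * x i - d r * y r - b r * s) = 0` in
the unknowns `x`, `y`, `s`, where `d r` is the characteristic of `H r` and `Δ` is a common
denominator. -/
def systemMatrix (H : Fin n → Primitive) (A : Matrix (Fin n) (Fin m) ℚ) (b : Fin n → ℚ) (Δ : ℕ)
    (r : Fin n) (i : Fin (m + n + 1)) : ℤ :=
  if h : (i : ℕ) < m then (A r ⟨i, h⟩).num * ((Δ : ℤ) / (A r ⟨i, h⟩).den)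
  else if (i : ℕ) = m + r then -((H r).char * Δ)
  else if (i : ℕ) = m + n then -((b r).num * ((Δ : ℤ) / (b r).den)) else 0

/-- The unknowns that range over the real numbers. -/
def realUnknown (G : Fin m → Primitive) (i : Fin (m + n + 1)) : Prop :=
  ∃ h : (i : ℕ) < m, (G ⟨i, h⟩).IsReal

instance (G : Fin m → Primitive) : DecidablePred (realUnknown (n := n) G) := fun i => by
  unfold realUnknown; infer_instance

theorem realUnknown_unknown (G : Fin m → Primitive) (i : Fin m) :
    realUnknown G (unknown n i) ↔ (G i).IsReal := by
  simp [realUnknown, unknown]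

theorem not_realUnknown_last (G : Fin m → Primitive) : ¬ realUnknown G (Fin.last (m + n)) := by
  simp [realUnknown]

theorem cast_num_mul_div {q : ℚ} {Δ : ℕ} (h : q.den ∣ Δ) :
    ((q.num * ((Δ : ℤ) / q.den) : ℤ) : ℝ) = Δ * (q : ℝ) := by
  obtain ⟨e, rfl⟩ := h
  have h0 : (q.den : ℤ) ≠ 0 := by exact_mod_cast q.den_nz
  have h1 : ((q.den : ℕ) : ℝ) ≠ 0 := by exact_mod_cast q.den_nz
  have h2 : (q : ℝ) = q.num / q.den := by exact_mod_cast (Rat.num_div_den q).symm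
  rw [Nat.cast_mul, Int.mul_ediv_cancel_left _ h0, h2]
  push_cast
  field_simp

theorem sum_systemMatrix {H : Fin n → Primitive} {A : Matrix (Fin n) (Fin m) ℚ} {b : Fin n → ℚ}
    {Δ : ℕ} (hA : ∀ r i, (A r i).den ∣ Δ) (hb : ∀ r, (b r).den ∣ Δ) (r : Fin n)
    (z : Fin (m + n + 1) → ℝ) :
    ∑ i, (systemMatrix H A b Δ r i : ℝ) * z i =
      Δ * ((A.map fun q : ℚ => (q : ℝ)).mulVec (fun i => z (unknown n i)) r -
        (H r).char * z (Fin.natAdd m r).castSucc - b r * z (Fin.last (m + n))) := by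
  rw [Fin.sum_univ_castSucc, Fin.sum_univ_add]
  have h1 : ∀ i : Fin m, (systemMatrix H A b Δ r (Fin.castAdd n i).castSucc : ℝ) =
      Δ * (A r i : ℝ) := by
    intro i
    rw [← cast_num_mul_div (hA r i)]
    simp [systemMatrix]
  have h2 : ∀ j : Fin n, (systemMatrix H A b Δ r (Fin.natAdd m j).castSucc : ℝ) =
      if j = r then -((H r).char * Δ : ℝ) else 0 := by
    intro j
    have hj : (j : ℕ) ≠ n := j.2.ne
    have : (j : ℕ) = r ↔ j = r := Fin.ext_iff.symm
    by_cases hjr : j = r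
    · subst hjr; simp [systemMatrix]
    · simp [systemMatrix, this, hjr, hj]
  have h3 : (systemMatrix H A b Δ r (Fin.last (m + n)) : ℝ) = -(Δ * (b r : ℝ)) := by
    have hr : n ≠ (r : ℕ) := r.2.ne'
    rw [← cast_num_mul_div (hb r)]
    simp [systemMatrix, hr]
  simp_rw [h1, h2, h3]
  simp only [ite_mul, zero_mul, Finset.sum_ite_eq', Finset.mem_univ, if_true, mulVec, dotProduct,
    map_apply, unknown]
  rw [mul_sub, mul_sub, Finset.mul_sum]
  simp_rw [mul_assoc]
  ring

/-- The equation `φ g = h` as a mixed system. The right hand side is a multiple `b * s`; the case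
`s = 1` gives the solutions, and the case `s = 0` the kernel. -/
theorem apply_eq_iff_exists_mixedSolution {G : Fin m → Primitive} {H : Fin n → Primitive}
    {φ : ElementaryGroup G →ₜ+ ElementaryGroup H} {A : Matrix (Fin n) (Fin m) ℚ} {b : Fin n → ℚ}
    {Δ : ℕ} (hΔ : Δ ≠ 0) (hA : ∀ r i, (A r i).den ∣ Δ) (hb : ∀ r, (b r).den ∣ Δ)
    (hφ : IsMatrixRep φ (A.map fun q : ℚ => (q : ℝ))) {s : ℤ} {h : ElementaryGroup H}
    (hs : TupleCongr H (fun j => b j * s) h) {x : Fin m → ℝ} {g : ElementaryGroup G}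
    (hx : TupleCongr G x g) :
    φ g = h ↔ ∃ z : Fin (m + n + 1) → ℝ, MixedSolution (systemMatrix H A b Δ) (realUnknown G) z ∧
      z (Fin.last (m + n)) = s ∧ ∀ i, z (unknown n i) = x i := by
  have hAx := hφ g x hx
  have hΔ' : (Δ : ℝ) ≠ 0 := by exact_mod_cast hΔ
  have h1 : φ g = h ↔ ∀ j, ∃ k : ℤ,
      (A.map fun q : ℚ => (q : ℝ)).mulVec x j = b j * s + (H j).char * k := by
    constructor
    · rintro rfl j
      exact ((hs j).iff_exists _).1 (hAx j)
    · intro hj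
      exact TupleCongr.unique hAx fun j => ((hs j).iff_exists _).2 (hj j)
  rw [h1]
  constructor
  · intro hk
    choose y hy using hk
    refine ⟨Fin.snoc (Fin.append x fun j => (y j : ℝ)) (s : ℝ), ⟨fun r => ?_, fun i hi => ?_⟩,
      by simp, fun i => by simp [unknown]⟩
    · rw [sum_systemMatrix hA hb]
      simp only [unknown, Fin.snoc_castSucc, Fin.append_left, Fin.append_right, Fin.snoc_last]
      rw [hy]; ring
    · refine Fin.lastCases ?_ (fun i => ?_) i (motive := fun i => ¬ realUnknown G i → ∃ k : ℤ,
        (Fin.snoc (Fin.append x fun j => (y j : ℝ)) (s : ℝ) : Fin (m + n + 1) → ℝ) i = k) hi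
      · intro _; exact ⟨s, by simp⟩
      · refine Fin.addCases (fun i => ?_) (fun i => ?_) i
        · intro hi
          simp only [Fin.snoc_castSucc, Fin.append_left]
          exact (hx i).exists_int ((realUnknown_unknown G i).not.1 hi)
        · intro _; exact ⟨y i, by simp only [Fin.snoc_castSucc, Fin.append_right]⟩
  · rintro ⟨z, ⟨hz, hzi⟩, hzs, hzx⟩ j
    obtain ⟨k, hk⟩ := hzi (Fin.natAdd m j).castSucc (by simp [realUnknown])
    refine ⟨k, ?_⟩
    have := hz j
    rw [sum_systemMatrix hA hb, hzs, hk] at this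
    have := (mul_eq_zero.1 this).resolve_left hΔ'
    simp_rw [hzx] at this
    linarith

theorem exists_apply_eq_iff {G : Fin m → Primitive} {H : Fin n → Primitive}
    {φ : ElementaryGroup G →ₜ+ ElementaryGroup H} {A : Matrix (Fin n) (Fin m) ℚ} {b : Fin n → ℚ}
    {Δ : ℕ} (hΔ : Δ ≠ 0) (hA : ∀ r i, (A r i).den ∣ Δ) (hb : ∀ r, (b r).den ∣ Δ)
    (hφ : IsMatrixRep φ (A.map fun q : ℚ => (q : ℝ))) {h : ElementaryGroup H}
    (hs : TupleCongr H (fun j => (b j : ℝ)) h) :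
    (∃ g, φ g = h) ↔ ∃ z : Fin (m + n + 1) → ℝ,
      MixedSolution (systemMatrix H A b Δ) (realUnknown G) z ∧ z (Fin.last (m + n)) = 1 := by
  have hs' : TupleCongr H (fun j => b j * ((1 : ℤ) : ℝ)) h := by simpa using hs
  constructor
  · rintro ⟨g, hg⟩
    choose x hx using fun i => (G i).exists_congr (g i)
    obtain ⟨z, h1, h2, -⟩ := (apply_eq_iff_exists_mixedSolution hΔ hA hb hφ hs' hx).1 hg
    exact ⟨z, h1, by simpa using h2⟩
  · rintro ⟨z, h1, h2⟩
    choose g hg using fun i => (G i).exists_carrier_congr (x := z (unknown n i))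
      fun hi => h1.2 _ ((realUnknown_unknown G i).not.2 hi)
    exact ⟨g, (apply_eq_iff_exists_mixedSolution hΔ hA hb hφ hs' hg).2
      ⟨z, h1, by simpa using h2, fun i => rfl⟩⟩

/-- The parameter vectors of the general solution: unit vectors for the real unknowns, the lattice
generators, and the multiples by `D` of the unit vectors of the integer unknowns. -/
def columnVector (G : Fin m → Primitive) (D : ℤ)
    (V : Fin (m + n + 1 + 1) → Fin (m + n + 1) → ℤ) :
    Fin (m + ((m + n + 1) + (m + n + 1))) → Fin (m + n + 1) → ℤ :=
  Fin.append (fun i => if (G i).IsReal then Pi.single (unknown n i) 1 else 0)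
    (Fin.append (fun j => V j.castSucc)
      (fun j => if ¬ realUnknown G j ∧ j ≠ Fin.last (m + n) then Pi.single j D else 0))

/-- The matrix of the homomorphism that parametrizes the kernel. -/
def kernelMatrix (G : Fin m → Primitive) (D : ℤ)
    (V : Fin (m + n + 1 + 1) → Fin (m + n + 1) → ℤ)
    (W : Matrix (Fin (m + n + 1)) (Fin (m + n + 1)) ℤ) :
    Matrix (Fin m) (Fin (m + ((m + n + 1) + (m + n + 1)))) ℚ :=
  fun i c => ((W (unknown n i) ⬝ᵥ columnVector G D V c : ℤ) : ℚ) / D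

/-- The particular solution. -/
def particularSolution (D : ℤ) (V : Fin (m + n + 1 + 1) → Fin (m + n + 1) → ℤ)
    (W : Matrix (Fin (m + n + 1)) (Fin (m + n + 1)) ℤ) (i : Fin m) : ℚ :=
  ((W (unknown n i) ⬝ᵥ Function.update (V (Fin.last _)) (Fin.last (m + n)) 1 : ℤ) : ℚ) / D

/-- The linear combinations of the parameter vectors, in the form of `Elimination.kernel_iff`. -/
theorem sum_columnVector (G : Fin m → Primitive) (D : ℤ)
    (V : Fin (m + n + 1 + 1) → Fin (m + n + 1) → ℤ) (a : Fin (m + n + 1) → ℝ)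
    (c d : Fin (m + n + 1) → ℤ) (l : Fin (m + n + 1)) :
    ∑ j, (columnVector G D V j l : ℝ) *
        Fin.append (fun i => a (unknown n i)) (fun j => ((Fin.append c d j : ℤ) : ℝ)) j =
      (if realUnknown G l then a l else 0) +
        (∑ j, (Fin.snoc c 0 : Fin (m + n + 1 + 1) → ℤ) j * V j l : ℤ) +
        (if ¬ realUnknown G l ∧ l ≠ Fin.last (m + n) then (D : ℝ) * d l else 0) := by
  rw [Fin.sum_univ_add, Fin.sum_univ_add, ← add_assoc]
  simp only [columnVector, Fin.append_left, Fin.append_right]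
  congr 1
  · congr 1
    · have h0 : ∀ i : Fin m, (((if (G i).IsReal then (Pi.single (unknown n i) 1 :
          Fin (m + n + 1) → ℤ) else 0) l : ℤ) : ℝ) * a (unknown n i) =
          if unknown n i = l then (if realUnknown G l then a l else 0) else 0 := by
        intro i
        by_cases hi : unknown n i = l
        · subst hi
          by_cases hr : (G i).IsReal <;> simp [hr, realUnknown_unknown]
        · by_cases hr : (G i).IsReal <;> simp [hr, hi, Ne.symm hi]
      simp_rw [h0]
      by_cases hl : realUnknown G l
      · have hl' : (l : ℕ) < m := hl.1
        have h1 : ∀ i : Fin m, unknown n i = l ↔ i = ⟨l, hl'⟩ := by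
          intro i; rw [Fin.ext_iff, Fin.ext_iff]; simp [unknown]
        simp [h1]
      · simp [hl]
    · rw [Fin.sum_univ_castSucc (n := m + n + 1)]
      simp [mul_comm]
  · rw [Finset.sum_eq_single l]
    · split_ifs <;> simp
    · intro j _ hj
      split_ifs
      · simp [Ne.symm hj]
      · simp
    · simp

/-- The computed data are a general solution. -/
theorem exists_isGeneralSolution {G : Fin m → Primitive} {H : Fin n → Primitive}
    {φ : ElementaryGroup G →ₜ+ ElementaryGroup H} {A : Matrix (Fin n) (Fin m) ℚ} {b : Fin n → ℚ}
    {Δ : ℕ} (hΔ : Δ ≠ 0) (hA : ∀ r i, (A r i).den ∣ Δ) (hb : ∀ r, (b r).den ∣ Δ)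
    (hφ : IsMatrixRep φ (A.map fun q : ℚ => (q : ℝ))) {h : ElementaryGroup H}
    (hs : TupleCongr H (fun j => (b j : ℝ)) h) {μ D : ℤ}
    {W : Matrix (Fin (m + n + 1)) (Fin (m + n + 1)) ℤ} {bad : Prop}
    {V : Fin (m + n + 1 + 1) → Fin (m + n + 1) → ℤ} {t : Fin (m + n + 1 + 1) → ℤ}
    (E : Elimination (systemMatrix H A b Δ) (realUnknown G) (Fin.last (m + n)) μ
      (fun _ => True) W D bad)
    (hR : Residues D (IntegralOn W (realUnknown G) (Fin.last (m + n)) D (· ≠ Fin.last (m + n)))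
      (Pi.single (Fin.last (m + n)) 1) (Fin.last _) V t)
    (ht : ∀ j, j ≠ Fin.last _ → t j = 0) (hbad : ¬ bad) (ht1 : t (Fin.last _) = 1) :
    ∃ (g₀ : ElementaryGroup G)
      (ε : ElementaryGroup (realIntFactors m ((m + n + 1) + (m + n + 1))) →ₜ+ ElementaryGroup G),
      IsGeneralSolution φ h g₀ ε ∧
      TupleCongr G (fun i => (particularSolution D V W i : ℝ)) g₀ ∧
      IsMatrixRep ε ((kernelMatrix G D V W).map fun q : ℚ => (q : ℝ)) := by
  have hq := not_realUnknown_last (n := n) G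
  have hD : (D : ℝ) ≠ 0 := by exact_mod_cast E.pos.ne'
  have hs1 : TupleCongr H (fun j => b j * ((1 : ℤ) : ℝ)) h := by simpa using hs
  have hs0 : TupleCongr H (fun j => b j * ((0 : ℤ) : ℝ)) 0 := fun j => by
    simpa using (H j).congr_zero
  -- the particular solution
  obtain ⟨hz, hzq⟩ := E.mixedSolution_of_param hbad hq (Elimination.integralOn_update hq hR ht1)
    (v := fun l => (Function.update (V (Fin.last _)) (Fin.last (m + n)) 1 l : ℤ))
    (fun l _ => rfl)
    (z := fun i => (∑ l, (W i l : ℝ) *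
      ((Function.update (V (Fin.last _)) (Fin.last (m + n)) 1 l : ℤ) : ℝ)) / D)
    (fun i => mul_div_cancel₀ _ hD)
  have hp : ∀ i : Fin m, (particularSolution D V W i : ℝ) = (∑ l, (W (unknown n i) l : ℝ) *
      ((Function.update (V (Fin.last _)) (Fin.last (m + n)) 1 l : ℤ) : ℝ)) / D := by
    intro i; simp only [particularSolution, dotProduct]; push_cast; rfl
  choose g₀ hg₀ using fun i => (G i).exists_carrier_congr
    (x := (particularSolution D V W i : ℝ)) fun hi => by
      rw [hp]; exact hz.2 _ ((realUnknown_unknown G i).not.2 hi)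
  have hφ₀ : φ g₀ = h := (apply_eq_iff_exists_mixedSolution hΔ hA hb hφ hs1 hg₀).2
    ⟨_, hz, by rw [hzq]; simp, fun i => (hp i).symm⟩
  -- the values of the homomorphism
  have hE : ∀ (a : Fin (m + n + 1) → ℝ) (c d : Fin (m + n + 1) → ℤ) (i : Fin m),
      D * ((kernelMatrix G D V W).map fun q : ℚ => (q : ℝ)).mulVec
        (Fin.append (fun i => a (unknown n i)) (fun j => ((Fin.append c d j : ℤ) : ℝ))) i =
      ∑ l, (W (unknown n i) l : ℝ) * ((if realUnknown G l then a l else 0) +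
        (∑ j, (Fin.snoc c 0 : Fin (m + n + 1 + 1) → ℤ) j * V j l : ℤ) +
        (if ¬ realUnknown G l ∧ l ≠ Fin.last (m + n) then (D : ℝ) * d l else 0)) := by
    intro a c d i
    simp_rw [← sum_columnVector, Finset.mul_sum]
    rw [Finset.sum_comm]
    simp only [mulVec, dotProduct, map_apply, kernelMatrix, Finset.mul_sum]
    refine Finset.sum_congr rfl fun j _ => ?_
    push_cast
    rw [← mul_assoc, mul_div_cancel₀ _ hD, Finset.sum_mul]
    exact Finset.sum_congr rfl fun l _ => by ring
  have hker := E.kernel_iff hbad hq hR ht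
  -- every choice of parameters gives a solution of the homogeneous system
  have hsol : ∀ (a : Fin (m + n + 1) → ℝ) (c d : Fin (m + n + 1) → ℤ),
      ∃ z : Fin (m + n + 1) → ℝ, MixedSolution (systemMatrix H A b Δ) (realUnknown G) z ∧
        z (Fin.last (m + n)) = 0 ∧ ∀ i, z (unknown n i) =
          ((kernelMatrix G D V W).map fun q : ℚ => (q : ℝ)).mulVec
          (Fin.append (fun i => a (unknown n i)) (fun j => ((Fin.append c d j : ℤ) : ℝ))) i := by
    intro a c d
    refine ⟨fun i => (∑ l, (W i l : ℝ) * ((if realUnknown G l then a l else 0) +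
        (∑ j, (Fin.snoc c 0 : Fin (m + n + 1 + 1) → ℤ) j * V j l : ℤ) +
        (if ¬ realUnknown G l ∧ l ≠ Fin.last (m + n) then (D : ℝ) * d l else 0))) / D, ?_⟩
    rw [← and_assoc, hker]
    refine ⟨⟨a, Fin.snoc c 0, d, by simp, fun i => mul_div_cancel₀ _ hD⟩, fun i => ?_⟩
    rw [eq_comm, eq_div_iff hD, mul_comm]
    exact hE a c d i
  have hcases : ∀ x : Fin (m + ((m + n + 1) + (m + n + 1))) → ℝ,
      (∃ w, TupleCongr (realIntFactors m ((m + n + 1) + (m + n + 1))) x w) →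
      ∃ (a : Fin (m + n + 1) → ℝ) (c d : Fin (m + n + 1) → ℤ),
        x = Fin.append (fun i => a (unknown n i)) (fun j => ((Fin.append c d j : ℤ) : ℝ)) := by
    rintro x ⟨w, hw⟩
    obtain ⟨a, c, rfl⟩ := hw.exists_append
    refine ⟨Fin.snoc (Fin.append a 0) 0, fun j => c (Fin.castAdd _ j),
      fun j => c (Fin.natAdd _ j), ?_⟩
    congr 1
    · ext i; simp only [unknown, Fin.snoc_castSucc, Fin.append_left]
    · ext j
      rw [Fin.append_castAdd_natAdd]
  obtain ⟨ε, hε⟩ : ∃ ε : ElementaryGroup (realIntFactors m ((m + n + 1) + (m + n + 1))) →ₜ+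
      ElementaryGroup G, IsMatrixRep ε ((kernelMatrix G D V W).map fun q : ℚ => (q : ℝ)) := by
    refine exists_isMatrixRep G _ fun i hi => ⟨fun j => ?_, fun j => ?_⟩
    · simp only [map_apply, kernelMatrix, columnVector, Fin.append_left]
      split_ifs with hj
      · rw [dotProduct_single, E.separated _ _ ((realUnknown_unknown G i).not.2 hi)
          ((realUnknown_unknown G j).2 hj)]
        simp
      · simp
    · obtain ⟨z, hz, -, hzi⟩ := hsol 0 (fun l => (Pi.single j 1 : _ → ℤ) (Fin.castAdd _ l))
        (fun l => (Pi.single j 1 : _ → ℤ) (Fin.natAdd _ l))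
      obtain ⟨k, hk⟩ := hz.2 _ ((realUnknown_unknown G i).not.2 hi)
      refine ⟨k, ?_⟩
      rw [← hk, hzi, Fin.append_castAdd_natAdd]
      simp only [mulVec, dotProduct]
      rw [Finset.sum_eq_single (Fin.natAdd m j)]
      · simp
      · intro l _ hl
        refine Fin.addCases (fun l => ?_) (fun l => ?_) l (motive := fun l => l ≠ Fin.natAdd m j →
          ((kernelMatrix G D V W).map fun q : ℚ => (q : ℝ)) i l * Fin.append
            (fun i => (0 : Fin (m + n + 1) → ℝ) (unknown n i))
            (fun l => (((Pi.single j 1 : _ → ℤ) l : ℤ) : ℝ)) l = 0) hl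
        · intro _; simp
        · intro hl
          have : l ≠ j := fun h => hl (h ▸ rfl)
          simp [this]
      · simp
  refine ⟨g₀, ε, ⟨hφ₀, ?_⟩, hg₀, hε⟩
  ext g
  constructor
  · rintro ⟨w, rfl⟩
    have hw := (tupleCongr_realInt_iff _ w).2 rfl
    have hx := hε w _ hw
    obtain ⟨a, c, d, hacd⟩ := hcases _ ⟨w, hw⟩
    obtain ⟨z, hz, hzq, hzi⟩ := hsol a c d
    rw [hacd] at hx
    exact (apply_eq_iff_exists_mixedSolution hΔ hA hb hφ hs0 hx).2
      ⟨z, hz, by simpa using hzq, hzi⟩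
  · intro hg
    choose x hx using fun i => (G i).exists_congr (g i)
    obtain ⟨z, hz, hzq, hzi⟩ := (apply_eq_iff_exists_mixedSolution hΔ hA hb hφ hs0 hx).1 hg
    obtain ⟨a, c, d, hc, hacd⟩ := (hker z).1 ⟨hz, by simpa using hzq⟩
    obtain ⟨w, hw⟩ := exists_realInt (fun i : Fin m => a (unknown n i))
      (Fin.append (fun j => c (Fin.castSucc j)) d)
    refine ⟨w, TupleCongr.unique (hε w _ hw) ?_⟩
    suffices hx' : ((kernelMatrix G D V W).map fun q : ℚ => (q : ℝ)).mulVec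
        (Fin.append (fun i => a (unknown n i))
          (fun j => ((Fin.append (fun j => c (Fin.castSucc j)) d j : ℤ) : ℝ))) = x by
      rw [hx']; exact hx
    ext i
    apply mul_left_cancel₀ hD
    rw [hE, ← hzi, hacd]
    have : (Fin.snoc (fun j => c (Fin.castSucc j)) 0 : Fin (m + n + 1 + 1) → ℤ) = c := by
      rw [← hc]; exact Fin.snoc_init_self c
    rw [this]

end System

namespace LogRAM

/-! ### Matrices in memory -/

/-- The array `a` holds the matrix `F`, row by row. -/
def Stores (a : ℕ) {p w : ℕ} (F : Fin p → Fin w → ℤ) (s : State) : Prop :=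
  ∀ (i : Fin p) (j : Fin w), s.arr a ((i : ℕ) * (w : ℕ) + (j : ℕ)) = F i j

theorem Stores.congr {a p w : ℕ} {F : Fin p → Fin w → ℤ} {s s' : State} (h : Stores a F s)
    (hs : s'.arr a = s.arr a) : Stores a F s' := fun i j => by rw [hs]; exact h i j

theorem index_ediv {w : ℕ} (i : ℕ) (j : Fin w) : ((i : ℤ) * w + (j : ℕ)) / w = i := by
  have hw : (w : ℤ) ≠ 0 := by have := j.2; omega
  rw [add_comm, Int.add_mul_ediv_right _ _ hw, Int.ediv_eq_zero_of_lt (by positivity)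
    (by exact_mod_cast j.2), zero_add]

theorem index_emod {w : ℕ} (i : ℕ) (j : Fin w) : ((i : ℤ) * w + (j : ℕ)) % w = j := by
  rw [add_comm, Int.add_mul_emod_self_right]
  exact Int.emod_eq_of_lt (by positivity) (by exact_mod_cast j.2)

theorem index_lt {p w : ℕ} (i : Fin p) (j : Fin w) : (i : ℕ) * w + j < p * w := by
  have h1 : ((i : ℕ) + 1) * w ≤ p * w := Nat.mul_le_mul_right _ i.2
  have := j.2
  nlinarith

theorem exists_index {p w k : ℕ} (hk : k < p * w) :
    ∃ (i : Fin p) (j : Fin w), k = i * w + j := by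
  have hw : 0 < w := Nat.pos_of_ne_zero (by rintro rfl; simp at hk)
  refine ⟨⟨k / w, (Nat.div_lt_iff_lt_mul hw).2 hk⟩, ⟨k % w, Nat.mod_lt _ hw⟩, ?_⟩
  simp only; rw [mul_comm]; exact (Nat.div_add_mod k w).symm

theorem index_injective {w : ℕ} {i i' : ℕ} {j j' : Fin w}
    (h : (i : ℤ) * w + (j : ℕ) = i' * w + (j' : ℕ)) : i = i' ∧ j = j' := by
  have h1 := index_ediv i j
  have h2 := index_emod i j
  rw [h, index_ediv] at h1
  rw [h, index_emod] at h2
  exact ⟨by exact_mod_cast h1.symm, Fin.ext (by exact_mod_cast h2.symm)⟩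

variable {X R : ℕ}

theorem Achieves.fillMatrix {v c a p w : ℕ} {e : Expr} {s : State} {Q : State → Prop}
    (F : Fin p → Fin w → ℤ) (hvc : v ≠ c) (hcnt : s.var c = (p * w : ℕ)) (hR : p * w ≤ R)
    (hX : p * w ≤ X)
    (he : ∀ (i : Fin p) (j : Fin w) s', (∀ u, u ≠ v → s'.var u = s.var u) →
      s'.var v = ((i : ℕ) : ℤ) * (w : ℕ) + (j : ℕ) → (∀ a', a' ≠ a → s'.arr a' = s.arr a') →
      s'.arr a ((i : ℕ) * (w : ℕ) + (j : ℕ)) = s.arr a ((i : ℕ) * (w : ℕ) + (j : ℕ)) →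
      e.eval s' = F i j ∧ |F i j| ≤ X)
    (hQ : ∀ s', (∀ u, u ≠ v → s'.var u = s.var u) → (∀ a', a' ≠ a → s'.arr a' = s.arr a') →
      s'.out = s.out → Stores a F s' → Q s') : Achieves X R (LogRAM.fillLoop v c a 0 e) s Q := by
  set f : ℕ → ℤ := fun k => if h : k < p * w then
    F ⟨k / w, Nat.div_lt_of_lt_mul (by rwa [mul_comm])⟩
      ⟨k % w, Nat.mod_lt _ (Nat.pos_of_ne_zero (by rintro rfl; simp at h))⟩ else 0 with hf
  have hfF : ∀ (i : Fin p) (j : Fin w), f (i * w + j) = F i j := by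
    intro i j
    have hw : 0 < w := by have := j.2; omega
    simp only [hf, index_lt i j, dite_true]
    congr 1
    · ext; simp only; rw [add_comm, Nat.add_mul_div_right _ _ hw, Nat.div_eq_of_lt j.2, zero_add]
    · ext; simp only; rw [add_comm, Nat.add_mul_mod_self_right, Nat.mod_eq_of_lt j.2]
  refine Achieves.fillLoop (p * w) 0 f hvc hcnt hR hX (fun k hk => ?_) ?_
  · obtain ⟨i, j, rfl⟩ := exists_index hk
    rw [hfF]
    refine ⟨rfl, he i j _ (fun u hu => ?_) ?_ (fun a' ha => ?_) ?_⟩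
    · simp [State.filled, hu]
    · simp [State.filled]
    · simp [State.filled, ha]
    · simp [State.filled]
  · refine hQ _ (fun u hu => ?_) (fun a' ha => ?_) rfl fun i j => ?_
    · simp [State.filled, hu]
    · simp [State.filled, ha]
    · have h1 : ((i : ℕ) : ℤ) * (w : ℕ) + (j : ℕ) = ((i * w + j : ℕ) : ℤ) := by push_cast; rfl
      simp only [State.filled, Function.update_self]
      rw [h1, if_pos ⟨by positivity, by have := index_lt i j; push_cast at this ⊢; omega⟩, sub_zero,
        Int.toNat_natCast, hfF]

/-! ### The input -/

theorem length_flatten_ofFn {α : Type*} {p w : ℕ} (f : Fin p → List α)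
    (hf : ∀ i, (f i).length = w) : (List.ofFn f).flatten.length = p * w := by
  simp [List.length_flatten, List.map_ofFn, Function.comp_def, hf]

theorem getElem?_flatten_ofFn {α : Type*} {p w : ℕ} (f : Fin p → List α)
    (hf : ∀ i, (f i).length = w) (i : Fin p) {j : ℕ} (hj : j < w) :
    (List.ofFn f).flatten[(i : ℕ) * w + j]? = (f i)[j]? := by
  induction p with
  | zero => exact i.elim0
  | succ p ih =>
    rw [List.ofFn_succ, List.flatten_cons]
    refine Fin.cases ?_ (fun i => ?_) i
    · rw [List.getElem?_append_left (by simpa [hf] using hj)]; simp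
    · rw [List.getElem?_append_right (by rw [hf]; simp; nlinarith), hf]
      have : (i.succ : ℕ) * w + j - w = i * w + j := by
        rw [Fin.val_succ, Nat.succ_mul]; omega
      rw [this]
      exact ih (fun i => f i.succ) (fun i => hf _) i

theorem length_encodeVec {m : ℕ} (v : Fin m → ℚ) : (encodeVec v).length = m * 2 :=
  length_flatten_ofFn _ fun _ => rfl

theorem length_encodeMat {m n : ℕ} (A : Matrix (Fin n) (Fin m) ℚ) :
    (encodeMat A).length = n * (m * 2) :=
  length_flatten_ofFn _ fun _ => length_encodeVec _

theorem length_encode (P : Primitive) : P.encode.length = 2 := by cases P <;> rfl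

theorem length_encodeGroup {m : ℕ} (G : Fin m → Primitive) : (encodeGroup G).length = m * 2 :=
  length_flatten_ofFn _ fun _ => length_encode _

/-- The contents of the input array. -/
def inputCell (l : List ℤ) (k : ℤ) : ℤ := if 0 ≤ k then l.getD k.toNat 0 else 0

theorem inputCell_natCast {l : List ℤ} {k : ℕ} {z : ℤ} (h : l[k]? = some z) :
    inputCell l k = z := by
  simp [inputCell, List.getD, h]

section Input

variable {m n : ℕ} (G : Fin m → Primitive) (H : Fin n → Primitive) (A : Matrix (Fin n) (Fin m) ℚ)
  (b : Fin n → ℚ)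

theorem input_m : inputCell (encodeSystem G H A b) 0 = m :=
  inputCell_natCast (k := 0) (by simp [encodeSystem])

theorem input_n : inputCell (encodeSystem G H A b) 1 = n :=
  inputCell_natCast (k := 1) (by simp [encodeSystem])

theorem input_group (i : Fin m) {e : ℕ} (he : e < 2) {z : ℤ} (hz : (G i).encode[e]? = some z) :
    inputCell (encodeSystem G H A b) ((2 + (i * 2 + e) : ℕ) : ℤ) = z := by
  have hi : (i : ℕ) * 2 + e < (encodeGroup G).length := by
    rw [length_encodeGroup]; have := i.2; omega
  apply inputCell_natCast
  rw [encodeSystem, List.append_assoc, List.append_assoc, List.append_assoc,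
    List.getElem?_append_right (by simp)]
  simp only [List.length_cons, List.length_nil, zero_add, Nat.reduceAdd, Nat.add_sub_cancel_left]
  rw [List.getElem?_append_left hi, ← hz]
  exact getElem?_flatten_ofFn _ (fun _ => length_encode _) i he

theorem input_char (j : Fin n) :
    inputCell (encodeSystem G H A b) ((2 + (m * 2 + (j * 2 + 1)) : ℕ) : ℤ) = (H j).char := by
  have hi : (j : ℕ) * 2 + 1 < (encodeGroup H).length := by
    rw [length_encodeGroup]; have := j.2; omega
  have hz : (H j).encode[1]? = some ((H j).char : ℤ) := by cases H j <;> rfl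
  apply inputCell_natCast
  rw [encodeSystem, List.append_assoc, List.append_assoc, List.append_assoc,
    List.getElem?_append_right (by simp)]
  simp only [List.length_cons, List.length_nil, zero_add, Nat.reduceAdd, Nat.add_sub_cancel_left]
  rw [List.getElem?_append_right (by rw [length_encodeGroup]; omega), length_encodeGroup,
    Nat.add_sub_cancel_left, List.getElem?_append_left hi, ← hz]
  exact getElem?_flatten_ofFn _ (fun _ => length_encode _) j one_lt_two

theorem input_mat (r : Fin n) (i : Fin m) {e : ℕ} (he : e < 2) {z : ℤ}
    (hz : (encodeRat (A r i))[e]? = some z) :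
    inputCell (encodeSystem G H A b)
      ((2 + (m * 2 + (n * 2 + (r * (m * 2) + (i * 2 + e)))) : ℕ) : ℤ) = z := by
  have hi : (i : ℕ) * 2 + e < m * 2 := by have := i.2; omega
  have hi' : (r : ℕ) * (m * 2) + (i * 2 + e) < (encodeMat A).length := by
    rw [length_encodeMat]; exact index_lt r ⟨i * 2 + e, hi⟩
  apply inputCell_natCast
  rw [encodeSystem, List.append_assoc, List.append_assoc, List.append_assoc,
    List.getElem?_append_right (by simp)]
  simp only [List.length_cons, List.length_nil, zero_add, Nat.reduceAdd, Nat.add_sub_cancel_left]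
  rw [List.getElem?_append_right (by rw [length_encodeGroup]; omega), length_encodeGroup,
    Nat.add_sub_cancel_left, List.getElem?_append_right (by rw [length_encodeGroup]; omega),
    length_encodeGroup, Nat.add_sub_cancel_left, List.getElem?_append_left hi', ← hz]
  refine (getElem?_flatten_ofFn _ (fun _ => length_encodeVec _) r hi).trans ?_
  exact getElem?_flatten_ofFn (w := 2) _ (fun _ => rfl) i he

theorem input_vec (r : Fin n) {e : ℕ} (he : e < 2) {z : ℤ}
    (hz : (encodeRat (b r))[e]? = some z) :
    inputCell (encodeSystem G H A b)
      ((2 + (m * 2 + (n * 2 + (n * (m * 2) + (r * 2 + e)))) : ℕ) : ℤ) = z := by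
  apply inputCell_natCast
  rw [encodeSystem, List.append_assoc, List.append_assoc, List.append_assoc,
    List.getElem?_append_right (by simp)]
  simp only [List.length_cons, List.length_nil, zero_add, Nat.reduceAdd, Nat.add_sub_cancel_left]
  rw [List.getElem?_append_right (by rw [length_encodeGroup]; omega), length_encodeGroup,
    Nat.add_sub_cancel_left, List.getElem?_append_right (by rw [length_encodeGroup]; omega),
    length_encodeGroup, Nat.add_sub_cancel_left,
    List.getElem?_append_right (by rw [length_encodeMat]; omega), length_encodeMat,
    Nat.add_sub_cancel_left, ← hz]
  exact getElem?_flatten_ofFn (w := 2) _ (fun _ => rfl) r he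

/-- The product of all denominators. -/
def commonDen : ℕ := (∏ r, ∏ i, (A r i).den) * ∏ r, (b r).den

theorem commonDen_ne_zero : commonDen A b ≠ 0 :=
  mul_ne_zero (Finset.prod_ne_zero_iff.2 fun _ _ => Finset.prod_ne_zero_iff.2 fun _ _ =>
    (A _ _).den_nz) (Finset.prod_ne_zero_iff.2 fun _ _ => (b _).den_nz)

theorem den_dvd_commonDen (r : Fin n) (i : Fin m) : (A r i).den ∣ commonDen A b :=
  ((Finset.dvd_prod_of_mem (fun i => (A r i).den) (Finset.mem_univ i)).trans
    (Finset.dvd_prod_of_mem (fun r => ∏ i, (A r i).den) (Finset.mem_univ r))).mul_right _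

theorem den_dvd_commonDen' (r : Fin n) : (b r).den ∣ commonDen A b :=
  (Finset.dvd_prod_of_mem (fun r => (b r).den) (Finset.mem_univ r)).mul_left _

end Input

end LogRAM

namespace LogRAM

variable {X R : ℕ}

/-! ### The memory layout -/

/-!
The variables `1, …, 5` hold `m`, `n`, `q = m + n`, the number `N = q + 1` of unknowns, and
`N + 1`; the variables `11` and `12` hold `N * N` and `N * (N + 1)`. The position of the first
coefficient in the input is in variable `8`, the common denominator in variable `9`, the determinant
`D` in variable `6`, and variable `7` is set when the equations are found to be contradictory. The
other variables are counters and intermediate results.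

The arrays hold the input (`0`), the equations (`1`), the row `τ` (`2`) and the column (`3`) used in
an elimination step, the matrix `W` (`4`), the generators with their residues (`5`), a copy of a
generator (`6`) and the parameter vectors of the general solution (`7`). -/

/-- The part of the memory that the program does not change after its first stage. -/
structure Env (m n : ℕ) {N : ℕ} (q : Fin N) (rl : Fin N → Prop) [DecidablePred rl] (inp : ℤ → ℤ)
    (s : State) : Prop where
  v1 : s.var 1 = m
  v2 : s.var 2 = n
  v3 : s.var 3 = (q : ℕ)
  v4 : s.var 4 = N
  v5 : s.var 5 = (N + 1 : ℕ)
  v11 : s.var 11 = (N * N : ℕ)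
  v12 : s.var 12 = (N * (N + 1) : ℕ)
  a0 : s.arr 0 = inp
  real : ∀ i : Fin N, (if ((i : ℕ) : ℤ) < m then 1 else 0) * (inp (2 + 2 * (i : ℕ)) % 2) =
    if rl i then 1 else 0

section Env

variable {m n N : ℕ} {q : Fin N} {rl : Fin N → Prop} [DecidablePred rl] {inp : ℤ → ℤ} {s s' : State}

theorem Env.congr (h : Env m n q rl inp s) (hv : ∀ i ∈ [1, 2, 3, 4, 5, 11, 12], s'.var i = s.var i)
    (ha : s'.arr 0 = s.arr 0) : Env m n q rl inp s' where
  v1 := (hv 1 (by decide)).trans h.v1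
  v2 := (hv 2 (by decide)).trans h.v2
  v3 := (hv 3 (by decide)).trans h.v3
  v4 := (hv 4 (by decide)).trans h.v4
  v5 := (hv 5 (by decide)).trans h.v5
  v11 := (hv 11 (by decide)).trans h.v11
  v12 := (hv 12 (by decide)).trans h.v12
  a0 := ha.trans h.a0
  real := h.real

theorem Env.frame (h : Env m n q rl inp s) {p : Program} (hp : Frame p s s')
    (hv : ∀ i ∈ [1, 2, 3, 4, 5, 11, 12], i ∉ p.vars) (ha : 0 ∉ p.arrs) : Env m n q rl inp s' :=
  h.congr (fun i hi => hp.var i (hv i hi)) (hp.arr 0 ha)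

theorem Env.update (h : Env m n q rl inp s) {i : ℕ} (hi : i ∉ [1, 2, 3, 4, 5, 11, 12]) (z : ℤ) :
    Env m n q rl inp { s with var := Function.update s.var i z } :=
  h.congr (fun j hj => Function.update_of_ne (by rintro rfl; exact hi hj) _ _) rfl

/-- The expression that tells whether the unknown with index `e` is real. -/
def isReal (e : Expr) : Expr := e.lt (.var 1) * (.get 0 (2 + 2 * e) % 2)

theorem Env.eval_isReal (h : Env m n q rl inp s) {e : Expr} {i : Fin N} (he : e.eval s = (i : ℕ)) :
    (isReal e).eval s = if rl i then 1 else 0 := by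
  rw [← h.real i]
  simp only [isReal, eval_mul, eval_lt, eval_mod, eval_get, eval_add, eval_ofNat, eval_var, he,
    h.v1, h.a0]

end Env

/-- Bounds that hold throughout the computation with `N` unknowns and equations whose
coefficients are bounded by `μ`: on the numbers (`X`) and on the numbers of iterations (`R`). -/
structure Capacity (X R n N : ℕ) (μ : ℤ) : Prop where
  one_le : 1 ≤ μ
  pos : 1 ≤ N
  n_le : n ≤ R
  sq_le : (N + 1) * (N + 1) ≤ R
  R_le : R ≤ X
  le_X : N * (detBound N μ * detBound N μ) ≤ X
  euclid : 2 * X.size + 1 ≤ R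

theorem Capacity.le_detBound {n N : ℕ} {μ : ℤ} (h : Capacity X R n N μ) : μ ≤ detBound N μ := by
  have h0 := h.one_le
  have h1 : μ ≤ μ ^ N := le_self_pow₀ h0 (by have := h.pos; omega)
  have h2 : (1 : ℤ) ≤ N.factorial := by exact_mod_cast N.factorial_pos
  unfold detBound
  nlinarith [mul_le_mul h2 h1 (by omega) (by omega)]

theorem Capacity.detBound_le {n N : ℕ} {μ : ℤ} (h : Capacity X R n N μ) : detBound N μ ≤ X := by
  have h1 := h.le_detBound
  have h2 := h.one_le
  have h3 := h.le_X
  have h4 : (1 : ℤ) ≤ N := by exact_mod_cast h.pos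
  have h5 : 1 ≤ detBound N μ := h2.trans h1
  have h6 : detBound N μ * 1 ≤ detBound N μ * detBound N μ :=
    mul_le_mul_of_nonneg_left h5 (by omega)
  have h7 : 1 * (detBound N μ * detBound N μ) ≤ N * (detBound N μ * detBound N μ) :=
    mul_le_mul_of_nonneg_right h4 (by positivity)
  linarith

/-- A summation loop that computes a dot product. -/
theorem Achieves.dotProduct {v c w N : ℕ} {e : Expr} {s : State} {Q : State → Prop}
    (x y : Fin N → ℤ) {B : ℤ} (hB : 0 ≤ B) (hx : ∀ i, |x i| ≤ B) (hy : ∀ i, |y i| ≤ B)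
    (hBX : N * (B * B) ≤ X) (hvc : v ≠ c) (hvw : v ≠ w) (hwc : w ≠ c) (hcnt : s.var c = N)
    (hR : N ≤ R) (hX : N ≤ X)
    (he : ∀ (i : Fin N) (s' : State), (∀ u, u ≠ v → u ≠ w → s'.var u = s.var u) →
      s'.var v = (i : ℕ) → s'.arr = s.arr → e.eval s' = x i * y i)
    (hQ : ∀ s', (∀ u, u ≠ v → u ≠ w → s'.var u = s.var u) → s'.arr = s.arr → s'.out = s.out →
      s'.var w = x ⬝ᵥ y → Q s') :
    Achieves X R (LogRAM.sumLoop v c w e) s Q := by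
  set f : ℕ → ℤ := fun k => if h : k < N then x ⟨k, h⟩ * y ⟨k, h⟩ else 0 with hf
  have hfB : ∀ k, |f k| ≤ B * B := by
    intro k
    simp only [hf]
    split_ifs with h
    · rw [abs_mul]; exact mul_le_mul (hx _) (hy _) (abs_nonneg _) hB
    · simpa using mul_nonneg hB hB
  refine Achieves.sumLoop N f hvc hvw hwc hcnt hR hX (fun k hk => ?_) (fun k hk => ?_) ?_
  · rw [he ⟨k, hk⟩ (s.summed v w f k) (fun u h1 h2 => by simp [State.summed, h1, h2])
      (by simp [State.summed]) rfl]
    simp [hf, hk]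
  · refine (Finset.abs_sum_le_sum_abs _ _).trans ?_
    refine (Finset.sum_le_card_nsmul _ _ (B * B) fun i _ => hfB i).trans ?_
    rw [Finset.card_range, nsmul_eq_mul]
    refine le_trans (mul_le_mul_of_nonneg_right ?_ (mul_nonneg hB hB)) hBX
    exact_mod_cast hk
  · refine hQ _ (fun u h1 h2 => by simp [State.summed, h1, h2]) rfl rfl ?_
    simp only [State.summed, Function.update_of_ne hvw.symm, Function.update_self,
      Finset.sum_range, _root_.dotProduct]
    exact Finset.sum_congr rfl fun i _ => by simp [hf]

/-! ### The elimination program -/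

/-- Compute the row `τ = M r * W`, where `r` is the value of variable `13`. -/
def computeRow : Program :=
  forLoop 14 4
    (sumLoop 15 4 16 (.get 1 (.var 13 * .var 4 + .var 15) * .get 4 (.var 15 * .var 4 + .var 14)) ;;
      .store 2 (.var 14) (.var 16))

/-- Search for a pivot, that is, a nonzero entry of `τ` other than the last one; real unknowns are
preferred. If there is none, variable `17` gets the value `N`. -/
def searchPivot : Program :=
  .assign 17 (.var 4) ;;
  forLoop 14 3
    (.branch ((1 - (Expr.get 2 (.var 14)).eq 0) * ((Expr.var 17).eq (.var 4) + isReal (.var 14)))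
      (.assign 17 (.var 14)) .skip)

/-- Eliminate the unknown `c` whose index is the value of variable `17`: replace the entries of `W`
by `σ * (τ c * W i l - W i c * τ l) / D`, where `σ` is the sign of `τ c`, and `D` by `σ * τ c`. -/
def eliminate : Program :=
  .assign 19 (.get 2 (.var 17)) ;;
  .assign 18 (1 - 2 * (Expr.var 19).lt 0) ;;
  fillLoop 14 4 3 0 (.get 4 (.var 14 * .var 4 + .var 17)) ;;
  fillLoop 14 11 4 0
    (.var 18 * (.var 19 * .get 4 (.var 14) -
      .get 3 (.var 14 / .var 4) * .get 2 (.var 14 % .var 4)) / .var 6) ;;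
  .assign 6 (.var 18 * .var 19)

/-- Process the equation whose index is the value of variable `13`. If the last entry of `τ` is the
only nonzero one, the equations force the last unknown to vanish, and variable `7` is set. -/
def processEquation : Program :=
  computeRow ;; searchPivot ;;
  .branch ((Expr.var 17).lt (.var 3)) eliminate (.branch (.get 2 (.var 3)) (.assign 7 1) .skip)

/-- Process all equations. -/
def elimination : Program :=
  fillLoop 13 11 4 0 ((Expr.var 13 / .var 4).eq (.var 13 % .var 4)) ;;
  .assign 6 1 ;; .assign 7 0 ;; forLoop 13 2 processEquation

section Elimination

variable {m n N : ℕ} {q : Fin N} {rl : Fin N → Prop} [DecidablePred rl] {inp : ℤ → ℤ} {μ : ℤ}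
  {M : Fin n → Fin N → ℤ}

/-- The memory after the first `k` equations have been processed. -/
structure Processed (m : ℕ) (q : Fin N) (rl : Fin N → Prop) [DecidablePred rl] (inp : ℤ → ℤ) (μ : ℤ)
    (M : Fin n → Fin N → ℤ) (k : ℕ) (W : Matrix (Fin N) (Fin N) ℤ) (s : State) : Prop where
  env : Env m n q rl inp s
  eqs : Stores 1 M s
  mat : Stores 4 W s
  elim : Elimination M rl q μ (fun r => (r : ℕ) < k) W (s.var 6) (s.var 7 ≠ 0)

theorem achieves_computeRow (hC : Capacity X R n N μ) (hM : ∀ r i, |M r i| ≤ μ) {k : ℕ}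
    {W : Matrix (Fin N) (Fin N) ℤ} {s : State} (h : Processed m q rl inp μ M k W s) (r : Fin n)
    (hr : s.var 13 = (r : ℕ)) :
    Achieves X R computeRow s fun s' => ∀ l : Fin N, s'.arr 2 (l : ℕ) = (M r ᵥ* W) l := by
  have hN : N ≤ R := by have := hC.sq_le; nlinarith
  have hX : N ≤ X := hN.trans hC.R_le
  have hB := hC.le_detBound
  have h1 := hC.one_le
  refine Achieves.forLoop N (fun k s' => ∀ l : Fin N, (l : ℕ) < k → s'.arr 2 (l : ℕ) = (M r ᵥ* W) l)
    (by decide) (by decide) (by decide) h.env.v4 hN hX (fun l hl => absurd hl (by simp)) ?_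
    (fun s' _ _ hs l => hs l l.2)
  intro k hk s' hf hv hs
  refine Achieves.seq (Achieves.dotProduct (M r) (fun i => W i ⟨k, hk⟩) (B := detBound N μ)
    (by omega) (fun i => (hM r i).trans hB) (fun i => by simpa using h.elim.abs_entry_le h1 i ⟨k, hk⟩) hC.le_X
    (by decide) (by decide) (by decide) (by rw [hf.var 4 (by decide), h.env.v4]) hN hX ?_ ?_)
  · intro i s'' hu hi ha
    have e4 : s''.var 4 = N := by
      rw [hu 4 (by decide) (by decide), hf.var 4 (by decide), h.env.v4]
    have e13 : s''.var 13 = (r : ℕ) := by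
      rw [hu 13 (by decide) (by decide), hf.var 13 (by decide), hr]
    have e14 : s''.var 14 = k := by rw [hu 14 (by decide) (by decide), hv]
    simp only [eval_mul, eval_get, eval_add, eval_var, e4, e13, e14, hi, ha]
    rw [hf.arr 1 (by decide), hf.arr 4 (by decide), h.eqs r i]
    congr 1
    exact h.mat i ⟨k, hk⟩
  · intro s'' hu ha _ hw
    have e14 : s''.var 14 = k := by rw [hu 14 (by decide) (by decide), hv]
    refine Achieves.store ?_ ?_
    · rw [eval_var, hw]
      have := h.elim.abs_vecMul_le h1 (hM r) ⟨k, hk⟩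
      rw [Fintype.card_fin] at this
      exact this.trans hC.detBound_le
    · intro l hl
      simp only [eval_var, e14, hw, ha, Function.update_self]
      by_cases hlk : (l : ℕ) = k
      · have : l = ⟨k, hk⟩ := Fin.ext hlk
        subst this; rw [Function.update_self]; rfl
      · rw [Function.update_of_ne (by exact_mod_cast hlk)]
        exact hs l (by omega)

theorem achieves_searchPivot (hC : Capacity X R n N μ) (hq : (q : ℕ) + 1 = N) {τ : Fin N → ℤ}
    {s : State} (h : Env m n q rl inp s) (hτ : ∀ l : Fin N, s.arr 2 (l : ℕ) = τ l) :
    Achieves X R searchPivot s fun s' =>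
      (s'.var 17 = N ∧ ∀ l, l ≠ q → τ l = 0) ∨ ∃ c : Fin N, s'.var 17 = (c : ℕ) ∧ c ≠ q ∧ τ c ≠ 0 ∧
        (rl c ∨ ∀ l, l ≠ q → rl l → τ l = 0) := by
  have hN : N ≤ R := by have := hC.sq_le; nlinarith
  have hX : N ≤ X := hN.trans hC.R_le
  have hlq : ∀ l : Fin N, l ≠ q → (l : ℕ) < q := by
    intro l hl
    have := l.2
    have : (l : ℕ) ≠ q := fun h => hl (Fin.ext h)
    omega
  refine Achieves.seq (Achieves.assign ?_ ?_)
  · rw [eval_var, h.v4]; simpa using hX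
  rw [eval_var, h.v4]
  refine Achieves.forLoop (q : ℕ) (fun k s' =>
      (s'.var 17 = N ∧ ∀ l : Fin N, (l : ℕ) < k → τ l = 0) ∨ ∃ c : Fin N, s'.var 17 = (c : ℕ) ∧
        (c : ℕ) < k ∧ τ c ≠ 0 ∧ (rl c ∨ ∀ l : Fin N, (l : ℕ) < k → rl l → τ l = 0))
    (by decide) (by decide) (by decide) (by simpa using h.v3) (by omega) (by omega)
    (Or.inl ⟨by simp, by simp⟩) ?_ ?_
  · intro k hk s' hf hv hs
    have hkN : k < N := by omega
    set l₀ : Fin N := ⟨k, hkN⟩ with hl₀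
    have e4 : s'.var 4 = N := by rw [hf.var 4 (by decide)]; simpa using h.v4
    have henv : Env m n q rl inp s' :=
      (h.update (i := 17) (by decide) N).frame hf (by decide) (by decide)
    have eτ : s'.arr 2 k = τ l₀ := by rw [hf.arr 2 (by decide)]; exact hτ l₀
    have hreal := henv.eval_isReal (e := .var 14) (i := l₀) (by rw [eval_var, hv])
    -- a nonzero entry is chosen if there was no choice before, or if its unknown is real
    have hcond : ((1 - (Expr.get 2 (.var 14)).eq 0) *
        ((Expr.var 17).eq (.var 4) + isReal (.var 14))).eval s' =
        (1 - if τ l₀ = 0 then 1 else 0) * ((if s'.var 17 = N then 1 else 0) +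
          if rl l₀ then 1 else 0) := by
      rw [eval_mul, eval_sub, eval_add, hreal]
      simp only [eval_one, eval_eq, eval_get, eval_var, eval_zero, hv, eτ, e4]
    have hlt : ∀ l : Fin N, (l : ℕ) < k + 1 → (l : ℕ) < k ∨ l = l₀ := by
      intro l hl
      rcases Nat.lt_succ_iff_lt_or_eq.1 hl with h | h
      · exact Or.inl h
      · exact Or.inr (Fin.ext h)
    refine Achieves.branch (fun hne => ?_) (fun heq => Achieves.skip ?_)
    · rw [hcond] at hne
      have hτ0 : τ l₀ ≠ 0 := by
        intro h0; simp [h0] at hne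
      refine Achieves.assign ?_ (Or.inr ⟨l₀, ?_, ?_, hτ0, ?_⟩)
      · rw [eval_var, hv]; simp; omega
      · simp [hv, hl₀]
      · simp [hl₀]
      · by_cases hr : rl l₀
        · exact Or.inl hr
        · right
          have h17 : s'.var 17 = N := by
            by_contra h17; simp [hr, h17] at hne
          rcases hs with ⟨-, hs⟩ | ⟨c, hc, -⟩
          · intro l hl hrl
            rcases hlt l hl with h | rfl
            · exact hs l h
            · exact absurd hrl hr
          · rw [h17] at hc
            have := c.2
            have : N = (c : ℕ) := by exact_mod_cast hc
            omega
    · rw [hcond] at heq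
      have hz : τ l₀ = 0 ∨ (s'.var 17 ≠ N ∧ ¬ rl l₀) := by
        by_contra hcon
        push Not at hcon
        obtain ⟨h1, h2⟩ := hcon
        rw [if_neg h1] at heq
        by_cases h17 : s'.var 17 = N
        · by_cases hr : rl l₀ <;> simp [h17, hr] at heq
        · simp [h17, h2 h17] at heq
      rcases hs with ⟨h17, hs⟩ | ⟨c, hc, hck, hτc, hs⟩
      · refine Or.inl ⟨by simpa using h17, fun l hl => ?_⟩
        rcases hlt l hl with h | rfl
        · exact hs l h
        · exact hz.resolve_right fun h => h.1 h17
      · refine Or.inr ⟨c, by simpa using hc, by omega, hτc, hs.imp_right fun hs l hl hrl => ?_⟩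
        rcases hlt l hl with h | rfl
        · exact hs l h hrl
        · exact hz.resolve_right fun h => h.2 hrl
  · rintro s' - - (⟨h1, h2⟩ | ⟨c, h1, h2, h3, h4⟩)
    · exact Or.inl ⟨h1, fun l hl => h2 l (hlq l hl)⟩
    · refine Or.inr ⟨c, h1, fun h => ?_, h3, h4.imp_right fun h4 l hl => h4 l (hlq l hl)⟩
      subst h; omega

theorem achieves_eliminate (hC : Capacity X R n N μ) (hM : ∀ r i, |M r i| ≤ μ) {k : ℕ} (hk : k < n)
    {W : Matrix (Fin N) (Fin N) ℤ} {s : State} (h : Processed m q rl inp μ M k W s)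
    (hτ : ∀ l : Fin N, s.arr 2 (l : ℕ) = (M ⟨k, hk⟩ ᵥ* W) l) {c : Fin N} (hc : s.var 17 = (c : ℕ))
    (hcq : c ≠ q) (hτc : (M ⟨k, hk⟩ ᵥ* W) c ≠ 0)
    (hrl : rl c ∨ ∀ l, rl l → (M ⟨k, hk⟩ ᵥ* W) l = 0) :
    Achieves X R eliminate s fun s' => ∃ W', Processed m q rl inp μ M (k + 1) W' s' := by
  set τ := M ⟨k, hk⟩ ᵥ* W with hτ'
  have hN : N ≤ R := by have := hC.sq_le; nlinarith
  have hNN : N * N ≤ R := by have := hC.sq_le; nlinarith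
  have hRX := hC.R_le
  have h1 := hC.one_le
  -- the sign of the pivot
  set σ : ℤ := if τ c < 0 then -1 else 1 with hσ
  have hσ' : σ = 1 ∨ σ = -1 := by rw [hσ]; split_ifs <;> simp
  have hpos : 0 < σ * τ c := by
    rw [hσ]; split_ifs with h0 <;> omega
  have hnew := h.elim.pivot (hM ⟨k, hk⟩) hcq hτc hrl hσ' hpos
  set W' : Matrix (Fin N) (Fin N) ℤ :=
    fun i l => σ * (τ c * W i l - W i c * τ l) / s.var 6 with hW'
  have hτX : ∀ l, |τ l| ≤ X := fun l => by
    have := h.elim.abs_vecMul_le h1 (hM ⟨k, hk⟩) l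
    rw [Fintype.card_fin] at this
    exact this.trans hC.detBound_le
  have hWX : ∀ i l, |W i l| ≤ X := fun i l => by
    have := h.elim.abs_entry_le h1 i l
    rw [Fintype.card_fin] at this
    exact this.trans hC.detBound_le
  have hWX' : ∀ i l, |W' i l| ≤ X := fun i l => by
    have := hnew.abs_entry_le h1 i l
    rw [Fintype.card_fin] at this
    exact this.trans hC.detBound_le
  refine Achieves.seq (Achieves.assign ?_ ?_)
  · rw [eval_get, eval_var, hc, hτ]; exact hτX c
  rw [eval_get, eval_var, hc, hτ]
  have eσ : ∀ s' : State, s'.var 19 = τ c → (1 - 2 * (Expr.var 19).lt 0 : Expr).eval s' = σ := by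
    intro s' hs'
    simp only [eval_sub, eval_one, eval_mul, eval_ofNat, eval_lt, eval_var, hs', eval_zero, hσ]
    split_ifs <;> norm_num
  refine Achieves.seq (Achieves.assign ?_ ?_)
  · rw [eσ _ (by simp)]
    have : (1 : ℤ) ≤ X := by have := hC.pos; omega
    rcases hσ' with h | h <;> simpa [h] using this
  rw [eσ _ (by simp)]
  set s₁ : State := _
  change Achieves X R _ s₁ _
  have hv₁ : ∀ u, u ≠ 18 → u ≠ 19 → s₁.var u = s.var u := fun u h1 h2 => by simp [s₁, h1, h2]
  have hv18 : s₁.var 18 = σ := by simp [s₁]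
  have hv19 : s₁.var 19 = τ c := by simp [s₁]
  have ha₁ : s₁.arr = s.arr := rfl
  clear_value s₁
  have e4 : s₁.var 4 = N := by rw [hv₁ 4 (by decide) (by decide), h.env.v4]
  refine Achieves.seq ((Achieves.fillMatrix (p := 1) (w := N) (Q := fun s' =>
    (∀ i : Fin N, s'.arr 3 (i : ℕ) = W i c)) (fun _ i => W i c) (by decide)
    (by rw [e4, one_mul]) (by omega) (by omega) ?_ ?_).mono fun s₂ hf₂ hs₂ => ?_)
  · intro i j s' hu hv ha _
    refine ⟨?_, hWX j c⟩
    have hv' : s'.var 14 = (j : ℕ) := by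
      rw [hv]; have : i = 0 := Subsingleton.elim _ _
      subst this; simp
    simp only [eval_get, eval_add, eval_mul, eval_var, hv', hu 4 (by decide), e4, hu 17 (by decide),
      hv₁ 17 (by decide) (by decide), hc]
    rw [ha 4 (by decide), ha₁]
    exact h.mat j c
  · intro s' _ _ _ hs i
    have := hs 0 i
    simpa using this
  have hv₂ : ∀ u, u ≠ 14 → s₂.var u = s₁.var u := fun u hu => hf₂.var u (by
    simpa [fillLoop, Program.vars] using hu)
  have ha₂ : ∀ a, a ≠ 3 → s₂.arr a = s.arr a := fun a hu => by
    rw [hf₂.arr a (by simpa [fillLoop, Program.arrs] using hu), ha₁]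
  refine Achieves.seq (Achieves.fillMatrix (p := N) (w := N) W' (by decide)
    (by rw [hv₂ 11 (by decide), hv₁ 11 (by decide) (by decide), h.env.v11]) hNN (by omega) ?_ ?_)
  · intro i j s' hu hv ha hk'
    refine ⟨?_, hWX' i j⟩
    have e4' : s'.var 4 = N := by rw [hu 4 (by decide), hv₂ 4 (by decide), e4]
    have e6 : s'.var 6 = s.var 6 := by
      rw [hu 6 (by decide), hv₂ 6 (by decide), hv₁ 6 (by decide) (by decide)]
    have e18 : s'.var 18 = σ := by rw [hu 18 (by decide), hv₂ 18 (by decide), hv18]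
    have e19 : s'.var 19 = τ c := by rw [hu 19 (by decide), hv₂ 19 (by decide), hv19]
    simp only [eval_get, eval_sub, eval_mul, eval_div, eval_mod, eval_var, hv, e4', e6, e18, e19,
      index_ediv, index_emod]
    rw [hk', ha 3 (by decide), ha 2 (by decide), ha₂ 4 (by decide), ha₂ 2 (by decide), hs₂, hτ,
      h.mat i j]
  · intro s₃ hu₃ ha₃ _ hs₃
    have hv₃ : ∀ u, u ≠ 14 → u ≠ 18 → u ≠ 19 → s₃.var u = s.var u := fun u h1 h2 h3 => by
      rw [hu₃ u h1, hv₂ u h1, hv₁ u h2 h3]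
    have e : (Expr.var 18 * .var 19).eval s₃ = σ * τ c := by
      rw [eval_mul, eval_var, eval_var, hu₃ 18 (by decide), hu₃ 19 (by decide),
        hv₂ 18 (by decide), hv₂ 19 (by decide), hv18, hv19]
    refine Achieves.assign ?_ ⟨W', ?_, ?_, ?_, ?_⟩
    · rw [e, abs_mul]
      have : |σ| = 1 := by rcases hσ' with h | h <;> simp [h]
      rw [this, one_mul]; exact hτX c
    · refine h.env.congr (fun i hi => ?_) ?_
      · simp only [List.mem_cons, List.not_mem_nil, or_false] at hi
        rcases hi with rfl | rfl | rfl | rfl | rfl | rfl | rfl <;>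
          simpa using hv₃ _ (by decide) (by decide) (by decide)
      · simp only; rw [ha₃ 0 (by decide), ha₂ 0 (by decide)]
    · exact h.eqs.congr (by simp only; rw [ha₃ 1 (by decide), ha₂ 1 (by decide)])
    · exact hs₃.congr rfl
    · rw [e]
      have e7 : s₃.var 7 = s.var 7 := hv₃ 7 (by decide) (by decide) (by decide)
      change Elimination M rl q μ _ W' (Function.update s₃.var 6 (σ * τ c) 6)
        (Function.update s₃.var 6 (σ * τ c) 7 ≠ 0)
      rw [Function.update_self, Function.update_of_ne (by decide), e7]
      convert hnew using 2 with r
      rw [Nat.lt_succ_iff_lt_or_eq, Fin.ext_iff]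

theorem achieves_processEquation (hC : Capacity X R n N μ) (hM : ∀ r i, |M r i| ≤ μ)
    (hq : (q : ℕ) + 1 = N) (hqr : ¬ rl q) {k : ℕ} (hk : k < n) {W : Matrix (Fin N) (Fin N) ℤ}
    {s : State} (h : Processed m q rl inp μ M k W s) (hv : s.var 13 = k) :
    Achieves X R processEquation s fun s' => ∃ W', Processed m q rl inp μ M (k + 1) W' s' := by
  have hRX := hC.R_le
  refine Achieves.seq ((achieves_computeRow hC hM h ⟨k, hk⟩ hv).mono fun s₁ hf₁ hτ₁ => ?_)
  have henv₁ : Env m n q rl inp s₁ := h.env.frame hf₁ (by decide) (by decide)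
  refine Achieves.seq ((achieves_searchPivot hC hq henv₁ hτ₁).mono fun s₂ hf₂ hs₂ => ?_)
  have hτ₂ : ∀ l : Fin N, s₂.arr 2 (l : ℕ) = (M ⟨k, hk⟩ ᵥ* W) l := fun l => by
    rw [hf₂.arr 2 (by decide), hτ₁]
  have henv₂ : Env m n q rl inp s₂ := henv₁.frame hf₂ (by decide) (by decide)
  have h₂ : Processed m q rl inp μ M k W s₂ := by
    refine ⟨henv₂, h.eqs.congr ?_, h.mat.congr ?_, ?_⟩
    · rw [hf₂.arr 1 (by decide), hf₁.arr 1 (by decide)]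
    · rw [hf₂.arr 4 (by decide), hf₁.arr 4 (by decide)]
    · rw [hf₂.var 6 (by decide), hf₁.var 6 (by decide), hf₂.var 7 (by decide),
        hf₁.var 7 (by decide)]
      exact h.elim
  have hdone : (fun r : Fin n => (r : ℕ) < k + 1) = fun r : Fin n => (r : ℕ) < k ∨ r = ⟨k, hk⟩ := by
    ext r; rw [Nat.lt_succ_iff_lt_or_eq, Fin.ext_iff]
  have e3 := henv₂.v3
  rcases hs₂ with ⟨h17, h0⟩ | ⟨c, h17, hcq, hτc, hc⟩
  · refine Achieves.branch (fun hne => ?_) (fun _ => ?_)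
    · rw [eval_lt, eval_var, eval_var, h17, e3, if_neg (by omega)] at hne
      exact absurd rfl hne
    · have hnp := h₂.elim.no_pivot (r := ⟨k, hk⟩) h0
      have e : (Expr.get 2 (.var 3)).eval s₂ = (M ⟨k, hk⟩ ᵥ* W) q := by
        rw [eval_get, eval_var, e3, hτ₂]
      refine Achieves.branch (fun hne => Achieves.assign ?_ ⟨W, ?_, h₂.eqs, h₂.mat, ?_⟩)
        (fun heq => Achieves.skip ⟨W, henv₂, h₂.eqs, h₂.mat, ?_⟩)
      · have := hC.pos
        have := hC.sq_le
        simp; nlinarith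
      · exact henv₂.update (by decide) _
      · rw [e] at hne
        rw [hdone]
        simpa [hne] using hnp
      · rw [e] at heq
        rw [hdone]
        simpa [heq] using hnp
  · refine Achieves.branch (fun _ => ?_) (fun heq => ?_)
    · refine achieves_eliminate hC hM hk h₂ hτ₂ h17 hcq hτc (hc.imp_right fun hc l hl => ?_)
      exact hc l (fun h => hqr (h ▸ hl)) hl
    · have : (c : ℕ) < q := by
        have := c.2
        have : (c : ℕ) ≠ q := fun h => hcq (Fin.ext h)
        omega
      rw [eval_lt, eval_var, eval_var, h17, e3, if_pos (by exact_mod_cast this)] at heq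
      exact absurd heq one_ne_zero

theorem achieves_elimination (hC : Capacity X R n N μ) (hM : ∀ r i, |M r i| ≤ μ)
    (hq : (q : ℕ) + 1 = N) (hqr : ¬ rl q) {s : State} (h : Env m n q rl inp s) (hs : Stores 1 M s) :
    Achieves X R elimination s fun s' => ∃ W, Processed m q rl inp μ M n W s' := by
  have hNN : N * N ≤ R := by have := hC.sq_le; nlinarith
  have hRX := hC.R_le
  have hX : (1 : ℤ) ≤ X := by
    have := hC.pos
    have := hC.sq_le
    have : 1 ≤ X := by nlinarith
    exact_mod_cast this
  refine Achieves.seq (Achieves.fillMatrix (1 : Matrix (Fin N) (Fin N) ℤ) (by decide) h.v11 hNN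
    (by omega) ?_ ?_)
  · intro i j s' hu hv _ _
    simp only [eval_eq, eval_div, eval_mod, eval_var, hv, hu 4 (by decide), h.v4, index_ediv,
      index_emod]
    rw [one_apply]
    simp only [Nat.cast_inj, Fin.val_inj, true_and]
    split_ifs <;> simp; exact_mod_cast hX
  · intro s₁ hu ha _ hW
    refine Achieves.seq (Achieves.assign (by simpa using hX) ?_)
    refine Achieves.seq (Achieves.assign (by simp) ?_)
    refine Achieves.forLoop n (fun k s' => ∃ W, Processed m q rl inp μ M k W s') (by decide)
      (by decide) (by decide) ?_ hC.n_le (hC.n_le.trans hRX) ⟨1, ?_, ?_, ?_, ?_⟩ ?_ ?_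
    · simpa using (hu 2 (by decide)).trans h.v2
    · refine h.congr (fun i hi => ?_) (ha 0 (by decide))
      simp only [List.mem_cons, List.not_mem_nil, or_false] at hi
      rcases hi with rfl | rfl | rfl | rfl | rfl | rfl | rfl <;> simpa using hu _ (by decide)
    · exact hs.congr (ha 1 (by decide))
    · exact hW.congr rfl
    · simpa using Elimination.init (M := M) (rl := rl) (q := q) hC.one_le
    · rintro k hk s' - hv ⟨W, hW⟩
      refine (achieves_processEquation hC hM hq hqr hk hW hv).mono ?_
      rintro s'' - ⟨W', hW'⟩
      exact ⟨W', hW'.env.update (by decide) _, hW'.eqs, hW'.mat, by simpa using hW'.elim⟩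
    · rintro s' - - hs'; exact hs'

end Elimination

end LogRAM

namespace LogRAM

variable {X R : ℕ}

/-! ### The Euclidean algorithm -/

/-- A bound for the number of steps of the Euclidean algorithm, which is logarithmic because
`2 * (y % (x % y)) < y`. -/
def euclidMeasure (x y : ℕ) : ℕ := if y = 0 then 0 else 1 + y.size + (x % y).size

theorem euclidMeasure_lt (x : ℕ) {y : ℕ} (hy : y ≠ 0) :
    euclidMeasure y (x % y) < euclidMeasure x y := by
  unfold euclidMeasure
  rw [if_neg hy]
  split_ifs with h
  · omega
  · have hz : x % y < y := Nat.mod_lt _ (Nat.pos_of_ne_zero hy)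
    have h2 : 2 * (y % (x % y)) < y := by
      have h3 := Nat.mod_lt y (Nat.pos_of_ne_zero h)
      have h4 := Nat.mod_add_div y (x % y)
      have h5 : 0 < y / (x % y) := Nat.div_pos hz.le (Nat.pos_of_ne_zero h)
      have h6 : (x % y) * 1 ≤ (x % y) * (y / (x % y)) := Nat.mul_le_mul_left _ h5
      omega
    have h7 : (y % (x % y)).size < y.size := by
      by_cases h0 : y % (x % y) = 0
      · rw [h0, Nat.size_zero]; exact Nat.size_pos.2 (Nat.pos_of_ne_zero hy)
      · have hs := Nat.lt_size_self (y % (x % y))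
        rw [Nat.lt_size]
        have h8 : 2 ^ ((y % (x % y)).size - 1) ≤ y % (x % y) := by
          rw [← Nat.lt_size]
          have := Nat.size_pos.2 (Nat.pos_of_ne_zero h0)
          omega
        have h9 : 2 ^ (y % (x % y)).size = 2 * 2 ^ ((y % (x % y)).size - 1) := by
          rw [← pow_succ']
          congr 1
          have := Nat.size_pos.2 (Nat.pos_of_ne_zero h0)
          omega
        omega
    omega

theorem euclidMeasure_le {x y D : ℕ} (h : y ≤ D) : euclidMeasure x y ≤ 2 * D.size + 1 := by
  unfold euclidMeasure
  split_ifs with h0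
  · omega
  · have h1 := Nat.size_le_size h
    have h2 := Nat.size_le_size ((Nat.mod_lt x (Nat.pos_of_ne_zero h0)).le.trans h)
    omega

/-! ### The lattice program -/

/-- Start with the unit vectors of the integer unknowns as generators. The row `q` of the matrix
`W`, which is `D` times a unit vector, is replaced by the unit vector itself, so that the residues
of this last row are the values of the coordinate `q`. -/
def initGenerators : Program :=
  .store 4 (.var 3 * .var 4 + .var 3) 1 ;;
  fillLoop 13 12 5 0
    ((Expr.var 13 / .var 5).eq (.var 13 % .var 5) * (1 - isReal (.var 13 / .var 5)) % .var 6)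

/-- Compute the residues of the row of `W` whose index is the value of variable `13`, and
initialize the additional generator. -/
def computeResidues : Program :=
  forLoop 14 4
    (sumLoop 15 4 16 (.get 4 (.var 13 * .var 4 + .var 15) * .get 5 (.var 14 * .var 5 + .var 15)) ;;
      .store 5 (.var 14 * .var 5 + .var 4) ((1 - isReal (.var 13)) * .var 16 % .var 6)) ;;
  fillLoop 14 5 5 (.var 12) (.var 6 * (Expr.var 14).eq (.var 4))

/-- One division with remainder, applied to the generator with index the value of variable `14` and
the additional generator. -/
def divisionStep : Program :=
  .assign 20 (.get 5 (.var 12 + .var 4) / .get 5 (.var 14 * .var 5 + .var 4)) ;;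
  fillLoop 15 5 6 0 (.get 5 (.var 12 + .var 15)) ;;
  fillLoop 15 5 5 (.var 12) (.get 5 (.var 14 * .var 5 + .var 15)) ;;
  fillLoop 15 5 5 (.var 14 * .var 5)
    ((.get 6 (.var 15) - .var 20 * .get 5 (.var 14 * .var 5 + .var 15)) % .var 6)

/-- Pass to the sublattice on which the row of `W` with index the value of variable `13` vanishes
modulo `D`. -/
def processRow : Program :=
  computeResidues ;;
  forLoop 14 4 (.loop (.get 5 (.var 14 * .var 5 + .var 4)) divisionStep)

/-- Compute generators of the lattice of integer parameters. -/
def latticeProgram : Program := initGenerators ;; forLoop 13 4 processRow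

section Lattice

variable {m n N : ℕ} {q : Fin N} {rl : Fin N → Prop} [DecidablePred rl] {inp : ℤ → ℤ} {μ D : ℤ}
  {W : Matrix (Fin N) (Fin N) ℤ}

/-- The generators in memory. -/
def gens (N : ℕ) (s : State) (j : Fin (N + 1)) (l : Fin N) : ℤ :=
  s.arr 5 (((j : ℕ) : ℤ) * (N + 1 : ℕ) + (l : ℕ))

/-- The residues in memory. -/
def residue (N : ℕ) (s : State) (j : Fin (N + 1)) : ℤ :=
  s.arr 5 (((j : ℕ) : ℤ) * (N + 1 : ℕ) + N)

theorem gens_congr {s s' : State} (h : s'.arr 5 = s.arr 5) : gens N s' = gens N s := by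
  ext j l; simp only [gens, h]

/-- The memory after the first `k` rows of `W` have been processed. -/
structure LatticeState (m n : ℕ) (q : Fin N) (rl : Fin N → Prop) [DecidablePred rl] (inp : ℤ → ℤ)
    (W : Matrix (Fin N) (Fin N) ℤ) (D : ℤ) (k : ℕ) (s : State) : Prop where
  env : Env m n q rl inp s
  mat : Stores 4 (W.updateRow q (Pi.single q 1)) s
  det : s.var 6 = D
  gen : Generates D (IntegralOn W rl q D fun i => (i : ℕ) < k) (Fin.last N) (gens N s)

/-- All generators in memory but the last one have residue zero. -/
def ZeroResidues (N : ℕ) (s : State) : Prop := ∀ j, j ≠ Fin.last N → residue N s j = 0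

theorem achieves_initGenerators (hC : Capacity X R n N μ) {s : State} (h : Env m n q rl inp s)
    (hW : Stores 4 W s) (hkept : ∀ l, l ≠ q → W q l = 0) (hD : s.var 6 = D) (hD0 : 0 < D) :
    Achieves X R initGenerators s (LatticeState m n q rl inp W D 0) := by
  have hNN : N * (N + 1) ≤ R := by have := hC.sq_le; nlinarith
  have hRX := hC.R_le
  have hX : (1 : ℤ) ≤ X := by
    have := hC.pos
    have : 1 ≤ X := by nlinarith
    exact_mod_cast this
  refine Achieves.seq (Achieves.store (by simpa using hX) ?_)
  set s₁ : State := _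
  change Achieves X R _ s₁ _
  have hv₁ : s₁.var = s.var := rfl
  have ha₁ : ∀ a, a ≠ 4 → s₁.arr a = s.arr a := fun a ha => by simp [s₁, ha]
  have hW₁ : Stores 4 (W.updateRow q (Pi.single q 1)) s₁ := by
    intro i l
    simp only [s₁, eval_add, eval_mul, eval_var, eval_one, h.v3, h.v4, Function.update_self]
    by_cases hil : i = q ∧ l = q
    · obtain ⟨rfl, rfl⟩ := hil
      rw [Function.update_self, updateRow_self, Pi.single_eq_same]
    · rw [Function.update_of_ne, hW i l]
      · by_cases hi : i = q
        · subst hi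
          have hl : l ≠ i := fun h => hil ⟨rfl, h⟩
          rw [updateRow_self, Pi.single_eq_of_ne hl, hkept l hl]
        · rw [updateRow_ne hi]
      · intro he
        obtain ⟨h1, h2⟩ := index_injective he
        exact hil ⟨Fin.ext h1, h2⟩
  have h₁ : Env m n q rl inp s₁ := h.congr (fun _ _ => rfl) (ha₁ 0 (by decide))
  clear_value s₁
  have h1D : 0 ≤ 1 % D ∧ 1 % D < D := ⟨Int.emod_nonneg _ hD0.ne', Int.emod_lt_of_pos _ hD0⟩
  have h1X : 1 % D ≤ 1 := by
    rcases eq_or_ne D 1 with rfl | h1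
    · simp
    · rw [Int.emod_eq_of_lt (by norm_num) (by omega)]
  refine Achieves.fillMatrix (p := N) (w := N + 1)
    (fun i j => if (i : ℕ) = j ∧ ¬ rl i then 1 % D else 0) (by decide) h₁.v12 hNN
    (by omega) ?_ ?_
  · intro i j s' hu hv ha _
    have henv : Env m n q rl inp s' := by
      refine h₁.congr (fun u hu' => hu u ?_) (ha 0 (by decide))
      rintro rfl; exact absurd hu' (by decide)
    have e1 : (Expr.var 13 / .var 5).eval s' = (i : ℕ) := by
      rw [eval_div, eval_var, eval_var, henv.v5, hv, index_ediv]
    have e2 : (Expr.var 13 % .var 5).eval s' = (j : ℕ) := by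
      rw [eval_mod, eval_var, eval_var, henv.v5, hv, index_emod]
    refine ⟨?_, ?_⟩
    · rw [eval_mod, eval_mul, eval_eq, eval_sub, henv.eval_isReal e1, e1, e2, eval_var,
        hu 6 (by decide), hv₁, hD, eval_one]
      by_cases h1 : (i : ℕ) = j
      · by_cases h2 : rl i <;> simp [h1, h2]
      · have h1' : ¬ (((i : ℕ) : ℤ) = (j : ℕ)) := by exact_mod_cast h1
        rw [if_neg h1', zero_mul, Int.zero_emod]; simp [h1]
    · split_ifs
      · rw [abs_of_nonneg h1D.1]; omega
      · simp
  · intro s' hu ha _ hs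
    have hg : ∀ i l : Fin N, gens N s' i.castSucc l = if i = l ∧ ¬ rl i then 1 % D else 0 := by
      intro i l
      have := hs i l.castSucc
      simp only [Fin.val_castSucc, Fin.val_inj] at this
      exact this
    refine ⟨?_, hW₁.congr (ha 4 (by decide)), by rw [hu 6 (by decide), hv₁, hD], ?_, ?_, ?_, ?_⟩
    · refine h₁.congr (fun u hu' => hu u ?_) (ha 0 (by decide))
      rintro rfl; exact absurd hu' (by decide)
    · intro j hj
      obtain ⟨i, rfl⟩ := Fin.exists_castSucc_eq.2 hj
      refine ⟨fun l hl => ?_, fun i hi => absurd hi (by simp)⟩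
      rw [hg, if_neg]
      rintro ⟨rfl, h⟩; exact h hl
    · intro j hj l
      obtain ⟨i, rfl⟩ := Fin.exists_castSucc_eq.2 hj
      rw [hg]; split_ifs <;> omega
    · intro j hj l
      obtain ⟨i, rfl⟩ := Fin.exists_castSucc_eq.2 hj
      rw [hg]; split_ifs <;> omega
    · intro v hv
      refine ⟨Fin.snoc v 0, by simp, fun l => ?_⟩
      rw [Fin.sum_univ_castSucc]
      simp only [Fin.snoc_castSucc, Fin.snoc_last, zero_mul, add_zero, hg]
      rw [Finset.sum_eq_single l]
      · by_cases hl : rl l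
        · simp [hv.1 l hl]
        · rw [if_pos ⟨rfl, hl⟩]
          have : v l - v l * (1 % D) = v l * (1 - 1 % D) := by ring
          rw [this]
          exact Dvd.dvd.mul_left Int.dvd_self_sub_emod _
      · intro i _ hi
        rw [if_neg (fun h => hi h.1), mul_zero]
      · simp

theorem rowFunctional_dotProduct (i : Fin N) (v : Fin N → ℤ) :
    (1 - if rl i then 1 else 0) * (W.updateRow q (Pi.single q 1) i ⬝ᵥ v) =
      rowFunctional W rl q i ⬝ᵥ v := by
  by_cases hi : rl i
  · simp [rowFunctional, hi]
  · by_cases hq : i = q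
    · subst hq; simp [rowFunctional, hi]
    · simp [rowFunctional, hi, hq]

theorem achieves_computeResidues (hC : Capacity X R n N μ)
    (hWB : ∀ i l, |W.updateRow q (Pi.single q 1) i l| ≤ detBound N μ) (hD0 : 0 < D)
    (hDB : D ≤ detBound N μ) (k : Fin N) {s : State}
    (h : LatticeState m n q rl inp W D k s) (hk : s.var 13 = (k : ℕ)) :
    Achieves X R computeResidues s fun s' => Residues D (IntegralOn W rl q D fun i => i < k)
      (rowFunctional W rl q k) (Fin.last N) (gens N s') (residue N s') := by
  have hN : N ≤ R := by have := hC.sq_le; nlinarith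
  have hN1 : N + 1 ≤ R := by have := hC.sq_le; nlinarith
  have hRX := hC.R_le
  have hDX := hDB.trans hC.detBound_le
  have h1 := hC.one_le
  refine Achieves.seq (Achieves.forLoop N (fun k' s' => gens N s' = gens N s ∧
      ∀ j : Fin N, (j : ℕ) < k' →
        residue N s' j.castSucc = (rowFunctional W rl q k ⬝ᵥ gens N s j.castSucc) % D)
    (by decide) (by decide) (by decide) h.env.v4 hN (by omega) ⟨rfl, by simp⟩ ?_ ?_)
  · rintro j hj s' hf hv ⟨hg, hs⟩
    have henv : Env m n q rl inp s' := h.env.frame hf (by decide) (by decide)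
    set j₀ : Fin N := ⟨j, hj⟩ with hj₀
    refine Achieves.seq (Achieves.dotProduct (W.updateRow q (Pi.single q 1) k)
      (gens N s j₀.castSucc) (B := detBound N μ) (by have := hC.le_detBound; omega)
      (hWB k) (fun l => ?_) hC.le_X (by decide) (by decide) (by decide) henv.v4 hN (by omega) ?_ ?_)
    · rw [abs_of_nonneg (h.gen.nonneg _ (Fin.castSucc_ne_last _) l)]
      exact ((h.gen.lt _ (Fin.castSucc_ne_last _) l).le).trans hDB
    · intro l s'' hu hl ha
      have e4 : s''.var 4 = N := by rw [hu 4 (by decide) (by decide), henv.v4]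
      have e5 : s''.var 5 = (N + 1 : ℕ) := by rw [hu 5 (by decide) (by decide), henv.v5]
      have e13 : s''.var 13 = (k : ℕ) := by
        rw [hu 13 (by decide) (by decide), hf.var 13 (by decide), hk]
      have e14 : s''.var 14 = j := by rw [hu 14 (by decide) (by decide), hv]
      simp only [eval_mul, eval_get, eval_add, eval_var, e4, e5, e13, e14, hl, ha]
      rw [hf.arr 4 (by decide), h.mat k l]
      congr 1
      exact congrFun (congrFun hg j₀.castSucc) l
    · intro s'' hu ha _ hw
      have henv'' : Env m n q rl inp s'' := by
        refine henv.congr (fun u hu' => hu u ?_ ?_) (by rw [ha]) <;>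
        · rintro rfl; exact absurd hu' (by decide)
      have e13 : s''.var 13 = (k : ℕ) := by
        rw [hu 13 (by decide) (by decide), hf.var 13 (by decide), hk]
      have e14 : s''.var 14 = j := by rw [hu 14 (by decide) (by decide), hv]
      have e6 : s''.var 6 = D := by
        rw [hu 6 (by decide) (by decide), hf.var 6 (by decide), h.det]
      have e : ((1 - isReal (.var 13)) * .var 16 % .var 6 : Expr).eval s'' =
          (rowFunctional W rl q k ⬝ᵥ gens N s j₀.castSucc) % D := by
        rw [eval_mod, eval_mul, eval_sub, henv''.eval_isReal (i := k) (by rw [eval_var, e13]),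
          eval_var, eval_var, hw, e6, eval_one, rowFunctional_dotProduct]
      have ei : (.var 14 * .var 5 + .var 4 : Expr).eval s'' =
          ((j₀.castSucc : ℕ) : ℤ) * (N + 1 : ℕ) + ((Fin.last N : Fin (N + 1)) : ℕ) := by
        rw [eval_add, eval_mul, eval_var, eval_var, eval_var, e14, henv''.v5, henv''.v4]
        rfl
      refine Achieves.store ?_ ⟨?_, ?_⟩
      · rw [e, abs_of_nonneg (Int.emod_nonneg _ hD0.ne')]
        exact (Int.emod_lt_of_pos _ hD0).le.trans hDX
      · rw [← hg]
        ext j' l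
        simp only [gens, ha, Function.update_self]
        rw [ei, Function.update_of_ne]
        intro he
        have := (index_injective (j := l.castSucc) he).2
        exact Fin.castSucc_ne_last l this
      · intro j' hj'
        simp only [residue, ha, Function.update_self, e]
        rw [ei]
        by_cases hjj : j' = j₀
        · subst hjj
          exact Function.update_self _ _ _
        · rw [Function.update_of_ne]
          · refine hs j' ?_
            have : (j' : ℕ) ≠ j := fun h => hjj (Fin.ext h)
            omega
          · intro he
            have := (index_injective (j := Fin.last N) he).1
            exact hjj (Fin.ext this)
  · rintro s' hf - ⟨hg, hs⟩
    have henv : Env m n q rl inp s' := h.env.frame hf (by decide) (by decide)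
    have e6 : s'.var 6 = D := by rw [hf.var 6 (by decide), h.det]
    refine Achieves.fillLoop (N + 1) ((N * (N + 1) : ℕ) : ℤ) (fun l => if l = N then D else 0)
      (by decide) henv.v5 hN1 (by omega) (fun l hl => ⟨?_, ?_, ?_⟩) ?_
    · simp only [eval_var, State.filled]
      rw [Function.update_of_ne (by decide), henv.v12]
    · simp only [eval_var, eval_mul, eval_eq, State.filled, Function.update_self]
      rw [Function.update_of_ne (by decide), Function.update_of_ne (by decide), henv.v4, e6]
      by_cases hlN : l = N
      · simp [hlN]
      · have : ¬ ((l : ℤ) = N) := by exact_mod_cast hlN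
        simp [hlN]
    · split_ifs
      · rw [abs_of_nonneg hD0.le]; exact hDX
      · simp
    · have hR := h.gen.residues (ω := rowFunctional W rl q k)
        (modClosed_integralOn W rl q D fun i => (i : ℕ) < k) hD0
      have hlow : ∀ (j : Fin N) (l : Fin (N + 1)),
          (s'.filled 14 5 ((N * (N + 1) : ℕ) : ℤ) (fun l => if l = N then D else 0) (N + 1)).arr 5
            (((j : ℕ) : ℤ) * (N + 1 : ℕ) + (l : ℕ)) =
          s'.arr 5 (((j : ℕ) : ℤ) * (N + 1 : ℕ) + (l : ℕ)) := by
        intro j l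
        simp only [State.filled, Function.update_self]
        rw [if_neg]
        have := index_lt j l
        push_cast at this ⊢
        have h2 : ((j : ℕ) : ℤ) * (N + 1) + (l : ℕ) < N * (N + 1) := by exact_mod_cast this
        omega
      have hhigh : ∀ l : Fin (N + 1),
          (s'.filled 14 5 ((N * (N + 1) : ℕ) : ℤ) (fun l => if l = N then D else 0) (N + 1)).arr 5
            (((Fin.last N : Fin (N + 1)) : ℕ) * (N + 1 : ℕ) + (l : ℕ)) =
          if (l : ℕ) = N then D else 0 := by
        intro l
        simp only [State.filled, Function.update_self, Fin.val_last]
        have hl := l.2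
        rw [if_pos (by push_cast; omega)]
        congr 2
        push_cast
        omega
      have hG : gens N (s'.filled 14 5 ((N * (N + 1) : ℕ) : ℤ)
          (fun l => if l = N then D else 0) (N + 1)) =
          Function.update (gens N s) (Fin.last N) 0 := by
        refine funext fun j => funext fun l => ?_
        refine Fin.lastCases ?_ (fun j => ?_) j
        · rw [Function.update_self]
          have := hhigh l.castSucc
          rw [if_neg (by simp; omega)] at this
          exact this
        · rw [Function.update_of_ne (Fin.castSucc_ne_last j), ← hg]
          exact hlow j l.castSucc
      have hT : residue N (s'.filled 14 5 ((N * (N + 1) : ℕ) : ℤ)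
          (fun l => if l = N then D else 0) (N + 1)) =
          Function.update (fun j => (rowFunctional W rl q k ⬝ᵥ gens N s j) % D) (Fin.last N) D := by
        refine funext fun j => ?_
        refine Fin.lastCases ?_ (fun j => ?_) j
        · rw [Function.update_self]
          have := hhigh (Fin.last N)
          rw [if_pos (Fin.val_last N)] at this
          exact this
        · rw [Function.update_of_ne (Fin.castSucc_ne_last j), ← hs j j.2]
          exact hlow j (Fin.last N)
      rw [hG, hT]
      exact hR

/-- The additional generator and the generator `j` undergo one step of the Euclidean algorithm. -/
theorem achieves_divisionStep (hC : Capacity X R n N μ) (hDB : D ≤ detBound N μ)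
    {P : (Fin N → ℤ) → Prop} (hP : ModClosed D P) {ω : Fin N → ℤ} (j : Fin N) {s : State}
    (henv : Env m n q rl inp s) (hD : s.var 6 = D) (hj : s.var 14 = (j : ℕ))
    (h : Residues D P ω (Fin.last N) (gens N s) (residue N s))
    (hne : residue N s j.castSucc ≠ 0) :
    Achieves X R divisionStep s fun s' =>
      Residues D P ω (Fin.last N) (gens N s') (residue N s') ∧
      residue N s' = Function.update (Function.update (residue N s) (Fin.last N)
        (residue N s j.castSucc)) j.castSucc
        (residue N s (Fin.last N) % residue N s j.castSucc) := by
  have hN1 : N + 1 ≤ R := by have := hC.sq_le; nlinarith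
  have hRX := hC.R_le
  have hDX := hDB.trans hC.detBound_le
  have hD0 : 0 < D := h.res_pos.trans_le (h.res_le _)
  have hcell : ∀ (i l : Fin (N + 1)), 0 ≤ s.arr 5 (((i : ℕ) : ℤ) * (N + 1 : ℕ) + (l : ℕ)) ∧
      s.arr 5 (((i : ℕ) : ℤ) * (N + 1 : ℕ) + (l : ℕ)) ≤ D := by
    intro i l
    refine Fin.lastCases ?_ (fun l => ?_) l
    · exact ⟨h.res_nonneg i, h.res_le i⟩
    · exact ⟨h.nonneg i l, (h.lt i l).le⟩
  set x : ℕ → ℤ := fun l => s.arr 5 ((N * (N + 1) : ℕ) + (l : ℤ)) with hx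
  set y : ℕ → ℤ := fun l => s.arr 5 (((j : ℕ) : ℤ) * (N + 1 : ℕ) + l) with hy
  have hx0 : ∀ l < N + 1, 0 ≤ x l ∧ x l ≤ D := by
    intro l hl
    have := hcell (Fin.last N) ⟨l, hl⟩
    simpa [hx] using this
  have hy0 : ∀ l < N + 1, 0 ≤ y l ∧ y l ≤ D := fun l hl => hcell j.castSucc ⟨l, hl⟩
  have hxN : residue N s (Fin.last N) = x N := by simp [residue, hx]
  have hyN : residue N s j.castSucc = y N := rfl
  set qt : ℤ := x N / y N with hqt
  have hjN : ((j : ℕ) : ℤ) * (N + 1 : ℕ) + (N + 1 : ℕ) ≤ (N * (N + 1) : ℕ) := by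
    have : ((j : ℕ) + 1) * (N + 1) ≤ N * (N + 1) := Nat.mul_le_mul_right _ j.2
    push_cast
    have h2 : (((j : ℕ) : ℤ) + 1) * (N + 1) ≤ N * (N + 1) := by exact_mod_cast this
    linarith
  refine Achieves.seq (Achieves.assign ?_ ?_)
  · simp only [eval_div, eval_get, eval_add, eval_mul, eval_var, henv.v12, henv.v4, henv.v5, hj]
    refine (abs_ediv_le _ _).trans ?_
    have := hx0 N (by omega)
    rw [abs_of_nonneg this.1]; exact this.2.trans hDX
  have eqt : (.get 5 (.var 12 + .var 4) / .get 5 (.var 14 * .var 5 + .var 4) : Expr).eval s =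
      qt := by
    simp only [eval_div, eval_get, eval_add, eval_mul, eval_var, henv.v12, henv.v4, henv.v5, hj,
      hqt, hx, hy]
  rw [eqt]
  set s₁ : State := _
  change Achieves X R _ s₁ _
  have env₁ : Env m n q rl inp s₁ := henv.update (by decide) _
  have hv₁ : ∀ u, u ≠ 20 → s₁.var u = s.var u := fun u hu => by simp [s₁, hu]
  have hq₁ : s₁.var 20 = qt := by simp [s₁]
  have ha₁ : s₁.arr = s.arr := rfl
  clear_value s₁
  -- the copy of the additional generator
  refine Achieves.seq (Achieves.fillLoop (N + 1) 0 x (by decide) env₁.v5 hN1 (by omega)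
    (fun l hl => ⟨rfl, ?_, ?_⟩) ?_)
  · simp only [eval_get, eval_add, eval_var, State.filled, Function.update_self]
    rw [Function.update_of_ne (by decide), Function.update_of_ne (by decide), env₁.v12, ha₁]
  · have := hx0 l hl
    rw [abs_of_nonneg this.1]; exact this.2.trans hDX
  set s₂ : State := _
  change Achieves X R _ s₂ _
  have hv₂ : ∀ u, u ≠ 15 → s₂.var u = s₁.var u := fun u hu => by simp [s₂, State.filled, hu]
  have ha₂ : s₂.arr 5 = s.arr 5 := by rw [← ha₁]; simp [s₂, State.filled]
  have ht₂ : ∀ l < N + 1, s₂.arr 6 l = x l := by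
    intro l hl
    simp only [s₂, State.filled, Function.update_self]
    rw [if_pos (by omega)]; simp
  clear_value s₂
  -- the additional generator is replaced by the generator `j`
  refine Achieves.seq (Achieves.fillLoop (N + 1) ((N * (N + 1) : ℕ) : ℤ) y (by decide)
    (by rw [hv₂ 5 (by decide), env₁.v5]) hN1 (by omega) (fun l hl => ⟨?_, ?_, ?_⟩) ?_)
  · simp only [eval_var, State.filled]
    rw [Function.update_of_ne (by decide), hv₂ 12 (by decide), env₁.v12]
  · simp only [eval_get, eval_add, eval_mul, eval_var, State.filled, Function.update_self]
    rw [Function.update_of_ne (by decide), Function.update_of_ne (by decide), hv₂ 14 (by decide),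
      hv₂ 5 (by decide), env₁.v5, hv₁ 14 (by decide), hj, if_neg (by omega), ha₂]
  · have := hy0 l hl
    rw [abs_of_nonneg this.1]; exact this.2.trans hDX
  set s₃ : State := _
  change Achieves X R _ s₃ _
  have hv₃ : ∀ u, u ≠ 15 → s₃.var u = s₂.var u := fun u hu => by simp [s₃, State.filled, hu]
  have ht₃ : ∀ l < N + 1, s₃.arr 6 l = x l := by
    intro l hl
    rw [← ht₂ l hl]; simp [s₃, State.filled]
  have ha₃ : s₃.arr 5 = fun z : ℤ => if ((N * (N + 1) : ℕ) : ℤ) ≤ z ∧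
      z < ((N * (N + 1) : ℕ) : ℤ) + (N + 1 : ℕ)
      then y (z - ((N * (N + 1) : ℕ) : ℤ)).toNat else s.arr 5 z := by
    simp [s₃, State.filled, ha₂]
  clear_value s₃
  -- the generator `j` is replaced by a remainder
  refine Achieves.fillLoop (N + 1) (((j : ℕ) : ℤ) * (N + 1 : ℕ)) (fun l => (x l - qt * y l) % D)
    (by decide) (by rw [hv₃ 5 (by decide), hv₂ 5 (by decide), env₁.v5]) hN1 (by omega)
    (fun l hl => ⟨?_, ?_, ?_⟩) ?_
  · simp only [eval_var, eval_mul, State.filled]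
    rw [Function.update_of_ne (by decide), Function.update_of_ne (by decide), hv₃ 5 (by decide),
      hv₂ 5 (by decide), env₁.v5, hv₃ 14 (by decide), hv₂ 14 (by decide), hv₁ 14 (by decide), hj]
  · simp only [eval_get, eval_add, eval_mul, eval_mod, eval_sub, eval_var, State.filled,
      Function.update_self]
    rw [Function.update_of_ne (by decide), Function.update_of_ne (by decide),
      Function.update_of_ne (by decide), Function.update_of_ne (by decide),
      Function.update_of_ne (by decide), hv₃ 5 (by decide),
      hv₂ 5 (by decide), env₁.v5, hv₃ 14 (by decide), hv₂ 14 (by decide), hv₁ 14 (by decide), hj,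
      hv₃ 20 (by decide), hv₂ 20 (by decide), hq₁, hv₃ 6 (by decide), hv₂ 6 (by decide),
      hv₁ 6 (by decide), hD, ht₃ l hl, if_neg (by omega), ha₃]
    simp only
    rw [if_neg (by omega)]
  · rw [abs_of_nonneg (Int.emod_nonneg _ hD0.ne')]
    exact (Int.emod_lt_of_pos _ hD0).le.trans hDX
  set s₄ : State := _
  change Residues D P ω (Fin.last N) (gens N s₄) (residue N s₄) ∧ residue N s₄ = _
  have ha₄ : s₄.arr 5 = fun z => if ((j : ℕ) : ℤ) * (N + 1 : ℕ) ≤ z ∧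
      z < ((j : ℕ) : ℤ) * (N + 1 : ℕ) + (N + 1 : ℕ)
      then (x (z - ((j : ℕ) : ℤ) * (N + 1 : ℕ)).toNat - qt * y (z - ((j : ℕ) : ℤ) *
        (N + 1 : ℕ)).toNat) % D else s₃.arr 5 z := by
    simp [s₄, State.filled]
  clear_value s₄
  have hnew : ∀ i l : Fin (N + 1), s₄.arr 5 (((i : ℕ) : ℤ) * (N + 1 : ℕ) + (l : ℕ)) =
      if i = j.castSucc then (x l - qt * y l) % D else if i = Fin.last N then y l
      else s.arr 5 (((i : ℕ) : ℤ) * (N + 1 : ℕ) + (l : ℕ)) := by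
    intro i l
    have hl := l.2
    rw [ha₄]
    by_cases hij : i = j.castSucc
    · subst hij
      simp only [Fin.val_castSucc, if_true]
      rw [if_pos (by omega), add_sub_cancel_left, Int.toNat_natCast]
    · have hij' : (i : ℕ) ≠ j := fun h => hij (Fin.ext h)
      simp only [hij, if_false]
      rw [if_neg, ha₃]
      · by_cases hi : i = Fin.last N
        · subst hi
          simp only [Fin.val_last, if_true]
          rw [if_pos (by push_cast; omega)]
          congr 1
          push_cast; omega
        · have hi' : (i : ℕ) < N := Fin.val_lt_last hi
          simp only [hi, if_false]
          rw [if_neg]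
          have h1 : ((i : ℕ) + 1) * (N + 1) ≤ N * (N + 1) := Nat.mul_le_mul_right _ hi'
          have h2 : (((i : ℕ) : ℤ) + 1) * (N + 1) ≤ N * (N + 1) := by exact_mod_cast h1
          push_cast
          intro h3
          have : ((l : ℕ) : ℤ) < N + 1 := by exact_mod_cast hl
          linarith [h3.1]
      · rintro ⟨h1, h2⟩
        have h3 : ((j : ℕ) : ℤ) * (N + 1 : ℕ) + (((i : ℤ) - (j : ℤ)) * (N + 1 : ℕ) + (l : ℕ)) =
          ((i : ℕ) : ℤ) * (N + 1 : ℕ) + (l : ℕ) := by push_cast; ring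
        have h4 : (((i : ℕ) : ℤ) * (N + 1 : ℕ) + (l : ℕ)) / (N + 1 : ℕ) = (i : ℕ) := index_ediv _ l
        have h5 : (((i : ℕ) : ℤ) * (N + 1 : ℕ) + (l : ℕ)) / (N + 1 : ℕ) = (j : ℕ) := by
          rw [Int.ediv_eq_iff_of_pos (by positivity)]
          exact ⟨by linarith, by push_cast at h2 ⊢; linarith⟩
        rw [h4] at h5
        exact hij' (by exact_mod_cast h5)
  have hstep := h.step hP (Fin.castSucc_ne_last j) hne
  have hgen : gens N s₄ = Function.update (Function.update (gens N s) (Fin.last N)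
      (gens N s j.castSucc)) j.castSucc fun l => (gens N s (Fin.last N) l -
        residue N s (Fin.last N) / residue N s j.castSucc * gens N s j.castSucc l) % D := by
    ext i l
    have := hnew i l.castSucc
    rw [hxN, hyN, ← hqt]
    rw [show gens N s₄ i l = _ from this]
    by_cases hij : i = j.castSucc
    · subst hij
      rw [if_pos rfl, Function.update_self]
      simp [gens, hx, hy]
    · rw [if_neg hij, Function.update_of_ne hij]
      by_cases hi : i = Fin.last N
      · subst hi
        rw [if_pos rfl, Function.update_self]; rfl
      · rw [if_neg hi, Function.update_of_ne hi]; rfl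
  have hres : residue N s₄ = Function.update (Function.update (residue N s) (Fin.last N)
      (residue N s j.castSucc)) j.castSucc
      (residue N s (Fin.last N) % residue N s j.castSucc) := by
    ext i
    have := hnew i (Fin.last N)
    rw [hxN, hyN]
    rw [show residue N s₄ i = _ from this]
    by_cases hij : i = j.castSucc
    · subst hij
      rw [if_pos rfl, Function.update_self, Fin.val_last]
      -- the remainder is smaller than `D`, so that the reduction modulo `D` has no effect
      have hy1 : 0 < y N := lt_of_le_of_ne (hy0 N (by omega)).1 (Ne.symm (by rwa [hyN] at hne))
      have h1 : x N - qt * y N = x N % y N := by rw [hqt, Int.emod_def]; ring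
      rw [h1]
      exact Int.emod_eq_of_lt (Int.emod_nonneg _ hy1.ne')
        ((Int.emod_lt_of_pos _ hy1).trans_le (hy0 N (by omega)).2)
    · rw [if_neg hij, Function.update_of_ne hij]
      by_cases hi : i = Fin.last N
      · subst hi
        rw [if_pos rfl, Function.update_self]; rfl
      · rw [if_neg hi, Function.update_of_ne hi]; rfl
  rw [hgen, hres]
  exact ⟨hstep, rfl⟩

theorem achieves_processRow (hC : Capacity X R n N μ)
    (hWB : ∀ i l, |W.updateRow q (Pi.single q 1) i l| ≤ detBound N μ) (hD0 : 0 < D)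
    (hDB : D ≤ detBound N μ) (k : Fin N) {s : State}
    (h : LatticeState m n q rl inp W D k s) (hk : s.var 13 = (k : ℕ)) :
    Achieves X R processRow s fun s' => Residues D (IntegralOn W rl q D fun i => i < k)
      (rowFunctional W rl q k) (Fin.last N) (gens N s') (residue N s') ∧ ZeroResidues N s' := by
  have hN : N ≤ R := by have := hC.sq_le; nlinarith
  have hRX := hC.R_le
  have hDX := hDB.trans hC.detBound_le
  refine Achieves.seq ((achieves_computeResidues hC hWB hD0 hDB k h hk).mono fun s₁ hf₁ h₁ => ?_)
  have env₁ : Env m n q rl inp s₁ := h.env.frame hf₁ (by decide) (by decide)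
  have hP := modClosed_integralOn W rl q D fun i => i < k
  refine Achieves.forLoop N (fun k' s' => Residues D (IntegralOn W rl q D fun i => i < k)
      (rowFunctional W rl q k) (Fin.last N) (gens N s') (residue N s') ∧
      ∀ j : Fin N, (j : ℕ) < k' → residue N s' j.castSucc = 0)
    (by decide) (by decide) (by decide) env₁.v4 hN (by omega) ⟨h₁, by simp⟩ ?_ ?_
  · rintro j hj s' hf hv ⟨hr, hs⟩
    have henv : Env m n q rl inp s' := env₁.frame hf (by decide) (by decide)
    set j₀ : Fin N := ⟨j, hj⟩
    have e6 : s'.var 6 = D := by rw [hf.var 6 (by decide), hf₁.var 6 (by decide), h.det]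
    have hcond : ∀ s'' : State, Frame divisionStep s' s'' →
        (Expr.get 5 (.var 14 * .var 5 + .var 4)).eval s'' = residue N s'' j₀.castSucc := by
      intro s'' hf''
      have henv'' : Env m n q rl inp s'' := henv.frame hf'' (by decide) (by decide)
      simp only [eval_get, eval_add, eval_mul, eval_var, henv''.v4, henv''.v5,
        hf''.var 14 (by decide), hv]
      rfl
    refine Achieves.loop (fun s'' => Residues D (IntegralOn W rl q D fun i => i < k)
        (rowFunctional W rl q k) (Fin.last N) (gens N s'') (residue N s'') ∧
        ∀ j' : Fin N, (j' : ℕ) < j → residue N s'' j'.castSucc = 0)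
      (fun s'' => euclidMeasure (residue N s'' (Fin.last N)).toNat
        (residue N s'' j₀.castSucc).toNat) ?_ ⟨hr, hs⟩ ?_ ?_
    · refine le_trans (euclidMeasure_le (D := X) ?_) hC.euclid
      have := (hr.res_le j₀.castSucc).trans hDX
      omega
    · rintro s'' hf'' ⟨hr'', hs''⟩ hne
      have hf''' : Frame divisionStep s' s'' := ⟨hf''.var, hf''.arr, hf''.out⟩
      have henv'' : Env m n q rl inp s'' := henv.frame hf''' (by decide) (by decide)
      rw [hcond s'' hf'''] at hne
      refine (achieves_divisionStep hC hDB hP j₀ henv'' (by rw [hf'''.var 6 (by decide), e6])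
        (by rw [hf'''.var 14 (by decide), hv]) hr'' hne).mono ?_
      rintro s₃ - ⟨hr₃, hres₃⟩
      refine ⟨⟨hr₃, fun j' hj' => ?_⟩, ?_⟩
      · have h1 : j'.castSucc ≠ j₀.castSucc := fun h => by
          have := congrArg Fin.val h
          simp [j₀] at this; omega
        rw [hres₃, Function.update_of_ne h1, Function.update_of_ne (Fin.castSucc_ne_last j')]
        exact hs'' j' hj'
      · have h0 := hr''.res_nonneg (Fin.last N)
        have h1 := hr''.res_nonneg j₀.castSucc
        rw [hres₃, Function.update_self,
          Function.update_of_ne (Fin.castSucc_ne_last j₀).symm, Function.update_self,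
          Int.toNat_emod h0 h1]
        exact euclidMeasure_lt _ (by omega)
    · rintro s'' hf'' ⟨hr'', hs''⟩ heq
      have hf''' : Frame divisionStep s' s'' := ⟨hf''.var, hf''.arr, hf''.out⟩
      rw [hcond s'' hf'''] at heq
      refine ⟨hr'', fun j' hj' => ?_⟩
      by_cases hjj : j' = j₀
      · subst hjj; exact heq
      · refine hs'' j' ?_
        have : (j' : ℕ) ≠ j := fun h => hjj (Fin.ext h)
        omega
  · rintro s' - - ⟨hr, hs⟩
    refine ⟨hr, fun j hj => ?_⟩
    obtain ⟨i, rfl⟩ := Fin.exists_castSucc_eq.2 hj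
    exact hs i i.2

theorem achieves_latticeProgram (hC : Capacity X R n N μ) (hq : (q : ℕ) + 1 = N) (hqr : ¬ rl q)
    (hWB : ∀ i l, |W i l| ≤ detBound N μ) (hD0 : 0 < D)
    (hDB : D ≤ detBound N μ) {s : State} (h : Env m n q rl inp s)
    (hW : Stores 4 W s) (hkept : ∀ l, l ≠ q → W q l = 0) (hD : s.var 6 = D) :
    Achieves X R latticeProgram s fun s' => LatticeState m n q rl inp W D N s' ∧
      Residues D (IntegralOn W rl q D (· ≠ q)) (Pi.single q 1) (Fin.last N) (gens N s')
        (residue N s') ∧ ZeroResidues N s' := by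
  have hN : N ≤ R := by have := hC.sq_le; nlinarith
  have hRX := hC.R_le
  have hB := hC.one_le.trans hC.le_detBound
  have hWB' : ∀ i l, |W.updateRow q (Pi.single q 1) i l| ≤ detBound N μ := by
    intro i l
    by_cases hi : i = q
    · subst hi
      rw [updateRow_self, Pi.single_apply]
      split_ifs <;> simp <;> omega
    · rw [updateRow_ne hi]; exact hWB i l
  refine Achieves.seq ((achieves_initGenerators hC h hW hkept hD hD0).mono fun s₁ _ h₁ => ?_)
  refine Achieves.forLoop N (fun k s' => LatticeState m n q rl inp W D k s' ∧ (k = N →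
      Residues D (IntegralOn W rl q D (· ≠ q)) (Pi.single q 1) (Fin.last N) (gens N s')
        (residue N s') ∧ ZeroResidues N s'))
    (by decide) (by decide) (by decide) h₁.env.v4 hN (by omega)
    ⟨⟨h₁.env.update (by decide) _, h₁.mat, ?_, h₁.gen⟩, fun h0 => ?_⟩ ?_ ?_
  · simpa using h₁.det
  · have := hC.pos; omega
  · rintro k hk s' - hv ⟨hs, -⟩
    refine (achieves_processRow hC hWB' hD0 hDB ⟨k, hk⟩ hs hv).mono ?_
    rintro s'' hf'' ⟨hr, hz⟩
    refine ⟨⟨(hs.env.frame hf'' (by decide) (by decide)).update (by decide) _,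
      hs.mat.congr (hf''.arr 4 (by decide)), ?_, ?_⟩, fun hkN => ?_⟩
    · simpa [hs.det] using hf''.var 6 (by decide)
    · have := hr.generates hz
      have hI : (IntegralOn W rl q D fun i => (i : ℕ) < k + 1) =
          fun v => IntegralOn W rl q D (fun i => i < ⟨k, hk⟩) v ∧
            D ∣ rowFunctional W rl q ⟨k, hk⟩ ⬝ᵥ v := ?_
      · rw [hI]; exact this
      ext v
      simp only [IntegralOn, Nat.lt_succ_iff_lt_or_eq]
      constructor
      · rintro ⟨h1, h2⟩
        exact ⟨⟨h1, fun i hi => h2 i (Or.inl hi)⟩, h2 ⟨k, hk⟩ (Or.inr rfl)⟩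
      · rintro ⟨⟨h1, h2⟩, h3⟩
        refine ⟨h1, fun i hi => ?_⟩
        rcases hi with hi | hi
        · exact h2 i hi
        · have : i = ⟨k, hk⟩ := Fin.ext hi
          rw [this]; exact h3
    · have hkq : (⟨k, hk⟩ : Fin N) = q := Fin.ext (by simp only; omega)
      have hlt : (fun i : Fin N => i < ⟨k, hk⟩) = fun i => i ≠ q := by
        ext i
        rw [← hkq, Fin.lt_def, Ne, Fin.ext_iff]
        have := i.2
        simp only; omega
      rw [hlt, hkq] at hr
      have hω : rowFunctional W rl q q = Pi.single q 1 := by simp [rowFunctional, hqr]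
      rw [hω] at hr
      exact ⟨hr, hz⟩
  · rintro s' - - ⟨h1, h2⟩; exact ⟨h1, h2 rfl⟩

end Lattice

end LogRAM

namespace LogRAM

variable {X R : ℕ}

/-! ### The output program -/

/-- A loop that outputs one list per iteration. -/
theorem Achieves.outputLoop {v c : ℕ} {p : Program} {s : State} {Q : State → Prop} {cnt : ℕ}
    (f : Fin cnt → List ℤ) (hv : v ∉ p.vars) (hc : c ∉ p.vars) (hvc : v ≠ c)
    (hcnt : s.var c = cnt) (hR : cnt ≤ R) (hX : cnt ≤ X)
    (hstep : ∀ (k : Fin cnt) (s' : State), Frame (LogRAM.forLoop v c p) s s' →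
      s'.var v = (k : ℕ) → Achieves X R p s' fun s'' => s''.out = s'.out ++ f k)
    (hend : ∀ s', Frame (LogRAM.forLoop v c p) s s' → s'.out = s.out ++ (List.ofFn f).flatten →
      Q s') :
    Achieves X R (LogRAM.forLoop v c p) s Q := by
  refine Achieves.forLoop cnt (fun k s' => s'.out = s.out ++ ((List.ofFn f).take k).flatten)
    hv hc hvc hcnt hR hX (by simp) ?_ ?_
  · intro k hk s' hf hv' ho
    refine (hstep ⟨k, hk⟩ s' hf hv').mono fun s'' _ h => ?_
    change s''.out = _
    rw [h, ho, List.take_succ_eq_append_getElem (by simpa using hk), List.flatten_append]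
    simp
  · intro s' hf _ ho
    refine hend s' hf ?_
    rw [ho, List.take_of_length_le (by simp)]

/-- Output the rational number with numerator the product of the row `e` of `W` and the parameter
vector `f`, and denominator `D`, in lowest terms. -/
def emitEntry (e f : Expr) : Program :=
  sumLoop 15 4 16 (.get 4 (e * .var 4 + .var 15) * .get 7 (f * .var 4 + .var 15)) ;;
  .assign 24 (.var 6) ;; .assign 25 (.var 16 % .var 6) ;;
  .loop (.var 25) (.assign 26 (.var 24 % .var 25) ;; .assign 24 (.var 25) ;;
    .assign 25 (.var 26)) ;;
  .emit (.var 16 / .var 24) ;; .emit (.var 6 / .var 24)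

/-- The coordinate `l` of the parameter vector `c`. The last vector belongs to the particular
solution, the other ones to the columns of the matrix of the kernel. -/
def slotEntry (c l : Expr) : Expr :=
  c.lt (.var 1) * (isReal c * c.eq l) +
  (1 - c.lt (.var 1)) * c.lt (.var 1 + .var 4) * .get 5 ((c - .var 1) * .var 5 + l) +
  (1 - c.lt (.var 1 + .var 4)) * c.lt (.var 21) *
    ((c - .var 1 - .var 4).eq l * (1 - isReal l) * l.lt (.var 3) * .var 6) +
  c.eq (.var 21) * (l.eq (.var 3) + l.lt (.var 3) * .get 5 (.var 12 + l))

/-- Output the general solution. Variable `21` holds the number of columns of the matrix. -/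
def outputSolution : Program :=
  .emit 1 ;; .emit (.var 1) ;; .emit (.var 4 + .var 4) ;;
  .assign 21 (.var 1 + (.var 4 + .var 4)) ;; .assign 10 ((.var 21 + 1) * .var 4) ;;
  fillLoop 13 10 7 0 (slotEntry (.var 13 / .var 4) (.var 13 % .var 4)) ;;
  forLoop 22 1 (emitEntry (.var 22) (.var 21)) ;;
  forLoop 22 1 (forLoop 23 21 (emitEntry (.var 22) (.var 23)))

theorem encodeRat_intCast_div {p D : ℤ} (hD : 0 < D) :
    encodeRat ((p : ℚ) / D) = [p / (Int.gcd p D : ℕ), D / (Int.gcd p D : ℕ)] := by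
  rw [encodeRat, ← Rat.divInt_eq_div, Rat.num_divInt, Rat.den_divInt, if_neg hD.ne',
    Int.sign_eq_one_of_pos hD, one_mul, Int.gcd_comm D p, Int.natCast_ediv,
    Int.natCast_natAbs, abs_of_pos hD]

theorem achieves_emitEntry {n N w : ℕ} {μ D : ℤ} (hC : Capacity X R n N μ)
    {W : Matrix (Fin N) (Fin N) ℤ} {F : Fin w → Fin N → ℤ} {i : Fin N} {c : Fin w}
    {s : State}
    (hWB : ∀ l, |W i l| ≤ detBound N μ) (hFB : ∀ l, |F c l| ≤ detBound N μ)
    (hD0 : 0 < D) (hDB : D ≤ detBound N μ) (h4 : s.var 4 = N)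
    (h6 : s.var 6 = D) (hW : ∀ l : Fin N, s.arr 4 ((i : ℕ) * (N : ℕ) + (l : ℕ)) = W i l)
    (hF : Stores 7 F s) {e f : Expr}
    (he : ∀ s' : State, (∀ u, u ≠ 15 → u ≠ 16 → s'.var u = s.var u) → e.eval s' = (i : ℕ))
    (hf : ∀ s' : State, (∀ u, u ≠ 15 → u ≠ 16 → s'.var u = s.var u) →
      f.eval s' = (c : ℕ)) :
    Achieves X R (emitEntry e f) s fun s' =>
      s'.out = s.out ++ encodeRat (((W i ⬝ᵥ F c : ℤ) : ℚ) / D) := by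
  have hN : N ≤ R := by have := hC.sq_le; nlinarith
  have hRX := hC.R_le
  have hDX := hDB.trans hC.detBound_le
  refine Achieves.seq (Achieves.dotProduct (W i) (F c) (B := detBound N μ) (by omega) hWB hFB
    hC.le_X (by decide) (by decide) (by decide) h4 hN (by omega) ?_ ?_)
  · intro l s' hu hl ha
    simp only [eval_mul, eval_get, eval_add, eval_var, he s' hu, hf s' hu, hl, ha,
      hu 4 (by decide) (by decide), h4, hW l]
    rw [hF c l]
  intro s₁ hu _ ho hw
  set P : ℤ := W i ⬝ᵥ F c
  have e6 : s₁.var 6 = D := by rw [hu 6 (by decide) (by decide), h6]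
  refine Achieves.seq (Achieves.assign (by rw [eval_var, e6, abs_of_pos hD0]; exact hDX) ?_)
  have hr0 := Int.emod_nonneg P hD0.ne'
  have hrD := Int.emod_lt_of_pos P hD0
  refine Achieves.seq (Achieves.assign ?_ ?_)
  · simp only [eval_mod, eval_var]
    rw [Function.update_of_ne (by decide), Function.update_of_ne (by decide), hw, e6,
      abs_of_nonneg hr0]
    omega
  -- the Euclidean algorithm for `P` and `D`
  refine Achieves.seq (Achieves.loop
    (fun s' => 0 < s'.var 24 ∧ s'.var 24 ≤ D ∧ 0 ≤ s'.var 25 ∧ s'.var 25 ≤ D ∧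
      Int.gcd (s'.var 24) (s'.var 25) = Int.gcd P D)
    (fun s' => euclidMeasure (s'.var 24).toNat (s'.var 25).toNat) ?_ ?_ ?_ ?_)
  · refine le_trans (euclidMeasure_le (D := X) ?_) hC.euclid
    simp [hw, e6]; omega
  · simp only [eval_mod, eval_var, ne_eq, not_false_eq_true, Function.update_of_ne,
      Nat.reduceEqDiff, Function.update_self]
    rw [hw, e6]
    refine ⟨hD0, le_rfl, hr0, hrD.le, ?_⟩
    rw [Int.gcd_comm, Int.gcd_emod]
  · rintro s' - ⟨h1, h2, h3, h4, h5⟩ hne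
    rw [eval_var] at hne
    have hy : 0 < s'.var 25 := by omega
    have hm0 := Int.emod_nonneg (s'.var 24) hy.ne'
    have hmD := Int.emod_lt_of_pos (s'.var 24) hy
    refine Achieves.seq (Achieves.assign ?_ (Achieves.seq (Achieves.assign ?_
      (Achieves.assign ?_ ?_))))
    · simp only [eval_mod, eval_var]; rw [abs_of_nonneg hm0]; omega
    · simp; rw [abs_of_pos hy]; omega
    · simp; rw [abs_of_nonneg hm0]; omega
    · simp only [eval_mod, eval_var, Function.update_self, ne_eq,
        not_false_eq_true, Function.update_of_ne, Nat.reduceEqDiff]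
      refine ⟨⟨hy, h4, hm0, by omega, ?_⟩, ?_⟩
      · rw [← h5, Int.gcd_comm (s'.var 25), Int.gcd_emod]
      · rw [Int.toNat_emod h1.le h3]
        exact euclidMeasure_lt _ (by omega)
  · rintro s' hf' ⟨h1, -, -, -, h5⟩ heq
    rw [eval_var] at heq
    rw [heq, Int.gcd_zero_right] at h5
    have e24 : s'.var 24 = (Int.gcd P D : ℕ) := by rw [← h5]; omega
    have e16 : s'.var 16 = P := by rw [hf'.var 16 (by decide), ← hw]; simp
    have e6' : s'.var 6 = D := by rw [hf'.var 6 (by decide), ← e6]; simp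
    have eo : s'.out = s.out := by rw [hf'.out rfl]; exact ho
    refine Achieves.seq (Achieves.emit (Achieves.emit ?_))
    simp only [eval_div, eval_var]
    rw [encodeRat_intCast_div hD0, eo, e24, e16, e6']
    simp

section Output

variable {m n : ℕ} {G : Fin m → Primitive} {inp : ℤ → ℤ} {μ D : ℤ}

/-- The parameter vectors of the kernel, and the one of the particular solution. -/
def slotVector (G : Fin m → Primitive) (D : ℤ)
    (V : Fin (m + n + 1 + 1) → Fin (m + n + 1) → ℤ) :
    Fin (m + ((m + n + 1) + (m + n + 1)) + 1) → Fin (m + n + 1) → ℤ :=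
  Fin.snoc (α := fun _ => Fin (m + n + 1) → ℤ) (columnVector G D V)
    (Function.update (V (Fin.last _)) (Fin.last (m + n)) 1)

theorem eval_slotEntry {s : State} (h : Env m n (Fin.last (m + n)) (realUnknown G) inp s)
    (hD : s.var 6 = D) (hK : s.var 21 = (m + ((m + n + 1) + (m + n + 1)) : ℕ)) {e f : Expr}
    {c : Fin (m + ((m + n + 1) + (m + n + 1)) + 1)} {l : Fin (m + n + 1)}
    (he : e.eval s = (c : ℕ)) (hf : f.eval s = (l : ℕ)) :
    (slotEntry e f).eval s = slotVector G D (gens (m + n + 1) s) c l := by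
  have hl := l.2
  have hr := h.eval_isReal hf
  have h3 := h.v3
  rw [Fin.val_last] at h3
  simp only [slotEntry, eval_add, eval_mul, eval_lt, eval_eq, eval_sub, eval_get, eval_var,
    eval_one, hf, h.v1, h3, h.v4, h.v5, h.v12, hK, hD, hr]
  have hri : ∀ i : Fin m, e.eval s = (i : ℕ) →
      (isReal e).eval s = if (G i).IsReal then 1 else 0 := fun i hi => by
    rw [h.eval_isReal (i := unknown n i) hi]
    simp only [realUnknown_unknown]
  generalize e.eval s = x at he hri ⊢
  induction c using Fin.lastCases with
  | last =>
    rw [Fin.val_last] at he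
    rw [slotVector, Fin.snoc_last]
    simp only [if_neg (show ¬ x < m by omega), if_neg (show ¬ x < m + (m + n + 1 : ℕ) by omega),
      if_neg he.not_lt, if_pos he]
    by_cases hlq : l = Fin.last (m + n)
    · subst hlq
      simp
    · have hlt : (l : ℕ) < m + n := Fin.val_lt_last hlq
      rw [Function.update_of_ne hlq, if_neg (show ¬ ((l : ℕ) : ℤ) = (m + n : ℕ) by omega),
        if_pos (show ((l : ℕ) : ℤ) < (m + n : ℕ) by omega)]
      simp [gens]
  | cast c =>
    rw [slotVector, Fin.snoc_castSucc]
    rw [Fin.val_castSucc] at he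
    induction c using Fin.addCases with
    | left i =>
      have hi := i.2
      rw [Fin.val_castAdd] at he
      rw [hri i he, columnVector, Fin.append_left]
      simp only [if_pos (show x < m by omega), if_pos (show x < m + (m + n + 1 : ℕ) by omega),
        if_neg (show ¬ x = (m + ((m + n + 1) + (m + n + 1)) : ℕ) by omega)]
      have hil : x = (l : ℕ) ↔ l = unknown n i := by
        rw [Fin.ext_iff, he, unknown, Fin.val_castSucc, Fin.val_castAdd, Nat.cast_inj, eq_comm]
      by_cases hR : (G i).IsReal
      · simp only [hR, if_true, Pi.single_apply, hil]
        ring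
      · simp [hR]
    | right c =>
      rw [columnVector, Fin.append_right]
      rw [Fin.val_natAdd] at he
      induction c using Fin.addCases with
      | left j =>
        have hj := j.2
        rw [Fin.val_castAdd] at he
        rw [Fin.append_left]
        simp only [if_neg (show ¬ x < m by omega), if_pos (show x < m + (m + n + 1 : ℕ) by omega),
          if_neg (show ¬ x = (m + ((m + n + 1) + (m + n + 1)) : ℕ) by omega)]
        rw [show x - m = (j : ℕ) by omega]
        simp [gens]
      | right j =>
        have hj := j.2
        rw [Fin.val_natAdd] at he
        rw [Fin.append_right]
        simp only [if_neg (show ¬ x < m by omega),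
          if_neg (show ¬ x < m + (m + n + 1 : ℕ) by omega),
          if_pos (show x < (m + ((m + n + 1) + (m + n + 1)) : ℕ) by omega),
          if_neg (show ¬ x = (m + ((m + n + 1) + (m + n + 1)) : ℕ) by omega)]
        have hjl : (x - m - (m + n + 1 : ℕ) = (l : ℕ)) ↔ l = j := by
          rw [Fin.ext_iff]; omega
        simp only [hjl]
        by_cases hlj : l = j
        · subst hlj
          by_cases hrl : realUnknown G l
          · simp [hrl]
          · by_cases hlq : l = Fin.last (m + n)
            · subst hlq; simp
            · have hlt : (l : ℕ) < m + n := Fin.val_lt_last hlq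
              rw [if_pos (show ((l : ℕ) : ℤ) < (m + n : ℕ) by exact_mod_cast hlt)]
              simp [hrl, hlq]
        · split_ifs <;> simp [hlj]

theorem abs_slotVector_le {P : (Fin (m + n + 1) → ℤ) → Prop} {ω : Fin (m + n + 1) → ℤ}
    {V : Fin (m + n + 1 + 1) → Fin (m + n + 1) → ℤ} {t : Fin (m + n + 1 + 1) → ℤ}
    (h : Residues D P ω (Fin.last _) V t) (c : Fin (m + ((m + n + 1) + (m + n + 1)) + 1))
    (l : Fin (m + n + 1)) : |slotVector G D V c l| ≤ D := by
  have hD : 0 < D := h.res_pos.trans_le (h.res_le _)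
  have hV : ∀ j l, |V j l| ≤ D := fun j l => by
    rw [abs_of_nonneg (h.nonneg j l)]; exact (h.lt j l).le
  induction c using Fin.lastCases with
  | last =>
    rw [slotVector, Fin.snoc_last, Function.update_apply]
    split_ifs
    · rw [abs_one]; exact hD
    · exact hV _ _
  | cast c =>
    rw [slotVector, Fin.snoc_castSucc]
    induction c using Fin.addCases with
    | left i =>
      rw [columnVector, Fin.append_left]
      split_ifs
      · rw [Pi.single_apply]; split_ifs <;> simp <;> omega
      · simpa using hD.le
    | right c =>
      rw [columnVector, Fin.append_right]
      induction c using Fin.addCases with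
      | left j => rw [Fin.append_left]; exact hV _ _
      | right j =>
        rw [Fin.append_right]
        split_ifs
        · rw [Pi.single_apply]; split_ifs
          · rw [abs_of_pos hD]
          · simpa using hD.le
        · simpa using hD.le

theorem achieves_outputSolution {W : Matrix (Fin (m + n + 1)) (Fin (m + n + 1)) ℤ}
    {P : (Fin (m + n + 1) → ℤ) → Prop} {ω : Fin (m + n + 1) → ℤ}
    (hC : Capacity X R n (m + n + 1) μ)
    (hR : (m + ((m + n + 1) + (m + n + 1)) + 1) * (m + n + 1) ≤ R)
    (hWB : ∀ i l, |W i l| ≤ detBound (m + n + 1) μ) (hDB : D ≤ detBound (m + n + 1) μ) {s : State}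
    (h : LatticeState m n (Fin.last (m + n)) (realUnknown G) inp W D (m + n + 1) s)
    (hr : Residues D P ω (Fin.last _) (gens (m + n + 1) s) (residue (m + n + 1) s))
    (ho : s.out = []) :
    Achieves X R outputSolution s fun s' => s'.out =
      encodeSolution (particularSolution D (gens (m + n + 1) s) W)
        (kernelMatrix G D (gens (m + n + 1) s) W) := by
  set K := m + ((m + n + 1) + (m + n + 1)) with hK
  have hD0 : 0 < D := hr.res_pos.trans_le (hr.res_le _)
  have hKR : K + 1 ≤ R := by nlinarith
  have hRX := hC.R_le
  have hDX := hDB.trans hC.detBound_le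
  refine Achieves.seq (Achieves.emit (Achieves.seq (Achieves.emit (Achieves.seq
    (Achieves.emit ?_)))))
  simp only [eval_one, eval_var, eval_add, ho, h.env.v1, h.env.v4]
  refine Achieves.seq (Achieves.assign ?_ ?_)
  · simp only [eval_add, eval_var, h.env.v1, h.env.v4]
    rw [abs_of_nonneg (by positivity)]
    omega
  refine Achieves.seq (Achieves.assign ?_ ?_)
  · simp only [eval_add, eval_mul, eval_var, eval_one, h.env.v1, h.env.v4, Function.update_self]
    rw [Function.update_of_ne (by decide), h.env.v4, abs_of_nonneg (by positivity)]
    norm_cast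
    exact hR.trans hRX
  set s₁ : State := _
  change Achieves X R _ s₁ _
  have hv₁ : ∀ u, u ≠ 10 → u ≠ 21 → s₁.var u = s.var u := fun u h1 h2 => by simp [s₁, h1, h2]
  have h10 : s₁.var 10 = ((K + 1) * (m + n + 1) : ℕ) := by
    simp [s₁, h.env.v1, h.env.v4, hK]
  have h21 : s₁.var 21 = K := by
    simp [s₁, h.env.v1, h.env.v4, hK]
  have ha₁ : s₁.arr = s.arr := rfl
  have ho₁ : s₁.out = [1, (m : ℤ), (((m + n + 1) + (m + n + 1) : ℕ) : ℤ)] := by simp [s₁]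
  clear_value s₁
  have henv₁ : Env m n (Fin.last (m + n)) (realUnknown G) inp s₁ := by
    refine h.env.congr (fun u hu => hv₁ u ?_ ?_) (by rw [ha₁]) <;>
    · rintro rfl; exact absurd hu (by decide)
  refine Achieves.seq (Achieves.fillMatrix (slotVector G D (gens (m + n + 1) s)) (by decide) h10
    hR (hR.trans hRX) ?_ ?_)
  · intro c l s' hu hv ha _
    have henv : Env m n (Fin.last (m + n)) (realUnknown G) inp s' := by
      refine henv₁.congr (fun u hu' => hu u ?_) (ha 0 (by decide))
      rintro rfl; exact absurd hu' (by decide)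
    refine ⟨?_, (abs_slotVector_le hr c l).trans hDX⟩
    rw [eval_slotEntry (D := D) (c := c) (l := l) henv
      (by rw [hu 6 (by decide), hv₁ 6 (by decide) (by decide), h.det])
      (by rw [hu 21 (by decide), h21]), gens_congr (s := s) (by rw [ha 5 (by decide), ha₁])]
    · rw [eval_div, eval_var, eval_var, henv.v4, hv, index_ediv]
    · rw [eval_mod, eval_var, eval_var, henv.v4, hv, index_emod]
  intro s₂ hu ha ho₂ hF
  have hW : ∀ (i : Fin m) (l : Fin (m + n + 1)),
      s₂.arr 4 ((unknown n i : ℕ) * (m + n + 1 : ℕ) + (l : ℕ)) = W (unknown n i) l := by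
    intro i l
    rw [ha 4 (by decide), ha₁, h.mat (unknown n i) l, updateRow_ne]
    exact Fin.castSucc_ne_last _
  have e1 : s₂.var 1 = m := by rw [hu 1 (by decide), henv₁.v1]
  have e4 : s₂.var 4 = (m + n + 1 : ℕ) := by rw [hu 4 (by decide), henv₁.v4]
  have e6 : s₂.var 6 = D := by
    rw [hu 6 (by decide), hv₁ 6 (by decide) (by decide), h.det]
  have e21 : s₂.var 21 = K := by rw [hu 21 (by decide), h21]
  have hentry : ∀ (i : Fin m) (c : Fin (K + 1)) (e f : Expr) (s' : State),
      s'.arr 4 = s₂.arr 4 → s'.arr 7 = s₂.arr 7 → s'.var 4 = s₂.var 4 → s'.var 6 = s₂.var 6 →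
      (∀ s'' : State, (∀ u, u ≠ 15 → u ≠ 16 → s''.var u = s'.var u) → e.eval s'' = (i : ℕ)) →
      (∀ s'' : State, (∀ u, u ≠ 15 → u ≠ 16 → s''.var u = s'.var u) → f.eval s'' = (c : ℕ)) →
      Achieves X R (emitEntry e f) s' fun s'' => s''.out = s'.out ++ encodeRat
        (((W (unknown n i) ⬝ᵥ slotVector G D (gens (m + n + 1) s) c : ℤ) : ℚ) / D) := by
    intro i c e f s' h4 h7 hv4 hv6 he hf
    exact achieves_emitEntry (i := unknown n i) (c := c) hC (hWB _)
      (fun l => (abs_slotVector_le hr c l).trans hDB) hD0 hDB (hv4.trans e4) (hv6.trans e6)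
      (fun l => by rw [h4]; exact hW i l) (hF.congr h7) he hf
  refine Achieves.seq (Achieves.outputLoop
    (fun i : Fin m => encodeRat (particularSolution D (gens (m + n + 1) s) W i))
    (by decide) (by decide) (by decide) e1 (by omega) (by omega) ?_ ?_)
  · intro i s' hf hv
    have := hentry i (Fin.last K) (.var 22) (.var 21) s' (hf.arr 4 (by decide))
      (hf.arr 7 (by decide)) (hf.var 4 (by decide)) (hf.var 6 (by decide))
      (fun s'' hs'' => by rw [eval_var, hs'' 22 (by decide) (by decide), hv])
      (fun s'' hs'' => by
        rw [eval_var, hs'' 21 (by decide) (by decide), hf.var 21 (by decide), e21, Fin.val_last])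
    rwa [slotVector, Fin.snoc_last] at this
  intro s₃ hf₃ ho₃
  refine Achieves.outputLoop
    (fun i : Fin m => encodeVec (kernelMatrix G D (gens (m + n + 1) s) W i))
    (by decide) (by decide) (by decide) (by rw [hf₃.var 1 (by decide), e1]) (by omega) (by omega)
    ?_ ?_
  · intro i s' hf hv
    refine Achieves.outputLoop
      (fun c => encodeRat (kernelMatrix G D (gens (m + n + 1) s) W i c))
      (by decide) (by decide) (by decide)
      (by rw [hf.var 21 (by decide), hf₃.var 21 (by decide), e21]) (by omega) (by omega) ?_
      (fun s'' _ ho => ho)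
    intro c s'' hf'' hv''
    have := hentry i c.castSucc (.var 22) (.var 23) s''
      (by rw [hf''.arr 4 (by decide), hf.arr 4 (by decide), hf₃.arr 4 (by decide)])
      (by rw [hf''.arr 7 (by decide), hf.arr 7 (by decide), hf₃.arr 7 (by decide)])
      (by rw [hf''.var 4 (by decide), hf.var 4 (by decide), hf₃.var 4 (by decide)])
      (by rw [hf''.var 6 (by decide), hf.var 6 (by decide), hf₃.var 6 (by decide)])
      (fun s₄ hs₄ => by
        rw [eval_var, hs₄ 22 (by decide) (by decide), hf''.var 22 (by decide), hv])
      (fun s₄ hs₄ => by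
        rw [eval_var, hs₄ 23 (by decide) (by decide), hv'', Fin.val_castSucc])
    rwa [slotVector, Fin.snoc_castSucc] at this
  · intro s' _ ho'
    rw [ho', ho₃, ho₂, ho₁]
    simp only [encodeSolution, encodeVec, encodeMat]

end Output

end LogRAM

namespace LogRAM

variable {X R : ℕ}

/-! ### Reading the input -/

/-- Compute the sizes of the system. -/
def setupSizes : Program :=
  .assign 1 (.get 0 0) ;; .assign 2 (.get 0 1) ;; .assign 3 (.var 1 + .var 2) ;;
  .assign 4 (.var 3 + 1) ;; .assign 5 (.var 4 + 1) ;; .assign 11 (.var 4 * .var 4) ;;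
  .assign 12 (.var 4 * .var 5) ;; .assign 8 (2 + 2 * .var 1 + 2 * .var 2) ;;
  .assign 10 (.var 2 * .var 1 + .var 2) ;; .assign 9 1

/-- Compute the common denominator. -/
def setupDenominator : Program :=
  forLoop 13 10 (.assign 9 (.var 9 * .get 0 (.var 8 + 2 * .var 13 + 1)))

/-- The numerator of the rational number at position `e` of the input, after multiplication by the
common denominator. -/
def numerator (e : Expr) : Expr :=
  .get 0 (.var 8 + 2 * e) * (.var 9 / .get 0 (.var 8 + 2 * e + 1))

/-- The coefficient of the unknown `i` in the equation `r`. -/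
def coefficient (r i : Expr) : Expr :=
  i.lt (.var 1) * numerator (r * .var 1 + i) -
  i.eq (.var 1 + r) * (.get 0 (3 + 2 * .var 1 + 2 * r) * .var 9) -
  i.eq (.var 3) * numerator (.var 2 * .var 1 + r)

/-- Write down the equations. -/
def setupMatrix : Program :=
  .assign 10 (.var 2 * .var 4) ;;
  fillLoop 13 10 1 0 (coefficient (.var 13 / .var 4) (.var 13 % .var 4))

/-- Prepare the memory for the elimination. -/
def setup : Program := setupSizes ;; setupDenominator ;; setupMatrix

section Setup

variable {m n : ℕ} (G : Fin m → Primitive) (H : Fin n → Primitive) (A : Matrix (Fin n) (Fin m) ℚ)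
  (b : Fin n → ℚ)

theorem input_isReal (i : Fin (m + n + 1)) :
    (if ((i : ℕ) : ℤ) < m then 1 else 0) *
      (inputCell (encodeSystem G H A b) (2 + 2 * (i : ℕ)) % 2) =
    if realUnknown G i then 1 else 0 := by
  by_cases hi : (i : ℕ) < m
  · have hi' : ((i : ℕ) : ℤ) < m := by exact_mod_cast hi
    have key : ∀ z, (G ⟨i, hi⟩).encode[0]? = some z →
        inputCell (encodeSystem G H A b) (2 + 2 * (i : ℕ)) = z := by
      intro z hz
      rw [← input_group G H A b ⟨i, hi⟩ two_pos hz]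
      congr 1
      push_cast
      ring
    have hr : realUnknown G i ↔ (G ⟨i, hi⟩).IsReal := by simp [realUnknown, hi]
    simp only [if_pos hi', hr, one_mul]
    cases hG : G ⟨i, hi⟩ <;> rw [hG] at key <;> rw [key _ rfl] <;> simp [Primitive.IsReal]
  · have hi' : ¬ ((i : ℕ) : ℤ) < m := by exact_mod_cast hi
    have hr : ¬ realUnknown G i := by simp [realUnknown, hi]
    rw [if_neg hi', if_neg hr, zero_mul]

theorem input_mat_num (r : Fin n) (i : Fin m) : inputCell (encodeSystem G H A b)
    (2 + 2 * m + 2 * n + 2 * ((r : ℕ) * m + (i : ℕ))) = (A r i).num := by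
  rw [← input_mat G H A b r i two_pos rfl]
  congr 1; push_cast; ring

theorem input_mat_den (r : Fin n) (i : Fin m) : inputCell (encodeSystem G H A b)
    (2 + 2 * m + 2 * n + 2 * ((r : ℕ) * m + (i : ℕ)) + 1) = (A r i).den := by
  rw [← input_mat G H A b r i one_lt_two rfl]
  congr 1; push_cast; ring

theorem input_vec_num (r : Fin n) : inputCell (encodeSystem G H A b)
    (2 + 2 * m + 2 * n + 2 * (n * m + (r : ℕ))) = (b r).num := by
  rw [← input_vec G H A b r two_pos rfl]
  congr 1; push_cast; ring

theorem input_vec_den (r : Fin n) : inputCell (encodeSystem G H A b)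
    (2 + 2 * m + 2 * n + 2 * (n * m + (r : ℕ)) + 1) = (b r).den := by
  rw [← input_vec G H A b r one_lt_two rfl]
  congr 1; push_cast; ring

/-- The denominators, in the order of the input. -/
theorem exists_denominators : ∃ g : ℕ → ℕ,
    (∀ k < n * m + n, 1 ≤ g k ∧ inputCell (encodeSystem G H A b)
      (2 + 2 * m + 2 * n + 2 * k + 1) = g k) ∧
    ∏ k ∈ Finset.range (n * m + n), g k = commonDen A b := by
  set g : ℕ → ℕ := fun k => (inputCell (encodeSystem G H A b)
      (2 + 2 * m + 2 * n + 2 * k + 1)).toNat with hg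
  have h1 : ∀ (r : Fin n) (i : Fin m), g (r * m + i) = (A r i).den := by
    intro r i
    simp only [hg]
    push_cast
    rw [input_mat_den, Int.toNat_natCast]
  have h2 : ∀ r : Fin n, g (n * m + r) = (b r).den := by
    intro r
    simp only [hg]
    push_cast
    rw [input_vec_den, Int.toNat_natCast]
  refine ⟨g, fun k hk => ?_, ?_⟩
  · have h3 : ∀ d : ℕ, inputCell (encodeSystem G H A b)
        (2 + 2 * m + 2 * n + 2 * k + 1) = d → 1 ≤ d → 1 ≤ g k ∧ inputCell (encodeSystem G H A b)
        (2 + 2 * m + 2 * n + 2 * k + 1) = g k := by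
      intro d hd h1
      simp only [hg, hd, Int.toNat_natCast, and_true, h1]
    by_cases hkm : k < n * m
    · obtain ⟨r, i, rfl⟩ := exists_index hkm
      exact h3 _ (by push_cast; exact input_mat_den G H A b r i) (A r i).den_pos
    · obtain ⟨j, rfl⟩ := Nat.exists_eq_add_of_le (not_lt.1 hkm)
      exact h3 _ (by push_cast; exact input_vec_den G H A b ⟨j, by omega⟩) (Rat.den_pos _)
  · rw [Finset.prod_range_add, commonDen, Finset.prod_range, Finset.prod_range]
    congr 1
    · rw [← Fintype.prod_prod_type']
      refine (Fintype.prod_equiv finProdFinEquiv _ _ fun x => ?_).symm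
      rw [← h1]
      congr 1
      simp [finProdFinEquiv]
      ring
    · exact Finset.prod_congr rfl fun r _ => h2 r

/-- The memory after the sizes have been computed. -/
structure Sizes (s : State) : Prop where
  env : Env m n (Fin.last (m + n)) (realUnknown G) (inputCell (encodeSystem G H A b)) s
  v8 : s.var 8 = 2 + 2 * m + 2 * n

theorem achieves_setupSizes (hX : (m + n + 2) * (m + n + 2) ≤ X) :
    Achieves X R setupSizes (initial (encodeSystem G H A b)) fun s => Sizes G H A b s ∧
      s.var 10 = (n * m + n : ℕ) ∧ s.var 9 = 1 := by
  have hm := input_m G H A b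
  have hn := input_n G H A b
  set inp := inputCell (encodeSystem G H A b) with hinp
  set s := initial (encodeSystem G H A b) with hs
  have h0 : s.arr 0 = inp := by
    funext k; simp [hs, initial, hinp, inputCell]
  clear_value s
  have hX' : ((m : ℤ) + n + 2) * (m + n + 2) ≤ X := by exact_mod_cast hX
  have hm0 : (0 : ℤ) ≤ m := by positivity
  have hn0 : (0 : ℤ) ≤ n := by positivity
  have hmn : (0 : ℤ) ≤ m * n := by positivity
  have assign : ∀ {i : ℕ} {e : Expr} {s : State} {Q : State → Prop} (z : ℤ), e.eval s = z →
      0 ≤ z ∧ z ≤ (m + n + 2) * (m + n + 2) →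
      Q { s with var := Function.update s.var i z } → Achieves X R (.assign i e) s Q := by
    rintro i e s Q z rfl hz hQ
    exact Achieves.assign (by rw [abs_of_nonneg hz.1]; exact hz.2.trans hX') hQ
  refine Achieves.seq (assign m (by simp [h0, hm]) ⟨by positivity, by nlinarith⟩ ?_)
  refine Achieves.seq (assign n (by simp [h0, hn]) ⟨by positivity, by nlinarith⟩ ?_)
  refine Achieves.seq (assign (m + n) (by simp) ⟨by positivity, by nlinarith⟩ ?_)
  refine Achieves.seq (assign (m + n + 1) (by simp) ⟨by positivity, by nlinarith⟩ ?_)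
  refine Achieves.seq (assign (m + n + 1 + 1) (by simp) ⟨by positivity, by nlinarith⟩ ?_)
  refine Achieves.seq (assign ((m + n + 1) * (m + n + 1)) (by simp)
    ⟨by positivity, by nlinarith⟩ ?_)
  refine Achieves.seq (assign ((m + n + 1) * (m + n + 1 + 1)) (by simp)
    ⟨by positivity, by nlinarith⟩ ?_)
  refine Achieves.seq (assign (2 + 2 * m + 2 * n) (by simp) ⟨by positivity, by nlinarith⟩ ?_)
  refine Achieves.seq (assign (n * m + n) (by simp) ⟨by positivity, by nlinarith⟩ ?_)
  refine assign 1 (by simp) ⟨by positivity, by nlinarith⟩ ?_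
  refine ⟨⟨⟨?_, ?_, ?_, ?_, ?_, ?_, ?_, ?_, input_isReal G H A b⟩, ?_⟩, ?_, ?_⟩ <;> simp [h0, hinp]

theorem achieves_setupDenominator {s : State} (h : Sizes G H A b s)
    (h10 : s.var 10 = (n * m + n : ℕ)) (h9 : s.var 9 = 1) (hR : n * m + n ≤ R) (hRX : R ≤ X)
    (hX : commonDen A b ≤ X) :
    Achieves X R setupDenominator s fun s => Sizes G H A b s ∧ s.var 9 = commonDen A b := by
  obtain ⟨g, hg, hprod⟩ := exists_denominators G H A b
  refine Achieves.forLoop (n * m + n) (fun k s' => s'.var 9 = ∏ i ∈ Finset.range k, (g i : ℤ))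
    (by decide) (by decide) (by decide) h10 hR (hR.trans hRX) (by simpa using h9) ?_ ?_
  · intro k hk s' hf hv hp
    have h8 : s'.var 8 = 2 + 2 * m + 2 * n := by rw [hf.var 8 (by decide), h.v8]
    have ha : s'.arr 0 = inputCell (encodeSystem G H A b) := by
      rw [hf.arr 0 (by decide), h.env.a0]
    have e : (Expr.var 9 * .get 0 (.var 8 + 2 * .var 13 + 1)).eval s' =
        ∏ i ∈ Finset.range (k + 1), (g i : ℤ) := by
      simp only [eval_mul, eval_var, eval_get, eval_add, eval_ofNat, eval_one, h8, hv, ha, hp]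
      rw [(hg k hk).2, Finset.prod_range_succ]
    refine Achieves.assign ?_ ?_
    · rw [e, abs_of_nonneg (by positivity)]
      -- the partial products are bounded by the whole product
      refine le_trans ?_ (show ((commonDen A b : ℕ) : ℤ) ≤ X by exact_mod_cast hX)
      rw [← hprod]
      norm_cast
      refine Finset.prod_le_prod_of_subset_of_one_le' (Finset.range_subset_range.2 hk) ?_
      intro i hi _
      exact (hg i (Finset.mem_range.1 hi)).1
    · rw [e]; simp
  · intro s' hf _ hp
    refine ⟨⟨h.env.frame hf (by decide) (by decide), by rw [hf.var 8 (by decide), h.v8]⟩, ?_⟩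
    rw [hp, ← hprod]; push_cast; rfl

theorem eval_coefficient {s : State} (h : Sizes G H A b s) (h9 : s.var 9 = commonDen A b)
    {e f : Expr} {r : Fin n} {i : Fin (m + n + 1)} (he : e.eval s = (r : ℕ))
    (hf : f.eval s = (i : ℕ)) :
    (coefficient e f).eval s = systemMatrix H A b (commonDen A b) r i := by
  have hr := r.2
  have hi := i.2
  have h3 := h.env.v3
  rw [Fin.val_last] at h3
  simp only [coefficient, numerator, eval_add, eval_mul, eval_lt, eval_eq, eval_sub, eval_get,
    eval_div, eval_var, eval_one, eval_ofNat, he, hf, h.env.v1, h.env.v2, h3, h9, h.v8, h.env.a0,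
    input_vec_num, input_vec_den]
  have hchar : inputCell (encodeSystem G H A b) (3 + 2 * m + 2 * (r : ℕ)) = (H r).char := by
    rw [← input_char G H A b r]
    congr 1; push_cast; ring
  rw [hchar]
  simp only [systemMatrix]
  by_cases h1 : (i : ℕ) < m
  · have hmat := input_mat_num G H A b r ⟨i, h1⟩
    have hden := input_mat_den G H A b r ⟨i, h1⟩
    simp only at hmat hden
    rw [dif_pos h1, hmat, hden, if_pos (by exact_mod_cast h1),
      if_neg (show ¬ ((i : ℕ) : ℤ) = m + (r : ℕ) by omega),
      if_neg (show ¬ ((i : ℕ) : ℤ) = (m + n : ℕ) by omega)]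
    ring
  · rw [dif_neg h1, if_neg (show ¬ ((i : ℕ) : ℤ) < m by omega)]
    by_cases h2 : (i : ℕ) = m + r
    · rw [if_pos h2, if_pos (show ((i : ℕ) : ℤ) = m + (r : ℕ) by omega),
        if_neg (show ¬ ((i : ℕ) : ℤ) = (m + n : ℕ) by omega)]
      ring
    · rw [if_neg h2, if_neg (show ¬ ((i : ℕ) : ℤ) = m + (r : ℕ) by omega)]
      by_cases h3 : (i : ℕ) = m + n
      · rw [if_pos h3, if_pos (show ((i : ℕ) : ℤ) = (m + n : ℕ) by omega)]
        ring
      · rw [if_neg h3, if_neg (show ¬ ((i : ℕ) : ℤ) = (m + n : ℕ) by omega)]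
        ring

theorem achieves_setupMatrix {s : State} (h : Sizes G H A b s) (h9 : s.var 9 = commonDen A b)
    (hR : n * (m + n + 1) ≤ R) (hRX : R ≤ X)
    (hX : ∀ r i, |systemMatrix H A b (commonDen A b) r i| ≤ X) :
    Achieves X R setupMatrix s fun s' => Sizes G H A b s' ∧
      Stores 1 (systemMatrix H A b (commonDen A b)) s' := by
  have e : (Expr.var 2 * .var 4).eval s = (n * (m + n + 1) : ℕ) := by
    rw [eval_mul, eval_var, eval_var, h.env.v2, h.env.v4]; push_cast; rfl
  refine Achieves.seq (Achieves.assign ?_ ?_)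
  · rw [e, abs_of_nonneg (by positivity)]; exact_mod_cast hR.trans hRX
  rw [e]
  set s₁ : State := _
  change Achieves X R _ s₁ _
  have h₁ : Sizes G H A b s₁ := ⟨h.env.update (by decide) _, by simpa [s₁] using h.v8⟩
  have h9₁ : s₁.var 9 = commonDen A b := by simpa [s₁] using h9
  have h10₁ : s₁.var 10 = (n * (m + n + 1) : ℕ) := by simp [s₁]
  clear_value s₁
  have key : ∀ s' : State, (∀ u, u ≠ 13 → s'.var u = s₁.var u) →
      (∀ a, a ≠ 1 → s'.arr a = s₁.arr a) → Sizes G H A b s' := by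
    intro s' hu ha
    refine ⟨h₁.env.congr (fun u hu' => hu u ?_) (ha 0 (by decide)), by rw [hu 8 (by decide), h₁.v8]⟩
    rintro rfl; exact absurd hu' (by decide)
  refine Achieves.fillMatrix (systemMatrix H A b (commonDen A b)) (by decide) h10₁ hR
    (hR.trans hRX) ?_ ?_
  · intro r i s' hu hv ha _
    have hs' := key s' hu ha
    refine ⟨eval_coefficient G H A b hs' (by rw [hu 9 (by decide), h9₁]) ?_ ?_, hX r i⟩
    · rw [eval_div, eval_var, eval_var, hs'.env.v4, hv, index_ediv]
    · rw [eval_mod, eval_var, eval_var, hs'.env.v4, hv, index_emod]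
  · intro s' hu ha _ hM
    exact ⟨key s' hu ha, hM⟩

theorem achieves_setup (hR : (m + n + 2) * (m + n + 2) ≤ R) (hRX : R ≤ X)
    (hX : commonDen A b ≤ X) (hM : ∀ r i, |systemMatrix H A b (commonDen A b) r i| ≤ X) :
    Achieves X R setup (initial (encodeSystem G H A b)) fun s =>
      Env m n (Fin.last (m + n)) (realUnknown G) (inputCell (encodeSystem G H A b)) s ∧
      Stores 1 (systemMatrix H A b (commonDen A b)) s := by
  refine Achieves.seq ((achieves_setupSizes G H A b (hR.trans hRX)).mono ?_)
  rintro s₁ - ⟨h₁, h10, h9⟩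
  refine Achieves.seq ((achieves_setupDenominator G H A b h₁ h10 h9 (by nlinarith) hRX hX).mono ?_)
  rintro s₂ - ⟨h₂, h9₂⟩
  refine (achieves_setupMatrix G H A b h₂ h9₂ (by nlinarith) hRX hM).mono ?_
  rintro s₃ - ⟨h₃, hM₃⟩
  exact ⟨h₃.env, hM₃⟩

end Setup

end LogRAM

namespace LogRAM

variable {X R : ℕ}

/-! ### The two algorithms -/

/-- Compute the matrix `W`, the determinant `D` and the lattice generators. -/
def prepare : Program := setup ;; elimination ;; latticeProgram

/-- The solvability criterion: the elimination found no contradiction, and the greatest common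
divisor of the last coordinates of the lattice vectors is `1`. -/
def solvable : Expr := (Expr.var 7).eq 0 * (Expr.get 5 (.var 12 + .var 4)).eq 1

/-- The program that decides solvability. -/
def decider : Program := prepare ;; .emit solvable

/-- The program that computes a general solution. -/
def solver : Program := prepare ;; .branch solvable outputSolution (.emit 0)

section Algorithms

variable {m n : ℕ} {G : Fin m → Primitive} {H : Fin n → Primitive} {A : Matrix (Fin n) (Fin m) ℚ}
  {b : Fin n → ℚ} {μ : ℤ}

/-- The memory after the system has been brought into solved form. -/
structure Prepared (G : Fin m → Primitive) (H : Fin n → Primitive) (A : Matrix (Fin n) (Fin m) ℚ)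
    (b : Fin n → ℚ) (μ : ℤ) (W : Matrix (Fin (m + n + 1)) (Fin (m + n + 1)) ℤ) (s : State) :
    Prop where
  elim : Elimination (systemMatrix H A b (commonDen A b)) (realUnknown G) (Fin.last (m + n)) μ
    (fun _ => True) W (s.var 6) (s.var 7 ≠ 0)
  lattice : LatticeState m n (Fin.last (m + n)) (realUnknown G)
    (inputCell (encodeSystem G H A b)) W (s.var 6) (m + n + 1) s
  residues : Residues (s.var 6)
    (IntegralOn W (realUnknown G) (Fin.last (m + n)) (s.var 6) (· ≠ Fin.last (m + n)))
    (Pi.single (Fin.last (m + n)) 1) (Fin.last _) (gens (m + n + 1) s) (residue (m + n + 1) s)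
  zero : ZeroResidues (m + n + 1) s
  out : s.out = []

theorem achieves_prepare (hC : Capacity X R n (m + n + 1) μ) (hX : commonDen A b ≤ X)
    (hM : ∀ r i, |systemMatrix H A b (commonDen A b) r i| ≤ μ) :
    Achieves X R prepare (initial (encodeSystem G H A b)) fun s =>
      ∃ W, Prepared G H A b μ W s := by
  refine Achieves.mono (Q := fun s => ∃ W, s.out = [] → Prepared G H A b μ W s) ?_
    fun s hf ⟨W, hs⟩ => ⟨W, hs ?_⟩
  swap
  · rw [hf.out rfl]; rfl
  have hqr := not_realUnknown_last (n := n) G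
  refine Achieves.seq ((achieves_setup G H A b hC.sq_le hC.R_le hX
    fun r i => (hM r i).trans (hC.le_detBound.trans hC.detBound_le)).mono ?_)
  rintro s₁ - ⟨h₁, hM₁⟩
  refine Achieves.seq ((achieves_elimination hC hM (by simp) hqr h₁ hM₁).mono ?_)
  rintro s₂ - ⟨W, hW⟩
  have hE : Elimination (systemMatrix H A b (commonDen A b)) (realUnknown G) (Fin.last (m + n)) μ
      (fun _ => True) W (s₂.var 6) (s₂.var 7 ≠ 0) := by
    convert hW.elim using 2 with r
    simp [r.2]
  refine (achieves_latticeProgram hC (by simp) hqr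
    (fun i l => by simpa using hE.abs_entry_le hC.one_le i l) hE.pos (by simpa using hE.abs_le)
    hW.env hW.mat (fun l hl => by rw [hE.kept, if_neg hl]) rfl).mono ?_
  rintro s₃ hf ⟨h₃, hr, hz⟩
  have e6 : s₃.var 6 = s₂.var 6 := h₃.det
  have e7 : s₃.var 7 = s₂.var 7 := hf.var 7 (by decide)
  refine ⟨W, fun ho => ⟨?_, ?_, ?_, hz, ho⟩⟩
  · rw [e6, e7]; exact hE
  · rw [e6]; exact h₃
  · rw [e6]; exact hr

theorem Prepared.eval_solvable {W : Matrix (Fin (m + n + 1)) (Fin (m + n + 1)) ℤ} {s : State}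
    (h : Prepared G H A b μ W s) : solvable.eval s =
      if ¬ s.var 7 ≠ 0 ∧ residue (m + n + 1) s (Fin.last _) = 1 then 1 else 0 := by
  simp only [solvable, eval_mul, eval_eq, eval_var, eval_get, eval_add, eval_zero, eval_one,
    h.lattice.env.v4, h.lattice.env.v12, residue, Fin.val_last]
  push_cast
  by_cases h7 : s.var 7 = 0 <;> simp [h7]

theorem Prepared.solvable_iff {W : Matrix (Fin (m + n + 1)) (Fin (m + n + 1)) ℤ} {s : State}
    (h : Prepared G H A b μ W s) {φ : ElementaryGroup G →ₜ+ ElementaryGroup H}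
    {y : ElementaryGroup H} (hφ : IsMatrixRep φ (A.map fun q : ℚ => (q : ℝ)))
    (hy : TupleCongr H (fun j => (b j : ℝ)) y) :
    (¬ s.var 7 ≠ 0 ∧ residue (m + n + 1) s (Fin.last _) = 1) ↔ ∃ x, φ x = y := by
  rw [exists_apply_eq_iff (commonDen_ne_zero A b) (den_dvd_commonDen A b) (den_dvd_commonDen' A b)
    hφ hy]
  exact h.elim.exists_solution_iff (not_realUnknown_last G) h.residues h.zero

theorem achieves_decider (hC : Capacity X R n (m + n + 1) μ) (hX : commonDen A b ≤ X)
    (hM : ∀ r i, |systemMatrix H A b (commonDen A b) r i| ≤ μ)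
    {φ : ElementaryGroup G →ₜ+ ElementaryGroup H}
    {y : ElementaryGroup H} (hφ : IsMatrixRep φ (A.map fun q : ℚ => (q : ℝ)))
    (hy : TupleCongr H (fun j => (b j : ℝ)) y) :
    Achieves X R decider (initial (encodeSystem G H A b)) fun s =>
      ((∃ x, φ x = y) → s.out = [1]) ∧ ((¬ ∃ x, φ x = y) → s.out = [0]) := by
  refine Achieves.seq ((achieves_prepare hC hX hM).mono ?_)
  rintro s - ⟨W, h⟩
  refine Achieves.emit ?_
  have hs := h.solvable_iff hφ hy
  simp only [h.eval_solvable, h.out, List.nil_append]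
  exact ⟨fun hx => by rw [if_pos (hs.2 hx)], fun hx => by
    rw [if_neg (hs.not.2 hx)]⟩

theorem achieves_solver (hC : Capacity X R n (m + n + 1) μ) (hX : commonDen A b ≤ X)
    (hM : ∀ r i, |systemMatrix H A b (commonDen A b) r i| ≤ μ)
    (hR : (m + ((m + n + 1) + (m + n + 1)) + 1) * (m + n + 1) ≤ R)
    {φ : ElementaryGroup G →ₜ+ ElementaryGroup H}
    {y : ElementaryGroup H} (hφ : IsMatrixRep φ (A.map fun q : ℚ => (q : ℝ)))
    (hy : TupleCongr H (fun j => (b j : ℝ)) y) :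
    Achieves X R solver (initial (encodeSystem G H A b)) fun s =>
      ((∃ x, φ x = y) → ∃ (r k : ℕ) (x₀ : Fin m → ℚ) (E : Matrix (Fin m) (Fin (r + k)) ℚ)
        (g₀ : ElementaryGroup G) (ε : ElementaryGroup (realIntFactors r k) →ₜ+ ElementaryGroup G),
        IsGeneralSolution φ y g₀ ε ∧ TupleCongr G (fun i => (x₀ i : ℝ)) g₀ ∧
        IsMatrixRep ε (E.map fun q : ℚ => (q : ℝ)) ∧ s.out = encodeSolution x₀ E) ∧
      ((¬ ∃ x, φ x = y) → s.out = [0]) := by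
  refine Achieves.seq ((achieves_prepare hC hX hM).mono ?_)
  rintro s - ⟨W, h⟩
  have hs := h.solvable_iff hφ hy
  refine Achieves.branch (fun he => ?_) (fun he => Achieves.emit ?_)
  · rw [h.eval_solvable, ite_ne_right_iff] at he
    have hx := hs.1 he.1
    obtain ⟨g₀, ε, h1, h2, h3⟩ := exists_isGeneralSolution (commonDen_ne_zero A b)
      (den_dvd_commonDen A b) (den_dvd_commonDen' A b) hφ hy h.elim h.residues h.zero he.1.1 he.1.2
    refine (achieves_outputSolution hC hR
      (fun i l => by simpa using h.elim.abs_entry_le hC.one_le i l) (by simpa using h.elim.abs_le)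
      h.lattice h.residues h.out).mono fun s' _ ho => ⟨fun _ => ?_, fun hn => absurd hx hn⟩
    exact ⟨_, _, _, _, g₀, ε, h1, h2, h3, ho⟩
  · have hx : ¬ ∃ x, φ x = y := by
      rw [← hs]
      intro hx
      rw [h.eval_solvable, if_pos hx] at he
      exact one_ne_zero he
    exact ⟨fun h' => absurd h' hx, fun _ => by simp [h.out]⟩

end Algorithms

/-! ### The bound for the running time -/

/-- All memory cells are bounded by the power of two with exponent `capacity m n a v c d`, where `a`,
`v`, `c` and `d` are the bit lengths of the matrix, the right hand side and the characteristics. The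
first three summands account for the products of two determinants, `c` for the characteristics of
`G`, and the sum in parentheses for the indices of the arrays and the length of the input. The
definition is generic, because it serves for numbers and for polynomials. -/
def capacity {S : Type*} [CommSemiring S] (m n a v c d : S) : S :=
  (m + n + 1) + 2 * (m + n + 1) * (m + n + 1) +
    2 * (m + n + 1) * ((n * m + n + 1) * (a + v + d)) + c +
    (n + (m + n + 2) * (m + n + 2) + (m + ((m + n + 1) + (m + n + 1)) + 1) * (m + n + 1) +
      (2 + m * 2 + n * 2 + n * (m * 2) + n * 2)) + 5

theorem natAbs_num_le (q : ℚ) : q.num.natAbs ≤ 2 ^ ratBits q :=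
  (Nat.lt_size_self _).le.trans (Nat.pow_le_pow_right two_pos (Nat.le_add_right _ _))

theorem den_le (q : ℚ) : q.den ≤ 2 ^ ratBits q :=
  (Nat.lt_size_self _).le.trans (Nat.pow_le_pow_right two_pos (Nat.le_add_left _ _))

section Bounds

variable {m n : ℕ} (G : Fin m → Primitive) (H : Fin n → Primitive) (A : Matrix (Fin n) (Fin m) ℚ)
  (b : Fin n → ℚ)

theorem ratBits_le_vecBits (r : Fin n) : ratBits (b r) ≤ vecBits b :=
  Finset.le_sup (f := fun j => ratBits (b j)) (Finset.mem_univ r)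

theorem ratBits_le_matBits (r : Fin n) (i : Fin m) : ratBits (A r i) ≤ matBits A :=
  (ratBits_le_vecBits (A r) i).trans
    (Finset.le_sup (f := fun i => vecBits (A i)) (Finset.mem_univ r))

theorem char_le (i : Fin m) : (G i).char ≤ 2 ^ charBits G :=
  (Nat.lt_size_self _).le.trans (Nat.pow_le_pow_right two_pos
    (Finset.le_sup (f := fun i => Nat.size (G i).char) (Finset.mem_univ i)))

theorem commonDen_le : commonDen A b ≤ 2 ^ ((n * m + n) * (matBits A + vecBits b)) := by
  have hA : ∀ r i, (A r i).den ≤ 2 ^ (matBits A + vecBits b) := fun r i =>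
    (den_le _).trans (Nat.pow_le_pow_right two_pos
      ((ratBits_le_matBits A r i).trans (Nat.le_add_right _ _)))
  have hb : ∀ r, (b r).den ≤ 2 ^ (matBits A + vecBits b) := fun r =>
    (den_le _).trans (Nat.pow_le_pow_right two_pos
      ((ratBits_le_vecBits b r).trans (Nat.le_add_left _ _)))
  have h1 : ∏ r, ∏ i, (A r i).den ≤ ∏ _r : Fin n, ∏ _i : Fin m, 2 ^ (matBits A + vecBits b) :=
    Finset.prod_le_prod' fun r _ => Finset.prod_le_prod' fun i _ => hA r i
  have h2 : ∏ r, (b r).den ≤ ∏ _r : Fin n, 2 ^ (matBits A + vecBits b) :=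
    Finset.prod_le_prod' fun r _ => hb r
  refine (Nat.mul_le_mul h1 h2).trans (le_of_eq ?_)
  simp only [Finset.prod_const, Finset.card_univ, Fintype.card_fin]
  ring

theorem abs_systemMatrix_le (r : Fin n) (i : Fin (m + n + 1)) :
    |systemMatrix H A b (commonDen A b) r i| ≤
      2 ^ ((n * m + n + 1) * (matBits A + vecBits b + charBits H)) := by
  have hΔ := commonDen_le A b
  set B := matBits A + vecBits b + charBits H with hB
  have hΔ' : commonDen A b ≤ 2 ^ ((n * m + n) * B) := hΔ.trans (Nat.pow_le_pow_right two_pos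
    (Nat.mul_le_mul_left _ (Nat.le_add_right _ _)))
  have key : ∀ x e : ℕ, x ≤ 2 ^ B → e ≤ commonDen A b →
      ((x * e : ℕ) : ℤ) ≤ 2 ^ ((n * m + n + 1) * B) := by
    intro x e hx he
    have := Nat.mul_le_mul hx (he.trans hΔ')
    rw [← pow_add, show B + (n * m + n) * B = (n * m + n + 1) * B by ring] at this
    exact_mod_cast this
  have hq : ∀ q : ℚ, ratBits q ≤ B →
      |q.num * ((commonDen A b : ℤ) / q.den)| ≤ 2 ^ ((n * m + n + 1) * B) := by
    intro q hq
    have := key q.num.natAbs (commonDen A b / q.den)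
      ((natAbs_num_le q).trans (Nat.pow_le_pow_right two_pos hq)) (Nat.div_le_self _ _)
    rw [abs_mul]
    rw [Nat.cast_mul, Int.natCast_natAbs, Int.natCast_ediv] at this
    rwa [abs_of_nonneg (show (0 : ℤ) ≤ (commonDen A b : ℤ) / q.den by positivity)]
  unfold systemMatrix
  split_ifs
  · exact hq _ ((ratBits_le_matBits A _ _).trans (by omega))
  · rw [abs_neg, abs_of_nonneg (by positivity)]
    exact_mod_cast key _ _ ((char_le H r).trans (Nat.pow_le_pow_right two_pos (by omega))) le_rfl
  · rw [abs_neg]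
    exact hq _ ((ratBits_le_vecBits b r).trans (by omega))
  · simp

theorem three_mul_add_le_two_pow {k : ℕ} (hk : 5 ≤ k) : 3 * k + 3 ≤ 2 ^ k := by
  induction k, hk using Nat.le_induction with
  | base => norm_num
  | succ k hk ih => rw [pow_succ]; omega

/-- If the coefficients have at most `L` bits, numbers with `β` bits suffice, where `β` is polynomial
in `m`, `n` and `L`, and loops need only `3 * β + 3` iterations. -/
theorem capacity_spec {m n L β : ℕ}
    (h1 : (m + n + 1) + 2 * (m + n + 1) * (m + n + 1) + 2 * (m + n + 1) * L ≤ β) (h5 : 5 ≤ β)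
    (hn : n ≤ β) (hN : (m + n + 2) * (m + n + 2) ≤ β) :
    Capacity (2 ^ β) (3 * β + 3) n (m + n + 1) (2 ^ L) where
  one_le := one_le_pow₀ (by norm_num)
  pos := by omega
  n_le := by omega
  sq_le := by simp only [add_assoc, Nat.reduceAdd] at hN ⊢; omega
  R_le := three_mul_add_le_two_pow h5
  le_X := by
    set N := m + n + 1
    have h2 : N ≤ 2 ^ N := Nat.lt_two_pow_self.le
    have h3 : N.factorial ≤ 2 ^ (N * N) := by
      rw [pow_mul]; exact (Nat.factorial_le_pow N).trans (Nat.pow_le_pow_left h2 N)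
    have h4 : N.factorial * (2 ^ L) ^ N ≤ 2 ^ (N * N + L * N) := by
      rw [pow_add 2 (N * N), pow_mul 2 L]; exact Nat.mul_le_mul_right _ h3
    have h6 : N * ((N.factorial * (2 ^ L) ^ N) * (N.factorial * (2 ^ L) ^ N)) ≤ 2 ^ β := by
      refine (Nat.mul_le_mul h2 (Nat.mul_le_mul h4 h4)).trans ?_
      rw [← pow_add, ← pow_add]
      refine Nat.pow_le_pow_right two_pos (le_trans (le_of_eq ?_) h1)
      ring
    unfold detBound
    exact_mod_cast h6
  euclid := by rw [Nat.size_pow]; omega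

theorem abs_le_of_mem_encodeSystem {z : ℤ} (hz : z ∈ encodeSystem G H A b) :
    |z| ≤ 2 ^ (m + n + 2 + (matBits A + vecBits b + charBits G + charBits H)) := by
  have hpow : ∀ {k e : ℕ}, k ≤ 2 ^ e →
      e ≤ m + n + 2 + (matBits A + vecBits b + charBits G + charBits H) →
      (k : ℤ) ≤ 2 ^ (m + n + 2 + (matBits A + vecBits b + charBits G + charBits H)) := by
    intro k e hk he
    exact_mod_cast hk.trans (Nat.pow_le_pow_right two_pos he)
  have hrat : ∀ q : ℚ, ratBits q ≤
      m + n + 2 + (matBits A + vecBits b + charBits G + charBits H) → z ∈ encodeRat q →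
      |z| ≤ 2 ^ (m + n + 2 + (matBits A + vecBits b + charBits G + charBits H)) := by
    intro q hq hz
    simp only [encodeRat, List.mem_cons, List.not_mem_nil, or_false] at hz
    rcases hz with rfl | rfl
    · rw [Int.abs_eq_natAbs]; exact hpow (natAbs_num_le q) hq
    · rw [Nat.abs_cast]; exact hpow (den_le q) hq
  have hprim : ∀ P : Primitive, P.char ≤ 2 ^ (charBits G + charBits H) → z ∈ P.encode →
      |z| ≤ 2 ^ (m + n + 2 + (matBits A + vecBits b + charBits G + charBits H)) := by
    intro P hP hz
    have h3 : z = P.char ∨ (0 ≤ z ∧ z ≤ 3) := by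
      cases P <;> simp only [Primitive.encode, Primitive.char, List.mem_cons, List.not_mem_nil,
        or_false] at hz ⊢ <;> rcases hz with rfl | rfl <;> simp
    rcases h3 with rfl | h3
    · rw [Nat.abs_cast]; exact hpow hP (by omega)
    · rw [abs_of_nonneg h3.1]
      exact h3.2.trans (hpow (k := 3) (e := 2) (by norm_num) (by omega))
  simp only [encodeSystem, encodeGroup, encodeMat, encodeVec, List.mem_append, List.mem_flatten,
    List.mem_ofFn, List.mem_cons, List.not_mem_nil, or_false] at hz
  rcases hz with (((((rfl | rfl) | ⟨_, ⟨i, rfl⟩, hz⟩) | ⟨_, ⟨i, rfl⟩, hz⟩) |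
    ⟨_, ⟨r, rfl⟩, hz⟩) | ⟨_, ⟨r, rfl⟩, hz⟩)
  · rw [Nat.abs_cast]; exact hpow Nat.lt_two_pow_self.le (by omega)
  · rw [Nat.abs_cast]; exact hpow Nat.lt_two_pow_self.le (by omega)
  · exact hprim _ ((char_le G i).trans (Nat.pow_le_pow_right two_pos (by omega))) hz
  · exact hprim _ ((char_le H i).trans (Nat.pow_le_pow_right two_pos (by omega))) hz
  · simp only [List.mem_flatten, List.mem_ofFn] at hz
    obtain ⟨_, ⟨i, rfl⟩, hz⟩ := hz
    exact hrat _ ((ratBits_le_matBits A r i).trans (by omega)) hz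
  · exact hrat _ ((ratBits_le_vecBits b r).trans (by omega)) hz

theorem bounded_initial {β : ℕ}
    (h1 : m + n + 2 + (matBits A + vecBits b + charBits G + charBits H) ≤ β)
    (h2 : 2 + m * 2 + n * 2 + n * (m * 2) + n * 2 ≤ β) :
    Bounded (2 ^ β) (initial (encodeSystem G H A b)) := by
  have hlen : (encodeSystem G H A b).length = 2 + m * 2 + n * 2 + n * (m * 2) + n * 2 := by
    simp [encodeSystem, length_encodeGroup, length_encodeMat, length_encodeVec]
    ring
  refine ⟨fun i => ?_, fun a k => ?_⟩
  · simp only [initial]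
    split_ifs
    · rw [Nat.abs_cast, hlen]; exact_mod_cast h2.trans Nat.lt_two_pow_self.le
    · simp
  · simp only [initial]
    split_ifs
    · by_cases hk : k.toNat < (encodeSystem G H A b).length
      · rw [List.getD_eq_getElem _ _ hk]
        refine (abs_le_of_mem_encodeSystem G H A b (List.getElem_mem hk)).trans ?_
        exact_mod_cast Nat.pow_le_pow_right two_pos h1
      · rw [List.getD_eq_default _ _ (not_lt.1 hk)]; simp
    · simp

end Bounds

theorem OutputsWithin.of_achieves {p : Program} {input output : List ℤ} {T : ℕ}
    (h : Achieves X R p (initial input) fun s => s.out = output) (hb : Bounded X (initial input))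
    (hT : p.steps R * (X.size + 1) ≤ T) : OutputsWithin p input output T := by
  obtain ⟨s, t, h1, h2, -, h3⟩ := h hb
  exact ⟨s, t, h1, h3, h2.trans hT⟩

/-- A polynomial bound for the running time of a program. -/
theorem exists_timeBound (p : Program) : ∃ T : MvPolynomial (Fin 6) ℕ,
    ∀ (m n : ℕ) (G : Fin m → Primitive) (H : Fin n → Primitive) (A : Matrix (Fin n) (Fin m) ℚ)
      (b : Fin n → ℚ),
      timeBound T G H A b =
        p.steps (3 * capacity m n (matBits A) (vecBits b) (charBits G) (charBits H) + 3) *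
          (capacity m n (matBits A) (vecBits b) (charBits G) (charBits H) + 2) := by
  obtain ⟨P, hP⟩ := p.exists_steps_eq_eval
  set c : MvPolynomial (Fin 6) ℕ := capacity (.X 0) (.X 1) (.X 2) (.X 3) (.X 4) (.X 5) with hc
  refine ⟨P.eval₂ MvPolynomial.C (3 * c + 3) * (c + 2), fun m n G H A b => ?_⟩
  have he : MvPolynomial.eval ![m, n, matBits A, vecBits b, charBits G, charBits H] c =
      capacity m n (matBits A) (vecBits b) (charBits G) (charBits H) := by
    simp [hc, capacity]
  have hC : (MvPolynomial.eval ![m, n, matBits A, vecBits b, charBits G, charBits H]).comp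
      MvPolynomial.C = RingHom.id ℕ := by ext; simp
  rw [timeBound, map_mul, Polynomial.hom_eval₂, hC, hP, Polynomial.eval₂_id, map_add, map_add,
    map_mul, he]
  simp

end LogRAM

theorem mainTheorem2 :
    ∃ (decider solver : LogRAM.Program) (T : MvPolynomial (Fin 6) ℕ),
      ∀ (m n : ℕ) (G : Fin m → Primitive) (H : Fin n → Primitive)
        (φ : ElementaryGroup G →ₜ+ ElementaryGroup H) (h : ElementaryGroup H)
        (A : Matrix (Fin n) (Fin m) ℚ) (b : Fin n → ℚ),
        IsMatrixRep φ (A.map fun q : ℚ => (q : ℝ)) →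
        TupleCongr H (fun j => (b j : ℝ)) h →
          -- the decision problem
          ((∃ x, φ x = h) →
            LogRAM.OutputsWithin decider (encodeSystem G H A b) [1] (timeBound T G H A b)) ∧
          ((¬ ∃ x, φ x = h) →
            LogRAM.OutputsWithin decider (encodeSystem G H A b) [0] (timeBound T G H A b)) ∧
          -- computing a general solution
          ((∃ x, φ x = h) →
            ∃ (r k : ℕ) (x₀ : Fin m → ℚ) (E : Matrix (Fin m) (Fin (r + k)) ℚ)
              (g₀ : ElementaryGroup G)
              (ε : ElementaryGroup (realIntFactors r k) →ₜ+ ElementaryGroup G),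
              IsGeneralSolution φ h g₀ ε ∧
              TupleCongr G (fun i => (x₀ i : ℝ)) g₀ ∧
              IsMatrixRep ε (E.map fun q : ℚ => (q : ℝ)) ∧
              LogRAM.OutputsWithin solver (encodeSystem G H A b) (encodeSolution x₀ E)
                (timeBound T G H A b)) ∧
          ((¬ ∃ x, φ x = h) →
            LogRAM.OutputsWithin solver (encodeSystem G H A b) [0] (timeBound T G H A b)) := by
  -- both programs obey the bound for their composition
  obtain ⟨T, hT⟩ := LogRAM.exists_timeBound (.seq LogRAM.decider LogRAM.solver)
  refine ⟨LogRAM.decider, LogRAM.solver, T, fun m n G H φ h A b hφ hb => ?_⟩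
  have hT' := hT m n G H A b
  set β := LogRAM.capacity m n (matBits A) (vecBits b) (charBits G) (charBits H) with hβ
  set L := (n * m + n + 1) * (matBits A + vecBits b + charBits H) with hL
  have hβ' : β = (m + n + 1) + 2 * (m + n + 1) * (m + n + 1) + 2 * (m + n + 1) * L + charBits G +
    (n + (m + n + 2) * (m + n + 2) + (m + ((m + n + 1) + (m + n + 1)) + 1) * (m + n + 1) +
      (2 + m * 2 + n * 2 + n * (m * 2) + n * 2)) + 5 := rfl
  have hbits : matBits A + vecBits b + charBits H ≤ L := by
    rw [hL]; exact Nat.le_mul_of_pos_left _ (Nat.succ_pos _)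
  have hL2 : L ≤ 2 * (m + n + 1) * L := Nat.le_mul_of_pos_left _ (by positivity)
  have hC : LogRAM.Capacity (2 ^ β) (3 * β + 3) n (m + n + 1) (2 ^ L) :=
    LogRAM.capacity_spec (by omega) (by omega) (by omega) (by omega)
  have hB : LogRAM.Bounded (2 ^ β) (LogRAM.initial (encodeSystem G H A b)) :=
    LogRAM.bounded_initial G H A b (by omega) (by omega)
  have hM := LogRAM.abs_systemMatrix_le H A b
  have hX : LogRAM.commonDen A b ≤ 2 ^ β := by
    refine (LogRAM.commonDen_le A b).trans (Nat.pow_le_pow_right two_pos ?_)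
    have : (n * m + n) * (matBits A + vecBits b) ≤ L :=
      Nat.mul_le_mul (Nat.le_succ _) (Nat.le_add_right _ _)
    omega
  have hsize : (2 ^ β).size + 1 = β + 2 := by rw [Nat.size_pow]
  have htime : ∀ p : LogRAM.Program,
      p.steps (3 * β + 3) ≤ (LogRAM.Program.seq LogRAM.decider LogRAM.solver).steps (3 * β + 3) →
      p.steps (3 * β + 3) * ((2 ^ β).size + 1) ≤ timeBound T G H A b := by
    intro p hp
    rw [hT', hsize]; exact Nat.mul_le_mul_right _ hp
  have hd := LogRAM.achieves_decider hC hX hM hφ hb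
  have hs := LogRAM.achieves_solver hC hX hM (by omega) hφ hb
  have htd := htime LogRAM.decider (Nat.le_add_right _ _)
  have hts := htime LogRAM.solver (Nat.le_add_left _ _)
  refine ⟨fun hx => ?_, fun hx => ?_, fun hx => ?_, fun hx => ?_⟩
  · exact .of_achieves (hd.mono fun s _ h => h.1 hx) hB htd
  · exact .of_achieves (hd.mono fun s _ h => h.2 hx) hB htd
  · obtain ⟨s, t, h1, h2, -, h3, -⟩ := hs hB
    obtain ⟨r, k, x₀, E, g₀, ε, h4, h5, h6, h7⟩ := h3 hx
    exact ⟨r, k, x₀, E, g₀, ε, h4, h5, h6, s, t, h1, h7, h2.trans hts⟩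
  · exact .of_achieves (hs.mono fun s _ h => h.2 hx) hB hts
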